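/- Let $K$ be a field. A \emph{planar tree} $\underline{G}$ is a finite tree $G$ together with, for each vertex $v$, a cyclic ordering of the edges incident to $v$; a \emph{Brauer tree} $(\underline{G},\underline{m})$ is a planar tree with positive integers $m_v$ (multiplicities), at most one of which differs from $1$. Let $H_{\underline{G}}$ be the set of symbols $(x|y)$, where $x,y$ are edges incident to a common vertex $v$ (the associated vertex) and $y$ is the successor of $x$ around $v$ (if there is just one edge $x$, there are two symbols $(x|x)$, one for each endpoint). The \emph{Brauer tree algebra} $\Lambda_{\underline{G},\underline{m}}$ is the quotient of the path algebra over $K$ of the quiver whose vertices are the edges of $G$ and whose arrows are $x\to y$ for $(x|y)\in H_{\underline{G}}$, by the relations: $(x\to y\to z)=0$ if the two arrows are associated to different endpoints of $y$, and $\rho_{x,u}^{m_u}=\rho_{x,v}^{m_v}$ for each edge $x$ with endpoints $u,v$, where $\rho_{x,v}$ is the simple cycle at $x$ around $v$. A subset $W\subseteq H_{\underline{G}}$ is \emph{special} if it contains no $(x|y),(y|z)$ whose associated vertices have different parity (odd distance in $G$). The enlarged Brauer tree $(\underline{G}^W,\underline{m}^W)$ is obtained by adding, for each $(x|y)\in W$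 with associated vertex $v$, a new edge joining $v$ to a new vertex of valency $1$ and multiplicity $1$, inserted between $x$ and $y$ in the cyclic ordering around $v$. Let $C=\Lambda_{\underline{G}^W,\underline{m}^W}$ and let $\Gamma^W_{\underline{G},\underline{m}}$ be the quotient of $C$ by the sum of the socles of the right modules $e_{(x|y)}C$, $(x|y)\in W$. A finite dimensional $K$-algebra $A$ is a \emph{special gendo-Brauer tree algebra associated to} $(\underline{G},\underline{m},W)$ if $W$ is special and $A$ is Morita equivalent to $\Gamma^W_{\underline{G},\underline{m}}$. The \emph{Gorenstein dimension} of $A$ is the common value of the left and the right injective dimension of the regular module, when these coincide; $A$ is \emph{Iwanaga--Gorenstein} if moreover it is finite. The \emph{dominant dimension} $\mathrm{domdim}\,A$ is the supremum of the $d\ge 0$ such that the first $d$ terms $I^0,\dots,I^{d-1}$ of the minimal injective coresolution of $A_A$ are projective. \textbf{Proposition.} Let $A$ be a special gendo-Brauer tree algebra associated to $(\underline{G},\underline{m},W)$. (1) Suppose that $A$ is not a symmetric algebra, and let $n$ be the number of isomorphism classes of simple $A$-modules. Then $\underline{G}^W$ has $n$ edges and has a clockwise Green's walk, i.e. a sequence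 $(v_0,x_1,v_1,x_2,\dots,x_{2n},v_{2n})$, indices modulo $2n$, such that $v_{i-1},v_i$ are the two endpoints of the edge $x_i$ and $x_{i+1}$ is the predecessor of $x_i$ around $v_i$. For every such walk, let $\omega$ be the set of indices $i$ such that $x_i=x_{i+1}$ is the new edge of an element of $W$ and $v_i$ is its new vertex, and for $i\in\omega$ let $\eta(i)$ be the first index in $\omega$ after $i$, cyclically (so $\eta(i)=i$ if $|\omega|=1$). Then $A$ has a well-defined Gorenstein dimension, $$\text{Gorenstein dimension of }A=\max\{\overline{\eta(i)-i}-2\mid i\in\omega\},\qquad \mathrm{domdim}\,A=\min\{\overline{\eta(i)-i}-2\mid i\in\omega\},$$ where $\overline{k}\in\{1,\dots,2n\}$ denotes the representative of $k$ modulo $2n$. (2) Every special gendo-Brauer tree algebra $A$ (symmetric or not) is Iwanaga--Gorenstein. (3) The Gorenstein dimension and the dominant dimension are independent of the exceptional multiplicity: if $A$ and $A'$ are special gendo-Brauer tree algebras over $K$ associated to $(\underline{G},\underline{m},W)$ and $(\underline{G},\underline{m}',W)$, they have the same Gorenstein dimension and the same dominant dimension. -/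

import Mathlib

universe u v w

open CategoryTheory

namespace GendoBrauer

/-! ### Planar trees and Brauer trees -/

/-- A planar tree: a finite tree together with, for each vertex, a cyclic ordering of the edges
incident to it. The incidence "the edge `x` at its endpoint `v`" is the dart of the tree that
starts at `v` and runs along `x`; `succ` sends it to the dart of the successor of `x` around `v`.
Being a cyclic ordering around every vertex means that the cycles of `succ` are exactly the sets
of darts starting at a given vertex. -/
structure PlanarTree (V : Type v) where
  graph : SimpleGraph V
  isTree : graph.IsTree
  succ : Equiv.Perm graph.Dart
  sameCycle_iff : ∀ h k : graph.Dart, succ.SameCycle h k ↔ h.fst = k.fst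

/-- A multiplicity function of a Brauer tree: positive, and different from `1` at no more than one
vertex. -/
def IsMultiplicity {V : Type v} (m : V → ℕ) : Prop :=
  (∀ a, 0 < m a) ∧ ∀ a b, m a ≠ 1 → m b ≠ 1 → a = b

/-- The set `H` of symbols `(x|y)`, where `y` is the successor of `x` around a common endpoint `a`,
is identified with the set of darts: `(x|y)`, with associated vertex `a`, is the dart `h` that
starts at `a` and runs along `x`, so that `y` is the edge of `succ h`. (If there is only one edge
`x`, the two darts are the two symbols `(x|x)`.)
A subset is special if it contains no `(x|y)` and `(y|z)` whose associated vertices have different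
parity, i.e. odd distance. -/
def PlanarTree.IsSpecial {V : Type v} (T : PlanarTree V) (W : Set T.graph.Dart) : Prop :=
  ∀ h ∈ W, ∀ k ∈ W, k.edge = (T.succ h).edge → Even (T.graph.dist h.fst k.fst)

/-- The combinatorial data from which the quiver and relations are read off: `H` is the set of
half-edges (pairs of an edge and one of its two ends), `opp` exchanges the two halves of an
edge, `succ` sends a half-edge to its successor in the cyclic ordering around its vertex (so the
vertices are the cycles of `succ`), and `mult` is the multiplicity of the vertex of a half-edge. -/
structure HalfEdgeData (H : Type v) where
  opp : H → H
  succ : Equiv.Perm H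
  mult : H → ℕ

/-- The half-edges of a Brauer tree are the darts of its underlying tree. -/
def PlanarTree.toHalfEdgeData {V : Type v} (T : PlanarTree V) (m : V → ℕ) :
    HalfEdgeData T.graph.Dart where
  opp := SimpleGraph.Dart.symm
  succ := T.succ
  mult h := m h.fst

namespace HalfEdgeData

variable {H : Type v}

/-- The set of edges. -/
def Edge (T : HalfEdgeData H) : Type v := Quot fun h k : H => k = T.opp h

/-- The edge containing a half-edge. -/
def edge (T : HalfEdgeData H) (h : H) : T.Edge := Quot.mk _ h

/-! ### Enlarging a planar tree by new leaves -/

open Classical in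
/-- The cyclic orderings of the enlarged tree: for each `h = (x|y)` in `W`, the new half-edge
`inr (inl h)` is inserted between `x` and `y`, while `inr (inr h)`, the other half of the new edge,
is alone at its (new) vertex. -/
noncomputable def enlargeSucc (T : HalfEdgeData H) (W : Set H) : Equiv.Perm (H ⊕ (W ⊕ W)) where
  toFun
    | .inl h => if hW : h ∈ W then .inr (.inl ⟨h, hW⟩) else .inl (T.succ h)
    | .inr (.inl h) => .inl (T.succ h)
    | .inr (.inr h) => .inr (.inr h)
  invFun
    | .inl h => if hW : T.succ.symm h ∈ W then .inr (.inl ⟨T.succ.symm h, hW⟩)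
        else .inl (T.succ.symm h)
    | .inr (.inl h) => .inl h
    | .inr (.inr h) => .inr (.inr h)
  left_inv := by
    rintro (h | h | h)
    · by_cases hW : h ∈ W <;> simp [hW]
    · simp
    · simp
  right_inv := by
    rintro (h | h | h)
    · by_cases hW : T.succ.symm h ∈ W <;> simp [hW]
    · simp
    · simp

/-- The enlarged tree: every element `h = (x|y)` of `W` contributes one new edge, with halves
`inr (inl h)` at the vertex associated to `(x|y)` and `inr (inr h)` at a new vertex of valency `1`
and multiplicity `1`. -/
noncomputable def enlarge (T : HalfEdgeData H) (W : Set H) : HalfEdgeData (H ⊕ (W ⊕ W)) where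
  opp
    | .inl h => .inl (T.opp h)
    | .inr (.inl h) => .inr (.inr h)
    | .inr (.inr h) => .inr (.inl h)
  succ := T.enlargeSucc W
  mult
    | .inl h => T.mult h
    | .inr (.inl h) => T.mult h
    | .inr (.inr _) => 1

/-! ### Brauer tree algebras -/

section Algebra

variable (K : Type u) [Field K] (T : HalfEdgeData H)

/-- The free algebra on the trivial paths `e_x` (one for each edge `x`) and the arrows
`(x → y)` (one for each half-edge `h = (x|y)`). -/
abbrev Free : Type (max u v) := FreeAlgebra K (T.Edge ⊕ H)

/-- The trivial path at the edge `x`. -/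
def gene (x : T.Edge) : T.Free K := FreeAlgebra.ι K (Sum.inl x)

/-- The arrow `(x → y)` for the half-edge `h = (x|y)`. -/
def gena (h : H) : T.Free K := FreeAlgebra.ι K (Sum.inr h)

/-- The simple cycle `(x → ⋯ → x)` around the vertex of the half-edge `h` of `x`. -/
noncomputable def rho (h : H) : T.Free K :=
  ((List.range (Function.minimalPeriod T.succ h)).map fun i => T.gena K (T.succ^[i] h)).prod

/-- The defining relations of the Brauer tree algebra. The first five present the path algebra of
the Brauer quiver, in which paths are multiplied from left to right; the last two are the Brauer
relations. -/
inductive Rel : T.Free K → T.Free K → Prop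
  | idem (x : T.Edge) : Rel (T.gene K x * T.gene K x) (T.gene K x)
  | orth (x y : T.Edge) (hxy : x ≠ y) : Rel (T.gene K x * T.gene K y) 0
  | one : Rel (∑ᶠ x : T.Edge, T.gene K x) 1
  | source (h : H) : Rel (T.gene K (T.edge h) * T.gena K h) (T.gena K h)
  | target (h : H) : Rel (T.gena K h * T.gene K (T.edge (T.succ h))) (T.gena K h)
  -- `(x → y → z) = 0` if the two arrows belong to different endpoints of `y`
  | turn (h : H) : Rel (T.gena K h * T.gena K (T.opp (T.succ h))) 0
  | cycle (h : H) : Rel (T.rho K h ^ T.mult h) (T.rho K (T.opp h) ^ T.mult (T.opp h))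

/-- The (basic) Brauer tree algebra. -/
def BrauerAlgebra : Type (max u v) := RingQuot (Rel K T)

noncomputable instance : Ring (T.BrauerAlgebra K) := inferInstanceAs (Ring (RingQuot (Rel K T)))

noncomputable instance : Algebra K (T.BrauerAlgebra K) :=
  inferInstanceAs (Algebra K (RingQuot (Rel K T)))

/-- The idempotent `e_x` of the Brauer tree algebra. -/
noncomputable def idemp (x : T.Edge) : T.BrauerAlgebra K :=
  RingQuot.mkAlgHom K (Rel K T) (T.gene K x)

end Algebra

end HalfEdgeData

/-- The socle of the right ideal `eC`: the sum of all simple right submodules of `eC`. -/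
def socleOf {C : Type w} [Ring C] (e : C) : Submodule Cᵐᵒᵖ C :=
  sSup {S | IsSimpleModule Cᵐᵒᵖ S ∧ S ≤ Submodule.span Cᵐᵒᵖ {e}}

namespace PlanarTree

variable (K : Type u) [Field K] {V : Type v} (T : PlanarTree V) (m : V → ℕ) (W : Set T.graph.Dart)

/-- The enlarged Brauer tree. -/
noncomputable abbrev enlarged : HalfEdgeData (T.graph.Dart ⊕ (W ⊕ W)) :=
  (T.toHalfEdgeData m).enlarge W

/-- The sum of the socles of the right modules `e_{(x|y)} C`, for `(x|y)` in `W`, where `C` is the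
Brauer tree algebra of the enlarged Brauer tree. -/
noncomputable def leafSocles : Submodule ((T.enlarged m W).BrauerAlgebra K)ᵐᵒᵖ
    ((T.enlarged m W).BrauerAlgebra K) :=
  ⨆ h : W, socleOf ((T.enlarged m W).idemp K ((T.enlarged m W).edge (.inr (.inl h))))

/-- The quotient of the Brauer tree algebra `C` of the enlarged Brauer tree by the (two-sided ideal
generated by the) sum of the socles of the `e_{(x|y)} C`, for `(x|y)` in `W`. -/
def GendoAlgebra : Type (max u v) :=
  RingQuot fun a b : (T.enlarged m W).BrauerAlgebra K => a ∈ T.leafSocles K m W ∧ b = 0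

noncomputable instance : Ring (T.GendoAlgebra K m W) := inferInstanceAs (Ring (RingQuot _))

noncomputable instance : Algebra K (T.GendoAlgebra K m W) :=
  inferInstanceAs (Algebra K (RingQuot _))

/-- `A` is a special gendo-Brauer tree algebra associated to the Brauer tree `(T, m)` and the
special subset `W`. -/
structure IsSpecialGendoBrauer (A : Type w) [Ring A] [Algebra K A] : Prop where
  special : T.IsSpecial W
  morita : IsMoritaEquivalent K A (T.GendoAlgebra K m W)

end PlanarTree

/-! ### Green's walk -/

/-- A clockwise Green's walk `(v_0, x_1, v_1, x_2, …, x_{2n}, v_{2n})` around a planar tree with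
`n` edges, with indices in `ℤ/2n`. It is recorded by its half-edges: `g i` is the half of `x_i` at
`v_i`. As `x_{i+1}` is the predecessor of `x_i` around `v_i`, its half at `v_i` is the
predecessor of `g i`, and its half at `v_{i+1}` is the opposite of that. -/
def IsGreenWalk {H : Type v} (T : HalfEdgeData H) (n : ℕ) (g : ZMod (2 * n) → H) : Prop :=
  Nat.card T.Edge = n ∧ ∀ i, g (i + 1) = T.opp (T.succ.symm (g i))

/-- The set `ω` of the indices `i` that correspond to elements of `W`: the walk runs along the new
edge `x_i = x_{i+1}` of an element of `W`, and `v_i` is the new leaf vertex of this edge. -/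
def omega {H : Type v} {W : Set H} {N : ℕ} (g : ZMod N → H ⊕ (W ⊕ W)) : Set (ZMod N) :=
  {i | ∃ h : W, g i = .inr (.inr h)}

/-- `η(i)`: the first index after `i` (cyclically) that lies in `S`. -/
noncomputable def eta {N : ℕ} (S : Set (ZMod N)) (i : ZMod N) : ZMod N :=
  i + ((sInf {k : ℕ | 0 < k ∧ i + (k : ZMod N) ∈ S} : ℕ) : ZMod N)

/-- The representative of a residue class modulo `N` in `{1, …, N}`. -/
def bar {N : ℕ} (z : ZMod N) : ℕ := if z = 0 then N else z.val

/-- The set of the numbers `bar (η(i) - i) - 2` with `i ∈ ω`. -/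
def gaps {H : Type v} {W : Set H} {N : ℕ} (g : ZMod N → H ⊕ (W ⊕ W)) : Set ℕ :=
  {d | ∃ i ∈ omega g, d = bar (eta (omega g) i - i) - 2}

/-! ### Notions for finite dimensional algebras -/

section Notions

variable (A : Type w) [Ring A]

/-- A symmetric algebra: there is a linear form on `A` with `t (a b) = t (b a)` whose kernel
contains no nonzero one-sided ideal. (For finite dimensional `A` this says `A ≅ Hom_K(A, K)` as
bimodules.) -/
def IsSymmetricAlgebra (K : Type u) [Field K] [Algebra K A] : Prop :=
  ∃ t : A →ₗ[K] K, (∀ a b, t (a * b) = t (b * a)) ∧ ∀ a, (∀ b, t (a * b) = 0) → a = 0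

/-- The number of isomorphism classes of simple right modules. Each of these is isomorphic to the
quotient of `A` by a maximal right ideal. -/
noncomputable def numSimples : ℕ :=
  Nat.card (Quot fun I J : {I : Submodule Aᵐᵒᵖ A // IsCoatom I} =>
    Nonempty ((A ⧸ I.1) ≃ₗ[Aᵐᵒᵖ] (A ⧸ J.1)))

/-- The left and the right injective dimension of the regular module coincide, and their common
value, the Gorenstein dimension of `A`, is `d`. -/
def HasGorensteinDim (d : WithBot ℕ∞) : Prop :=
  injectiveDimension (ModuleCat.of Aᵐᵒᵖ A) = d ∧ injectiveDimension (ModuleCat.of A A) = d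

/-- `A` is Iwanaga-Gorenstein: its Gorenstein dimension is finite. -/
def IsIwanagaGorenstein : Prop := ∃ d : WithBot ℕ∞, d ≠ ⊤ ∧ HasGorensteinDim A d

variable {A} in
/-- An injective coresolution `0 → M → I⁰ → I¹ → ⋯` is minimal if the kernel of each `Iⁿ → Iⁿ⁺¹`
(which is the image of the preceding map) is an essential submodule of `Iⁿ`. -/
def IsMinimal {M : ModuleCat.{w} A} (I : InjectiveResolution M) : Prop :=
  ∀ (n : ℕ) (L : Submodule A (I.cocomplex.X n)),
    L ⊓ LinearMap.ker (I.cocomplex.d n (n + 1)).hom = ⊥ → L = ⊥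

variable {A} in
/-- The dominant dimension of a module: the supremum of the numbers `n` such that the first `n`
terms `I⁰, …, Iⁿ⁻¹` of its minimal injective coresolution (unique up to isomorphism) are
projective. -/
noncomputable def moduleDomDim (M : ModuleCat.{w} A) : ℕ∞ :=
  sSup {c | ∃ n : ℕ, c = n ∧ ∃ I : InjectiveResolution M, IsMinimal I ∧
    ∀ j < n, Module.Projective A (I.cocomplex.X j)}

/-- The dominant dimension of `A`: that of the regular right module. -/
noncomputable def domDim : ℕ∞ := moduleDomDim (ModuleCat.of Aᵐᵒᵖ A)

end Notions

end GendoBrauer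

/-! Let `C` be the Brauer tree algebra of the enlarged tree, `L` the set of half-edges at the new
leaves and `Γ` the quotient. Compose paths from right to left, so that `a h` is an arrow from the
edge of `h` to the edge of `succ h`. Then `C` is symmetric: it carries a trace form `t` that is `1`
on the full cycles and `0` on all other paths. The form is obtained from a representation by
polynomial matrices (`exists_brauer_form`), and its nondegeneracy is `eq_zero_of_t_eq_zero`. At a
new leaf the socle is spanned by the loop (`mem_socleOf_leaf`), so `Γ` is `C` modulo the span of
these loops (`isLeafQuotient_gendoMk`).

The annihilator of an arrow is generated by an arrow (`exists_eq_mul_of_mul_a_eq_zero`). This gives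
exact sequences `0 → C a_q → C e_q → C a_q' → 0` with `q' = succ⁻¹ (opp q)`, so that passing from
`q` to `q'` is a step of Green's walk. When no half of the edge of `q` lies in `L`, the middle term
is projective and injective over `Γ`. For `h` in `L`, the projective `Γ e_h` is isomorphic to `C
a_q` with `q = succ⁻¹ (opp h)`. Splicing the sequences follows Green's walk from the leaf of `h` to
the next leaf, where the last term is injective but not projective (`injective_arrowMod`,
`not_projective_arrowMod`). Hence the injective and the dominant dimension of `Γ e_h` both equal the
return time of the walk to `L` minus two (`dimensions_arrowMod`). The remaining indecomposable
projectives are injective, so the regular module takes the maximum and the minimum over `L`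
(`regular_iff`).

The opposite algebra has the same shape with all cyclic orders reversed (`IsLeafQuotient.op`). Its
walk runs backwards and has the same set of return times (`returnTime_image_rev`), so left and right
injective dimensions agree. Since every edge of a tree is a bridge, Green's walk is one cycle
through all half-edges (`symm_mem_of_step_mem`, `exists_iterate_green_eq`), and the return times are
the gaps of any walk (`gaps_eq`). Its length is right because simple modules correspond to edges
(`numSimples_eq_card_edge`).

To pass from `Γ` to `A`, the properties involved are shown to be closed under sums and retracts, and
a Morita equivalence matches the additive closures of the regular modules. An equivalence of left
modules yields one of right modules through full corner rings (`exists_equivalence_op`). Minimal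
coresolutions are traded for the recursive condition `HasDomDimGE` (`moduleDomDim_eq`). If `W` is
empty then `Γ` is `C`, and `A` is symmetric by `IsSymmetricAlgebra.of_isMoritaEquivalent`; so a
non-symmetric `A` has `W` nonempty. Return times do not involve multiplicities, which gives the
independence statement. -/

namespace GendoBrauer

/-! ### Properties closed under sums and retracts -/

section Additive

open Limits ZeroObject

variable {C : Type u} [Category.{v} C] [Preadditive C]

/-- A property that holds for zero objects and is inherited by biproducts and by retracts. -/
structure IsAddClosed [HasBinaryBiproducts C] [HasZeroObject C] (P : C → Prop) : Prop where
  zero : P 0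
  biprod : ∀ X Y, P X → P Y → P (X ⊞ Y)
  retract : ∀ X Y, Retract X Y → P Y → P X

/-- Partial sums of the identity factor through iterated binary biproducts, so `Y` becomes a retract
of a biproduct of the `X i`. -/
lemma IsAddClosed.of_sum_comp_eq_id [HasBinaryBiproducts C] [HasZeroObject C] {P : C → Prop}
    (hP : IsAddClosed P) {ι : Type*} (s : Finset ι) (X : ι → C) (hX : ∀ i ∈ s, P (X i)) {Y : C}
    (f : ∀ i, Y ⟶ X i) (g : ∀ i, X i ⟶ Y) (h : ∑ i ∈ s, f i ≫ g i = 𝟙 Y) : P Y := by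
  classical
  have key : ∀ t ⊆ s, ∃ (B : C) (F : Y ⟶ B) (G : B ⟶ Y), P B ∧ F ≫ G = ∑ i ∈ t, f i ≫ g i := by
    intro t
    induction t using Finset.induction_on with
    | empty => intro _; exact ⟨0, 0, 0, hP.zero, by simp⟩
    | insert a t ha ih =>
      intro hs
      obtain ⟨B, F, G, hB, hFG⟩ := ih fun i hi => hs (Finset.mem_insert_of_mem hi)
      refine ⟨X a ⊞ B, biprod.lift (f a) F, biprod.desc (g a) G,
        hP.biprod _ _ (hX a (hs (Finset.mem_insert_self a t))) hB, ?_⟩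
      rw [biprod.lift_desc, hFG, Finset.sum_insert ha]
  obtain ⟨B, F, G, hB, hFG⟩ := key s subset_rfl
  exact hP.retract Y B ⟨F, G, hFG.trans h⟩ hB

/-- `Y` is a direct summand of a finite sum of copies of `X`. -/
def InAdd (X Y : C) : Prop :=
  ∃ (κ : Type) (_ : Fintype κ) (f : κ → (Y ⟶ X)) (g : κ → (X ⟶ Y)), ∑ i, f i ≫ g i = 𝟙 Y

lemma IsAddClosed.of_inAdd [HasBinaryBiproducts C] [HasZeroObject C] {P : C → Prop}
    (hP : IsAddClosed P) {X Y : C} (h : InAdd X Y)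
    (hX : P X) : P Y := by
  obtain ⟨κ, _, f, g, hfg⟩ := h
  exact hP.of_sum_comp_eq_id Finset.univ (fun _ => X) (fun _ _ => hX) f g hfg

lemma InAdd.map {D : Type*} [Category D] [Preadditive D] (F : C ⥤ D) [F.Additive] {X Y : C}
    (h : InAdd X Y) : InAdd (F.obj X) (F.obj Y) := by
  obtain ⟨κ, _, f, g, hfg⟩ := h
  refine ⟨κ, inferInstance, fun i => F.map (f i), fun i => F.map (g i), ?_⟩
  rw [← F.map_id, ← hfg, F.map_sum]
  simp

lemma InAdd.of_iso {X X' Y Y' : C} (e : X ≅ X') (e' : Y ≅ Y') (h : InAdd X Y) : InAdd X' Y' := by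
  obtain ⟨κ, _, f, g, hfg⟩ := h
  refine ⟨κ, inferInstance, fun i => e'.inv ≫ f i ≫ e.hom, fun i => e.inv ≫ g i ≫ e'.hom, ?_⟩
  have : ∀ i, (e'.inv ≫ f i ≫ e.hom) ≫ e.inv ≫ g i ≫ e'.hom = e'.inv ≫ (f i ≫ g i) ≫ e'.hom := by
    intro i; simp
  simp_rw [this, ← Preadditive.comp_sum, ← Preadditive.sum_comp, hfg]
  simp

lemma InAdd.refl (X : C) : InAdd X X := ⟨Unit, inferInstance, fun _ => 𝟙 X, fun _ => 𝟙 X, by simp⟩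

lemma InAdd.biprod [HasBinaryBiproducts C] {X Y Z : C} (hY : InAdd X Y) (hZ : InAdd X Z) :
    InAdd X (Y ⊞ Z) := by
  obtain ⟨κ, _, f, g, h⟩ := hY
  obtain ⟨κ', _, f', g', h'⟩ := hZ
  refine ⟨κ ⊕ κ', inferInstance, Sum.elim (fun i => biprod.fst ≫ f i) fun i => biprod.snd ≫ f' i,
    Sum.elim (fun i => g i ≫ biprod.inl) fun i => g' i ≫ biprod.inr, ?_⟩
  have h1 : ∀ i, ((biprod.fst : Y ⊞ Z ⟶ Y) ≫ f i) ≫ g i ≫ (biprod.inl : Y ⟶ Y ⊞ Z) =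
      biprod.fst ≫ (f i ≫ g i) ≫ biprod.inl := fun i => by simp
  have h2 : ∀ i, ((biprod.snd : Y ⊞ Z ⟶ Z) ≫ f' i) ≫ g' i ≫ (biprod.inr : Z ⟶ Y ⊞ Z) =
      biprod.snd ≫ (f' i ≫ g' i) ≫ biprod.inr := fun i => by simp
  simp only [Fintype.sum_sum_type, Sum.elim_inl, Sum.elim_inr, h1, h2, ← Preadditive.comp_sum,
    ← Preadditive.sum_comp, h, h', Category.id_comp]
  exact biprod.total

end Additive

/-! ### Dominant dimension through short exact sequences -/

section DominantDimension

open Limits ZeroObject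

variable {C : Type u} [Category.{v} C] [Abelian C]

/-- `X` has dominant dimension at least `n`: it has a coresolution whose first `n` terms are
projective and injective. -/
def HasDomDimGE : ℕ → C → Prop
  | 0, _ => True
  | n + 1, X => ∃ S : ShortComplex C, S.ShortExact ∧ Nonempty (S.X₁ ≅ X) ∧ Injective S.X₂ ∧
      Projective S.X₂ ∧ HasDomDimGE n S.X₃

lemma HasDomDimGE.of_shortExact {n : ℕ} {S : ShortComplex C} (hS : S.ShortExact)
    (hi : Injective S.X₂) (hp : Projective S.X₂) (h : HasDomDimGE n S.X₃) :
    HasDomDimGE (n + 1) S.X₁ := ⟨S, hS, ⟨Iso.refl _⟩, hi, hp, h⟩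

lemma HasDomDimGE.of_iso {n : ℕ} {X Y : C} (e : X ≅ Y) (h : HasDomDimGE n X) :
    HasDomDimGE n Y := by
  cases n with
  | zero => trivial
  | succ n =>
    obtain ⟨S, hS, ⟨e'⟩, h⟩ := h
    exact ⟨S, hS, ⟨e' ≪≫ e⟩, h⟩

lemma hasDomDimGE_of_injective_of_projective (n : ℕ) (X : C) [hi : Injective X]
    [hp : Projective X] : HasDomDimGE n X := by
  induction n generalizing X with
  | zero => trivial
  | succ n ih =>
    refine ⟨ShortComplex.mk (𝟙 X) (0 : X ⟶ 0) (by simp), ?_, ⟨Iso.refl _⟩, hi, hp, ih 0⟩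
    have : Epi (0 : X ⟶ 0) := ⟨fun _ _ _ => (isZero_zero C).eq_of_src _ _⟩
    exact { exact := (ShortComplex.exact_iff_epi _ rfl).2 (by dsimp; infer_instance)
            mono_f := by dsimp; infer_instance
            epi_g := by dsimp; infer_instance }

lemma HasDomDimGE.biprod {n : ℕ} {X Y : C} (hX : HasDomDimGE n X) (hY : HasDomDimGE n Y) :
    HasDomDimGE n (X ⊞ Y) := by
  induction n generalizing X Y with
  | zero => trivial
  | succ n ih =>
    obtain ⟨S, hS, ⟨e⟩, _, _, h⟩ := hX
    obtain ⟨S', hS', ⟨e'⟩, _, _, h'⟩ := hY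
    have := hS.mono_f
    have := hS'.mono_f
    have := hS.epi_g
    have := hS'.epi_g
    refine ⟨ShortComplex.mk (biprod.map S.f S'.f) (biprod.map S.g S'.g) (by ext <;> simp), ?_,
      ⟨biprod.mapIso e e'⟩, inferInstance, ⟨?_⟩, ih h h'⟩
    · exact { exact := by
                refine ShortComplex.exact_of_f_is_kernel _ (KernelFork.IsLimit.ofι' _ _ ?_)
                intro A k hk
                have h1 : (k ≫ biprod.fst) ≫ S.g = 0 := by
                  have := congrArg (· ≫ biprod.fst) hk
                  simpa using this
                have h2 : (k ≫ biprod.snd) ≫ S'.g = 0 := by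
                  have := congrArg (· ≫ biprod.snd) hk
                  simpa using this
                refine ⟨biprod.lift (hS.exact.lift _ h1) (hS'.exact.lift _ h2), ?_⟩
                ext <;> simp
              mono_f := by dsimp; infer_instance
              epi_g := by dsimp; infer_instance }
    · intro E Z f g _
      refine ⟨biprod.desc (Projective.factorThru (biprod.inl ≫ f) g)
        (Projective.factorThru (biprod.inr ≫ f) g), ?_⟩
      ext <;> simp

/-- Embed `Y` in the first term `I` of the coresolution of `X`. The cokernel is a retract of the
biproduct of the cosyzygy of `X` and `I`, so the induction continues. -/
lemma HasDomDimGE.retract {n : ℕ} {X Y : C} (r : Retract Y X) (hX : HasDomDimGE n X) :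
    HasDomDimGE n Y := by
  induction n generalizing X Y with
  | zero => trivial
  | succ n ih =>
    obtain ⟨S, hS, ⟨e⟩, hi, hp, h⟩ := hX
    have := hS.mono_f
    have := hS.epi_g
    have hm : Mono (r.i ≫ e.inv ≫ S.f) := inferInstance
    set j := r.i ≫ e.inv ≫ S.f with hj
    set T := ShortComplex.mk j (cokernel.π j) (by simp) with hT
    have hTe : T.ShortExact := { exact := ShortComplex.exact_cokernel j }
    refine ⟨T, hTe, ⟨Iso.refl _⟩, hi, hp, ?_⟩
    -- This extends the idempotent of `X` with image `Y`. Then `1 - α` vanishes on `Y` and descends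
    -- to the cokernel.
    let α : S.X₂ ⟶ S.X₂ := Injective.factorThru (e.hom ≫ r.r ≫ j) S.f
    have hα : S.f ≫ α = e.hom ≫ r.r ≫ j := Injective.comp_factorThru _ _
    have hjα : j ≫ α = j := by
      rw [hj, Category.assoc, Category.assoc, hα]; simp [hj]
    let δ : cokernel j ⟶ S.X₂ := cokernel.desc j (𝟙 _ - α) (by simp [Preadditive.comp_sub, hjα])
    have hδ : cokernel.π j ≫ δ = 𝟙 _ - α := cokernel.π_desc _ _ _
    let a : S.X₃ ⟶ cokernel j := hS.exact.desc (α ≫ cokernel.π j) (by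
      rw [← Category.assoc, hα]; simp)
    have ha : S.g ≫ a = α ≫ cokernel.π j := hS.exact.g_desc _ _
    let π : cokernel j ⟶ S.X₃ := cokernel.desc j S.g (by simp [hj])
    have hπ : cokernel.π j ≫ π = S.g := cokernel.π_desc _ _ _
    have hid : π ≫ a + δ ≫ cokernel.π j = 𝟙 (cokernel j) := by
      rw [← cancel_epi (cokernel.π j), Preadditive.comp_add, ← Category.assoc, hπ, ha,
        ← Category.assoc, hδ, Preadditive.sub_comp]
      simp
    exact ih (X := S.X₃ ⊞ S.X₂) ⟨biprod.lift π δ, biprod.desc a (cokernel.π j), by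
      rw [biprod.lift_desc]; exact hid⟩ (h.biprod (hasDomDimGE_of_injective_of_projective n S.X₂))

lemma HasDomDimGE.isAddClosed (n : ℕ) : IsAddClosed (HasDomDimGE n (C := C)) where
  zero := hasDomDimGE_of_injective_of_projective n 0
  biprod _ _ := HasDomDimGE.biprod
  retract _ _ r := HasDomDimGE.retract r

/-- Comparison of two coresolutions with injective middle terms. -/
lemma HasDomDimGE.of_two_shortExact {n : ℕ} {S T : ShortComplex C} (hS : S.ShortExact)
    (hT : T.ShortExact) (e : S.X₁ ≅ T.X₁) (hSi : Injective S.X₂) (hTi : Injective T.X₂)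
    (hTp : Projective T.X₂) (h : HasDomDimGE n S.X₃) : HasDomDimGE n T.X₃ := by
  have := hS.mono_f
  have := hT.mono_f
  have := hS.epi_g
  have := hT.epi_g
  let α : S.X₂ ⟶ T.X₂ := Injective.factorThru (e.hom ≫ T.f) S.f
  have hα : S.f ≫ α = e.hom ≫ T.f := Injective.comp_factorThru _ _
  let β : T.X₂ ⟶ S.X₂ := Injective.factorThru (e.inv ≫ S.f) T.f
  have hβ : T.f ≫ β = e.inv ≫ S.f := Injective.comp_factorThru _ _
  let δ : T.X₃ ⟶ T.X₂ := hT.exact.desc (𝟙 _ - β ≫ α) (by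
    rw [Preadditive.comp_sub, ← Category.assoc, hβ, Category.assoc, hα]; simp)
  have hδ : T.g ≫ δ = 𝟙 _ - β ≫ α := hT.exact.g_desc _ _
  let b : T.X₃ ⟶ S.X₃ := hT.exact.desc (β ≫ S.g) (by rw [← Category.assoc, hβ]; simp)
  have hb : T.g ≫ b = β ≫ S.g := hT.exact.g_desc _ _
  let a : S.X₃ ⟶ T.X₃ := hS.exact.desc (α ≫ T.g) (by rw [← Category.assoc, hα]; simp)
  have ha : S.g ≫ a = α ≫ T.g := hS.exact.g_desc _ _
  -- A Schanuel argument: it exhibits `T.X₃` as a retract of `S.X₃ ⊞ T.X₂`.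
  have hid : b ≫ a + δ ≫ T.g = 𝟙 T.X₃ := by
    rw [← cancel_epi T.g, Preadditive.comp_add, ← Category.assoc, hb, Category.assoc, ha,
      ← Category.assoc (T.g), hδ, Preadditive.sub_comp]
    simp
  exact HasDomDimGE.retract (X := S.X₃ ⊞ T.X₂) ⟨biprod.lift b δ, biprod.desc a T.g, by
    rw [biprod.lift_desc]; exact hid⟩ (h.biprod (hasDomDimGE_of_injective_of_projective n T.X₂))

lemma HasDomDimGE.map {D : Type*} [Category D] [Abelian D] (F : C ⥤ D) [F.Additive]
    [PreservesFiniteLimits F] [PreservesFiniteColimits F] [F.PreservesInjectiveObjects]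
    [F.PreservesProjectiveObjects] {n : ℕ} {X : C} (h : HasDomDimGE n X) :
    HasDomDimGE n (F.obj X) := by
  induction n generalizing X with
  | zero => trivial
  | succ n ih =>
    obtain ⟨S, hS, ⟨e⟩, hi, hp, h⟩ := h
    exact ⟨S.map F, hS.map_of_exact F, ⟨F.mapIso e⟩, F.injective_obj S.X₂,
      F.projective_obj S.X₂, ih h⟩

end DominantDimension

end GendoBrauer

namespace GendoBrauer

/-! ### Injective dimension as an additively closed property. -/

section InjectiveDimension

open Limits ZeroObject

lemma hasInjectiveDimensionLT_isAddClosed {C : Type u} [Category.{v} C] [Abelian C] (n : ℕ) :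
    IsAddClosed (fun X : C => HasInjectiveDimensionLT X n) where
  zero := hasInjectiveDimensionLT_of_ge 0 0 n n.zero_le
  biprod _ _ _ _ := inferInstance
  retract _ _ r _ := r.hasInjectiveDimensionLT n

end InjectiveDimension

/-! ### Injective hulls and minimal injective coresolutions -/

section Hull

variable {R : Type u} [Ring R]

/-- `M` is an essential submodule of `E`. -/
def IsEssentialIn {J : Type v} [AddCommGroup J] [Module R J] (M E : Submodule R J) : Prop :=
  M ≤ E ∧ ∀ L ≤ E, L ⊓ M = ⊥ → L = ⊥

lemma exists_maximal_isEssentialIn {J : Type v} [AddCommGroup J] [Module R J]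
    (M : Submodule R J) : ∃ E, Maximal (IsEssentialIn M) E := by
  obtain ⟨E, -, hE⟩ := zorn_le_nonempty₀ {E | IsEssentialIn M E} (fun c hc hchain y hy => by
    refine ⟨sSup c, ⟨(hc hy).1.trans (le_sSup hy), fun L hL hLM => ?_⟩, fun z hz => le_sSup hz⟩
    rw [eq_bot_iff]
    intro x hx
    obtain ⟨E, hEc, hxE⟩ := (Submodule.mem_sSup_of_directed ⟨y, hy⟩ hchain.directedOn).1 (hL hx)
    -- Essentiality in the union of the chain can be tested on a cyclic submodule, which already
    -- lies in one member.
    have : Submodule.span R {x} = ⊥ := (hc hEc).2 _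
      (by rwa [Submodule.span_singleton_le_iff_mem]) (by
        rw [eq_bot_iff, ← hLM]
        exact inf_le_inf_right _ (by rwa [Submodule.span_singleton_le_iff_mem]))
    rw [← this]
    exact Submodule.mem_span_singleton_self x) M ⟨le_rfl, fun L hL h => by
      rwa [inf_eq_left.2 hL] at h⟩
  exact ⟨E, hE⟩

lemma exists_maximal_disjoint {J : Type v} [AddCommGroup J] [Module R J]
    (E : Submodule R J) : ∃ E', Maximal (fun L => L ⊓ E = ⊥) E' := by
  obtain ⟨E', -, hE'⟩ := zorn_le_nonempty₀ {L | L ⊓ E = ⊥} (fun c hc hchain y hy => by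
    refine ⟨sSup c, ?_, fun z hz => le_sSup hz⟩
    rw [Set.mem_ofPred_eq, eq_bot_iff]
    rintro x ⟨hx, hxE⟩
    obtain ⟨L, hLc, hxL⟩ := (Submodule.mem_sSup_of_directed ⟨y, hy⟩ hchain.directedOn).1 hx
    rw [← hc hLc]
    exact ⟨hxL, hxE⟩) ⊥ (by simp)
  exact ⟨E', hE'⟩

/-- A maximal essential extension inside an injective module is a direct summand. -/
lemma exists_projection_of_maximal_isEssentialIn [Small.{v} R] {J : Type v} [AddCommGroup J]
    [Module R J] [Module.Injective R J] {M E : Submodule R J} (hE : Maximal (IsEssentialIn M) E) :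
    ∃ f : J →ₗ[R] E, f ∘ₗ E.subtype = LinearMap.id := by
  obtain ⟨E', hE'⟩ := exists_maximal_disjoint E
  let q : E →ₗ[R] J ⧸ E' := E'.mkQ ∘ₗ E.subtype
  have hq : Function.Injective q := by
    rw [← LinearMap.ker_eq_bot, eq_bot_iff]
    intro x hx
    have hx' : (x : J) ∈ E' ⊓ E := ⟨by simpa [q] using hx, x.2⟩
    rw [hE'.1] at hx'
    simpa using hx'
  have hess : ∀ L : Submodule R (J ⧸ E'), L ⊓ LinearMap.range q = ⊥ → L = ⊥ := by
    intro L hL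
    have h1 : L.comap E'.mkQ ⊓ E = ⊥ := by
      rw [eq_bot_iff]
      rintro x ⟨hx, hxE⟩
      have : E'.mkQ x ∈ L ⊓ LinearMap.range q := ⟨hx, ⟨x, hxE⟩, rfl⟩
      rw [hL, Submodule.mem_bot, Submodule.mkQ_apply, Submodule.Quotient.mk_eq_zero] at this
      have hh : x ∈ E' ⊓ E := ⟨this, hxE⟩
      rwa [hE'.1] at hh
    have h2 : L.comap E'.mkQ ≤ E' := hE'.2 h1 (E'.le_comap_mkQ L)
    rw [eq_bot_iff]
    intro x hx
    obtain ⟨y, rfl⟩ := E'.mkQ_surjective x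
    simpa using h2 hx
  -- Extend the inclusion of `E` along the essential embedding `q` of `E` into `J ⧸ E'`. The
  -- extension is injective on `E`, hence injective.
  obtain ⟨g, hg⟩ := Module.Injective.extension_property R J _ _ q hq E.subtype
  have hgE : ∀ x : E, g (q x) = x := fun x => LinearMap.congr_fun hg x
  have hgi : LinearMap.ker g = ⊥ := hess _ (by
    rw [eq_bot_iff]
    rintro _ ⟨hx, ⟨y, rfl⟩⟩
    have : (y : J) = 0 := by rw [← hgE y]; exact hx
    rw [Submodule.coe_eq_zero] at this
    simp [this])
  have hle : E ≤ LinearMap.range g := fun x hx => ⟨q ⟨x, hx⟩, hgE ⟨x, hx⟩⟩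
  -- The range of `g` is again essential over `M`, so maximality of `E` forces it back into `E`;
  -- thus `g` after the quotient map is a retraction.
  have hrange : LinearMap.range g ≤ E := hE.2 ⟨hE.1.1.trans hle, fun L hL hLM => by
    have h1 : L ⊓ E = ⊥ := hE.1.2 _ inf_le_right (by
      rw [eq_bot_iff, ← hLM]; exact inf_le_inf_right _ inf_le_left)
    have h2 : L.comap g = ⊥ := hess _ (by
      rw [eq_bot_iff]
      rintro _ ⟨hx, ⟨y, rfl⟩⟩
      have : (y : J) ∈ L ⊓ E := ⟨by rw [← hgE y]; exact hx, y.2⟩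
      rw [h1, Submodule.mem_bot, Submodule.coe_eq_zero] at this
      simp [this])
    rw [eq_bot_iff]
    intro x hx
    obtain ⟨y, rfl⟩ := hL hx
    have : y ∈ L.comap g := hx
    rw [h2, Submodule.mem_bot] at this
    simp [this]⟩ hle
  refine ⟨LinearMap.codRestrict E (g ∘ₗ E'.mkQ) fun x => hrange ⟨_, rfl⟩, ?_⟩
  ext x
  exact hgE x

lemma exists_injective_hull [Small.{v} R] (M : ModuleCat.{v} R) :
    ∃ (I : ModuleCat.{v} R) (i : M ⟶ I), Mono i ∧ Injective I ∧
      ∀ L : Submodule R I, L ⊓ LinearMap.range i.hom = ⊥ → L = ⊥ := by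
  obtain ⟨J, hJ, f, hf⟩ := EnoughInjectives.presentation M
  rw [ModuleCat.mono_iff_injective] at hf
  have := Module.injective_module_of_injective_object R J
  obtain ⟨E, hE⟩ := exists_maximal_isEssentialIn (LinearMap.range f.hom)
  obtain ⟨p, hp⟩ := exists_projection_of_maximal_isEssentialIn hE
  have hr : Retract (ModuleCat.of R E) J :=
    ⟨ModuleCat.ofHom E.subtype, ModuleCat.ofHom p, by rw [← ModuleCat.ofHom_comp, hp]; rfl⟩
  refine ⟨ModuleCat.of R E, ModuleCat.ofHom (LinearMap.codRestrict E f.hom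
    fun x => hE.1.1 ⟨x, rfl⟩), ?_, ?_, fun L hL => ?_⟩
  · rw [ModuleCat.mono_iff_injective]
    intro x y hxy
    exact hf (congrArg Subtype.val hxy)
  · have : HasInjectiveDimensionLT (ModuleCat.of R E) 1 := hr.hasInjectiveDimensionLT 1
    infer_instance
  · have h1 : L.map E.subtype = ⊥ := hE.1.2 _ (Submodule.map_subtype_le E L) (by
      rw [eq_bot_iff]
      rintro _ ⟨⟨y, hy, rfl⟩, ⟨m, hm⟩⟩
      have : y ∈ L ⊓ LinearMap.range (ModuleCat.ofHom (LinearMap.codRestrict E f.hom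
          fun x => hE.1.1 ⟨x, rfl⟩)).hom := ⟨hy, m, Subtype.ext hm⟩
      rw [hL, Submodule.mem_bot] at this
      simp [this])
    exact Submodule.map_injective_of_injective E.subtype_injective (by rw [h1, Submodule.map_bot])

/-- An injective essential extension embeds into every injective object that contains the same
subobject, and so splits off the projective `S.X₂`. -/
lemma projective_of_essential {S T : ShortComplex (ModuleCat.{v} R)} (hS : S.ShortExact)
    (e : S.X₁ ≅ T.X₁) (hi : Injective S.X₂) (hp : Projective S.X₂) (hT : Mono T.f)
    (hTi : Injective T.X₂) (hess : ∀ L : Submodule R T.X₂, L ⊓ LinearMap.range T.f.hom = ⊥ → L = ⊥) :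
    Projective T.X₂ := by
  have hSm := hS.mono_f
  let α : T.X₂ ⟶ S.X₂ := Injective.factorThru (e.inv ≫ S.f) T.f
  have hα : T.f ≫ α = e.inv ≫ S.f := Injective.comp_factorThru _ _
  have hαm : Mono α := by
    rw [ModuleCat.mono_iff_injective, ← LinearMap.ker_eq_bot]
    refine hess _ ?_
    rw [eq_bot_iff]
    rintro _ ⟨hx, ⟨y, rfl⟩⟩
    have h1 : (e.inv ≫ S.f).hom y = 0 := by
      rw [← hα]
      exact hx
    have h2 : Mono (e.inv ≫ S.f) := inferInstance
    rw [ModuleCat.mono_iff_injective] at h2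
    rw [h2 (h1.trans (map_zero _).symm), map_zero]
    exact Submodule.zero_mem _
  exact Retract.projective (Y := S.X₂)
    ⟨α, Injective.factorThru (𝟙 _) α, Injective.comp_factorThru _ _⟩

variable [Small.{v} R] (M : ModuleCat.{v} R)

/-- An injective hull of `M`. -/
noncomputable def hull : ModuleCat.{v} R := (exists_injective_hull M).choose

/-- The embedding into the injective hull. -/
noncomputable def toHull : M ⟶ hull M := (exists_injective_hull M).choose_spec.choose

instance : Mono (toHull M) := (exists_injective_hull M).choose_spec.choose_spec.1

instance : Injective (hull M) := (exists_injective_hull M).choose_spec.choose_spec.2.1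

lemma toHull_essential (L : Submodule R (hull M)) (h : L ⊓ LinearMap.range (toHull M).hom = ⊥) :
    L = ⊥ := (exists_injective_hull M).choose_spec.choose_spec.2.2 L h

/-- The cosyzygies in the minimal injective coresolution. -/
noncomputable def cosyzygy : ℕ → ModuleCat.{v} R
  | 0 => M
  | n + 1 => Limits.cokernel (toHull (cosyzygy n))

/-- The projection onto the next cosyzygy. -/
noncomputable def toCosyzygy (n : ℕ) : hull (cosyzygy M n) ⟶ cosyzygy M (n + 1) :=
  Limits.cokernel.π (toHull (cosyzygy M n))

instance (n : ℕ) : Epi (toCosyzygy M n) :=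
  inferInstanceAs (Epi (Limits.cokernel.π (toHull (cosyzygy M n))))

lemma toHull_comp_toCosyzygy (n : ℕ) : toHull (cosyzygy M n) ≫ toCosyzygy M n = 0 :=
  Limits.cokernel.condition _

lemma toCosyzygy_exact (n : ℕ) :
    (ShortComplex.mk _ _ (toHull_comp_toCosyzygy M n)).Exact :=
  ShortComplex.exact_cokernel (toHull (cosyzygy M n))

/-- The differentials of the minimal injective coresolution. -/
noncomputable def minimalD (n : ℕ) : hull (cosyzygy M n) ⟶ hull (cosyzygy M (n + 1)) :=
  toCosyzygy M n ≫ toHull (cosyzygy M (n + 1))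

lemma toHull_comp_minimalD (n : ℕ) : toHull (cosyzygy M n) ≫ minimalD M n = 0 := by
  rw [minimalD, ← Category.assoc, toHull_comp_toCosyzygy, Limits.zero_comp]

lemma minimalD_comp (n : ℕ) : minimalD M n ≫ minimalD M (n + 1) = 0 := by
  rw [minimalD, Category.assoc, toHull_comp_minimalD, Limits.comp_zero]

lemma toHull_exact (n : ℕ) :
    (ShortComplex.mk _ _ (toHull_comp_minimalD M n)).Exact := by
  let α : ShortComplex.mk _ _ (toHull_comp_toCosyzygy M n) ⟶
      ShortComplex.mk _ _ (toHull_comp_minimalD M n) :=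
    { τ₁ := 𝟙 _
      τ₂ := 𝟙 _
      τ₃ := toHull (cosyzygy M (n + 1))
      comm₂₃ := Category.id_comp _ }
  have : Epi α.τ₁ := inferInstanceAs (Epi (𝟙 _))
  have : IsIso α.τ₂ := inferInstanceAs (IsIso (𝟙 _))
  have : Mono α.τ₃ := inferInstanceAs (Mono (toHull (cosyzygy M (n + 1))))
  rw [← ShortComplex.exact_iff_of_epi_of_isIso_of_mono α]
  exact toCosyzygy_exact M n

lemma minimalD_exact (n : ℕ) : (ShortComplex.mk _ _ (minimalD_comp M n)).Exact := by
  let α : ShortComplex.mk _ _ (minimalD_comp M n) ⟶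
      ShortComplex.mk _ _ (toHull_comp_minimalD M (n + 1)) :=
    { τ₁ := toCosyzygy M n
      τ₂ := 𝟙 _
      τ₃ := 𝟙 _
      comm₁₂ := (Category.comp_id _).symm }
  have : Epi α.τ₁ := inferInstanceAs (Epi (toCosyzygy M n))
  have : IsIso α.τ₂ := inferInstanceAs (IsIso (𝟙 _))
  have : Mono α.τ₃ := inferInstanceAs (Mono (𝟙 _))
  rw [ShortComplex.exact_iff_of_epi_of_isIso_of_mono α]
  exact toHull_exact M (n + 1)

/-- The minimal injective coresolution as a complex. -/
noncomputable def minimalCocomplex : CochainComplex (ModuleCat.{v} R) ℕ :=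
  CochainComplex.of (fun n => hull (cosyzygy M n)) (minimalD M) (minimalD_comp M)

lemma minimalCocomplex_d (n : ℕ) : (minimalCocomplex M).d n (n + 1) = minimalD M n := by
  unfold minimalCocomplex
  exact CochainComplex.of_d (fun n => hull (cosyzygy M n)) (minimalD M) n

lemma minimalCocomplex_exactAt_succ (n : ℕ) : (minimalCocomplex M).ExactAt (n + 1) := by
  rw [HomologicalComplex.exactAt_iff' _ n (n + 1) (n + 1 + 1) (by simp) (by simp)]
  have h : (minimalCocomplex M).sc' n (n + 1) (n + 1 + 1) =
      ShortComplex.mk _ _ (minimalD_comp M n) := by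
    simp only [HomologicalComplex.sc', HomologicalComplex.shortComplexFunctor',
      minimalCocomplex_d]
    rfl
  rw [h]
  exact minimalD_exact M n

/-- The minimal injective coresolution. -/
noncomputable def minimalResolution : InjectiveResolution M where
  cocomplex := minimalCocomplex M
  injective n := inferInstanceAs (Injective (hull (cosyzygy M n)))
  ι := (CochainComplex.fromSingle₀Equiv _ _).symm ⟨toHull M, by
    rw [minimalCocomplex_d]; exact toHull_comp_minimalD M 0⟩
  quasiIso := ⟨fun n => by
    cases n
    · rw [CochainComplex.quasiIsoAt₀_iff, ShortComplex.quasiIso_iff_of_zeros]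
      · refine (ShortComplex.exact_and_mono_f_iff_of_iso ?_).2
          ⟨toHull_exact M 0, by dsimp; exact inferInstanceAs (Mono (toHull M))⟩
        exact ShortComplex.isoMk (Iso.refl _) (Iso.refl _) (Iso.refl _) (by simp; rfl)
          (by simp; exact (minimalCocomplex_d M 0).symm)
      all_goals rfl
    · rw [quasiIsoAt_iff_exactAt]
      · apply minimalCocomplex_exactAt_succ
      · apply CochainComplex.exactAt_succ_single_obj⟩

end Hull

/-! ### Dominant dimension without minimal coresolutions. -/

section DomDim

open Limits

variable {R : Type v} [Ring R] {M : ModuleCat.{v} R}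

lemma minimalResolution_isMinimal (M : ModuleCat.{v} R) : IsMinimal (minimalResolution M) := by
  intro n L hL
  have hd : (minimalResolution M).cocomplex.d n (n + 1) = minimalD M n := minimalCocomplex_d M n
  refine toHull_essential (cosyzygy M n) L ?_
  refine Eq.trans ?_ hL
  rw [hd]
  congr 1
  exact (LinearMap.exact_iff.1 ((ShortComplex.ShortExact.moduleCat_exact_iff_function_exact _).1
    (toHull_exact M n))).symm

/-- The `n`-th step of an injective coresolution as a short complex. -/
noncomputable def stepComplex (I : InjectiveResolution M) (n : ℕ) :
    ShortComplex (ModuleCat.{v} R) :=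
  ShortComplex.mk (kernel.ι (I.cocomplex.d n (n + 1)))
    (kernel.lift (I.cocomplex.d (n + 1) (n + 2)) (I.cocomplex.d n (n + 1)) (by simp))
    (by rw [← cancel_mono (kernel.ι _)]; simp)

lemma stepComplex_shortExact (I : InjectiveResolution M) (n : ℕ) :
    (stepComplex I n).ShortExact where
  mono_f := equalizer.ι_mono
  exact := by
    have : Mono (stepComplex I n).f := equalizer.ι_mono
    refine ShortComplex.exact_of_f_is_kernel _ (KernelFork.IsLimit.ofι' _ _ ?_)
    intro A k hk
    refine ⟨kernel.lift _ k ?_, kernel.lift_ι _ _ _⟩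
    have := congrArg (· ≫ kernel.ι _) hk
    refine Eq.trans ?_ (this.trans zero_comp)
    refine Eq.trans ?_ (Category.assoc _ _ _).symm
    exact congrArg (k ≫ ·) (kernel.lift_ι _ _ _).symm
  epi_g := (I.exact_succ n).epi_kernelLift

lemma hasDomDimGE_kernel_of_projective (I : InjectiveResolution M) (n k : ℕ)
    (h : ∀ j, k ≤ j → j < k + n → Projective (I.cocomplex.X j)) :
    HasDomDimGE n (kernel (I.cocomplex.d k (k + 1))) := by
  induction n generalizing k with
  | zero => trivial
  | succ n ih =>
    exact HasDomDimGE.of_shortExact (stepComplex_shortExact I k) (I.injective k)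
      (h k le_rfl (by omega)) (ih (k + 1) fun j h1 h2 => h j (by omega) (by omega))

lemma range_stepComplex_f (I : InjectiveResolution M) (n : ℕ) :
    LinearMap.range (stepComplex I n).f.hom = LinearMap.ker (I.cocomplex.d n (n + 1)).hom := by
  refine le_antisymm ?_ fun x hx => ?_
  · rintro _ ⟨y, rfl⟩
    exact congrArg (fun f => f.hom y) (kernel.condition (I.cocomplex.d n (n + 1)))
  · refine ((ShortComplex.ShortExact.moduleCat_exact_iff_function_exact _).1
      (stepComplex_shortExact I n).exact x).1 ?_
    have hm : Mono (kernel.ι (I.cocomplex.d (n + 1) (n + 2))) := equalizer.ι_mono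
    rw [ModuleCat.mono_iff_injective] at hm
    apply hm
    have h2 := congrArg (fun f => f.hom x)
      (kernel.lift_ι (I.cocomplex.d (n + 1) (n + 2)) (I.cocomplex.d n (n + 1)) (by simp))
    exact (h2.trans hx).trans (map_zero _).symm

/-- Minimality makes each term an injective hull of the kernel it contains, hence a summand of any
projective-injective module containing that kernel. Comparing the two cosyzygies allows the
induction to proceed. -/
lemma projective_of_hasDomDimGE_kernel {I : InjectiveResolution M} (hI : IsMinimal I) (n k : ℕ)
    (h : HasDomDimGE n (kernel (I.cocomplex.d k (k + 1)))) :
    ∀ j, k ≤ j → j < k + n → Projective (I.cocomplex.X j) := by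
  induction n generalizing k with
  | zero => intro j h1 h2; omega
  | succ n ih =>
    obtain ⟨S, hS, ⟨e⟩, hi, hp, h⟩ := h
    have hT := stepComplex_shortExact I k
    have hTp : Projective (stepComplex I k).X₂ :=
      projective_of_essential hS e hi hp hT.mono_f (I.injective k) fun L hL =>
        hI k L (by rw [← range_stepComplex_f]; exact hL)
    intro j h1 h2
    rcases h1.eq_or_lt with rfl | h1
    · exact hTp
    · exact ih (k + 1) (HasDomDimGE.of_two_shortExact hS hT e hi (I.injective k) hTp h) j h1
        (by omega)

lemma projective_iff_hasDomDimGE {I : InjectiveResolution M} (hI : IsMinimal I) (n : ℕ) :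
    (∀ j < n, Projective (I.cocomplex.X j)) ↔ HasDomDimGE n M := by
  have e : M ≅ kernel (I.cocomplex.d 0 1) :=
    I.isLimitKernelFork.conePointUniqueUpToIso
      (limit.isLimit (parallelPair (I.cocomplex.d 0 1) 0))
  constructor
  · intro h
    exact (hasDomDimGE_kernel_of_projective I n 0 fun j _ hj => h j (by omega)).of_iso e.symm
  · intro h j hj
    exact projective_of_hasDomDimGE_kernel hI n 0 (h.of_iso e) j (Nat.zero_le _) (by omega)

/-- From here on only the recursive condition is needed: minimal coresolutions exist, and each of
them detects `HasDomDimGE` in its projective terms. -/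
lemma moduleDomDim_eq (M : ModuleCat.{v} R) :
    moduleDomDim M = sSup {c : ℕ∞ | ∃ n : ℕ, c = n ∧ HasDomDimGE n M} := by
  unfold moduleDomDim
  refine congrArg (sSup : Set ℕ∞ → ℕ∞) (Set.ext fun c => ?_)
  refine exists_congr fun n => and_congr_right fun _ => ?_
  have hp : ∀ (I : InjectiveResolution M) (j : ℕ),
      Module.Projective R (I.cocomplex.X j) ↔ Projective (I.cocomplex.X j) := fun I j =>
    IsProjective.iff_projective (I.cocomplex.X j)
  simp only [hp]
  constructor
  · rintro ⟨I, hI, h⟩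
    exact (projective_iff_hasDomDimGE hI n).1 h
  · intro h
    exact ⟨minimalResolution M, minimalResolution_isMinimal M,
      (projective_iff_hasDomDimGE (minimalResolution_isMinimal M) n).2 h⟩

/-- Morita equivalences live in a larger universe than the regular modules. Downwards, the lift of
an injective hull is still essential and injective, hence projective, and projectivity descends
along `ULift`. -/
lemma hasDomDimGE_uliftFunctor_iff (n : ℕ) (M : ModuleCat.{v} R) :
    HasDomDimGE n ((ModuleCat.uliftFunctor.{w} R).obj M) ↔ HasDomDimGE n M := by
  refine ⟨fun h => ?_, fun h => h.map _⟩
  induction n generalizing M with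
  | zero => trivial
  | succ n ih =>
    obtain ⟨S, hS, ⟨e⟩, hi, hp, h⟩ := h
    let T : ShortComplex (ModuleCat.{v} R) := ShortComplex.mk _ _ (toHull_comp_toCosyzygy M 0)
    have hT : T.ShortExact :=
      { exact := toCosyzygy_exact M 0
        mono_f := inferInstanceAs (Mono (toHull M))
        epi_g := inferInstanceAs (Epi (toCosyzygy M 0)) }
    have hTi : Injective T.X₂ := inferInstanceAs (Injective (hull M))
    have hU := hT.map_of_exact (ModuleCat.uliftFunctor.{w} R)
    have hUi : Injective (T.map (ModuleCat.uliftFunctor.{w} R)).X₂ :=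
      (ModuleCat.uliftFunctor.{w} R).injective_obj T.X₂
    have hUp : Projective (T.map (ModuleCat.uliftFunctor.{w} R)).X₂ := by
      refine projective_of_essential hS e hi hp hU.mono_f hUi fun L hL => ?_
      have h1 : L.comap (ULift.moduleEquiv (R := R)).symm.toLinearMap = ⊥ := by
        refine toHull_essential M _ ?_
        rw [eq_bot_iff]
        rintro _ ⟨hx, ⟨y, rfl⟩⟩
        have h2 : (ULift.up ((toHull M).hom y) : ULift.{w} (hull M)) ∈
            L ⊓ LinearMap.range (T.map (ModuleCat.uliftFunctor.{w} R)).f.hom :=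
          ⟨hx, ⟨ULift.up y, rfl⟩⟩
        rw [hL] at h2
        exact congrArg ULift.down ((Submodule.mem_bot _).1 h2)
      rw [eq_bot_iff]
      rintro ⟨x⟩ hx
      have : x ∈ L.comap (ULift.moduleEquiv (R := R)).symm.toLinearMap := hx
      rw [h1, Submodule.mem_bot] at this
      rw [this]
      exact Submodule.zero_mem _
    have hTp : Projective T.X₂ := by
      have h1 : Projective (ModuleCat.of R (ULift.{w} T.X₂)) := hUp
      rw [← IsProjective.iff_projective] at h1
      have : Module.Projective R T.X₂ := Module.Projective.of_equiv (ULift.moduleEquiv (R := R))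
      exact (IsProjective.iff_projective T.X₂).1 this
    exact HasDomDimGE.of_shortExact hT hTi hTp
      (ih _ (HasDomDimGE.of_two_shortExact hS hU e hi hUi hUp h))

end DomDim

end GendoBrauer

namespace GendoBrauer

/-! ### Corner rings of full idempotents -/

section Corner

universe r s t

variable {R : Type r} [Ring R] {S : Type s} [Ring S]

/-- `ι` identifies `S` with the corner ring `e R e`, where `e = ι 1` is a full idempotent. -/
structure IsFullCorner (ι : S →ₙ+* R) : Prop where
  injective : Function.Injective ι
  exists_eq : ∀ r, ∃ s, ι s = ι 1 * r * ι 1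
  full : ∃ (κ : Type) (_ : Fintype κ) (a b : κ → R), ∑ i, a i * ι 1 * b i = 1

variable (ι : S →ₙ+* R)

/-- The part `e X` of an `R`-module on which `e` acts as the identity. -/
def cornerPart (X : Type*) [AddCommGroup X] [Module R X] : AddSubgroup X where
  carrier := {x | ι 1 • x = x}
  add_mem' hx hy := by
    rw [Set.mem_ofPred_eq] at *
    rw [smul_add, hx, hy]
  zero_mem' := smul_zero _
  neg_mem' hx := by
    rw [Set.mem_ofPred_eq] at *
    rw [smul_neg, hx]

section

variable {ι} {X Y : Type*} [AddCommGroup X] [Module R X] [AddCommGroup Y] [Module R Y]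

lemma mem_cornerPart {x : X} : x ∈ cornerPart ι X ↔ ι 1 • x = x := Iff.rfl

lemma corner_smul_mem (s : S) (x : X) : ι s • x ∈ cornerPart ι X := by
  rw [mem_cornerPart, smul_smul, ← map_mul, one_mul]

instance : SMul S (cornerPart ι X) := ⟨fun s x => ⟨ι s • (x : X), corner_smul_mem s _⟩⟩

lemma coe_corner_smul (s : S) (x : cornerPart ι X) : ((s • x : cornerPart ι X) : X) = ι s • (x : X) :=
  rfl

instance : Module S (cornerPart ι X) where
  one_smul x := Subtype.ext x.2
  mul_smul a b x := Subtype.ext (by simp [coe_corner_smul, mul_smul])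
  smul_zero a := Subtype.ext (by simp [coe_corner_smul])
  smul_add a x y := Subtype.ext (by simp [coe_corner_smul])
  add_smul a b x := Subtype.ext (by simp [coe_corner_smul, add_smul])
  zero_smul x := Subtype.ext (by simp [coe_corner_smul])

variable (ι) in
/-- The map induced on the corner parts. -/
def cornerMap (f : X →ₗ[R] Y) : cornerPart ι X →ₗ[S] cornerPart ι Y where
  toFun x := ⟨f x, by rw [mem_cornerPart, ← map_smul, x.2]⟩
  map_add' x y := Subtype.ext (by simp)
  map_smul' s x := Subtype.ext (by simp [coe_corner_smul])

lemma coe_cornerMap (f : X →ₗ[R] Y) (x : cornerPart ι X) : (cornerMap ι f x : Y) = f x := rfl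

lemma cornerMap_injective (h : IsFullCorner ι) {f g : X →ₗ[R] Y}
    (hfg : cornerMap ι f = cornerMap ι g) : f = g := by
  obtain ⟨κ, _, a, b, hab⟩ := h.full
  ext x
  rw [← one_smul R x, ← hab, Finset.sum_smul, map_sum, map_sum]
  refine Finset.sum_congr rfl fun i _ => ?_
  rw [mul_assoc, mul_smul, mul_smul, map_smul f, map_smul g]
  congr 1
  exact congrArg Subtype.val (LinearMap.congr_fun hfg ⟨ι 1 • b i • x, corner_smul_mem _ _⟩)

/-- Write `1 = ∑ aᵢ e bᵢ`. An `R`-linear extension of `φ` must send `x` to `∑ aᵢ φ (e bᵢ x)`; that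
this is `R`-linear follows from linearity of `φ` over `e R e`, after inserting the same
decomposition of `1` once more. -/
lemma cornerMap_surjective (h : IsFullCorner ι) (φ : cornerPart ι X →ₗ[S] cornerPart ι Y) :
    ∃ f : X →ₗ[R] Y, cornerMap ι f = φ := by
  obtain ⟨κ, _, a, b, hab⟩ := h.full
  let p : R → X → cornerPart ι X := fun r x => ⟨ι 1 • r • x, corner_smul_mem _ _⟩
  have hp : ∀ r r' x, (φ (p (r * ι 1 * r') x) : Y) = (ι 1 * r * ι 1) • (φ (p r' x) : Y) := by
    intro r r' x
    obtain ⟨s, hs⟩ := h.exists_eq r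
    have : p (r * ι 1 * r') x = s • p r' x := by
      refine Subtype.ext ?_
      change ι 1 • (r * ι 1 * r') • x = ι s • ι 1 • r' • x
      rw [hs, smul_smul, smul_smul, smul_smul]
      have h1 : ι 1 * ι 1 = ι 1 := by rw [← map_mul, one_mul]
      congr 1
      simp only [mul_assoc]
      rw [← mul_assoc (ι 1) (ι 1) r', h1]
    rw [this, map_smul, coe_corner_smul, hs]
  have hadd : ∀ r x y, p r (x + y) = p r x + p r y := fun r x y => Subtype.ext (by simp [p])
  have hsum : ∀ (r : R) (x : X), (φ (p r x) : Y) =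
      ∑ j, (φ (p (r * a j * ι 1 * b j) x) : Y) := by
    intro r x
    have : p r x = ∑ j, p (r * a j * ι 1 * b j) x := by
      refine Subtype.ext ?_
      rw [AddSubgroup.val_finsetSum]
      change ι 1 • r • x = ∑ j, ι 1 • (r * a j * ι 1 * b j) • x
      rw [← Finset.smul_sum, ← Finset.sum_smul]
      simp only [mul_assoc]
      rw [← Finset.mul_sum]
      simp only [← mul_assoc]
      rw [hab, mul_one]
    rw [this, map_sum, AddSubgroup.val_finsetSum]
  refine ⟨{ toFun := fun x => ∑ i, a i • (φ (p (b i) x) : Y)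
            map_add' := fun x y => by
              simp only [hadd, map_add, AddSubgroup.coe_add, smul_add, Finset.sum_add_distrib]
            map_smul' := fun r x => ?_ }, ?_⟩
  · have h1 : ∀ i, (φ (p (b i) (r • x)) : Y) =
        ∑ j, (ι 1 * (b i * r * a j) * ι 1) • (φ (p (b j) x) : Y) := by
      intro i
      have : p (b i) (r • x) = p (b i * r) x := Subtype.ext (by simp [p, mul_smul])
      rw [this, hsum]
      exact Finset.sum_congr rfl fun j _ => hp _ _ _
    simp only [h1, Finset.smul_sum, RingHom.id_apply]
    rw [Finset.sum_comm]
    refine Finset.sum_congr rfl fun j _ => ?_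
    have h2 : ∀ i, a i • (ι 1 * (b i * r * a j) * ι 1) • (φ (p (b j) x) : Y) =
        (a i * ι 1 * b i) • (r * a j) • (φ (p (b j) x) : Y) := by
      intro i
      conv_rhs => rw [← (φ (p (b j) x)).2]
      simp only [smul_smul, mul_assoc]
    simp only [h2]
    rw [← Finset.sum_smul, hab, one_smul, mul_smul]
  · ext x
    rw [coe_cornerMap]
    change ∑ i, a i • (φ (p (b i) x) : Y) = φ x
    have h1 : ∀ i, (φ (p (b i) (x : X)) : Y) = ι 1 • b i • (φ x : Y) := by
      intro i
      have h2 : p (b i) (x : X) = p (1 * ι 1 * b i * ι 1 * 1) (x : X) := by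
        refine Subtype.ext ?_
        change ι 1 • b i • (x : X) = ι 1 • (1 * ι 1 * b i * ι 1 * 1) • (x : X)
        rw [mul_one, one_mul, mul_smul _ (ι 1), x.2, smul_smul, smul_smul, ← mul_assoc, ← map_mul,
          one_mul]
      have h3 : p 1 (x : X) = x := by
        refine Subtype.ext ?_
        change ι 1 • (1 : R) • (x : X) = x
        rw [one_smul, x.2]
      rw [h2, hp, h3, mul_smul, (φ x).2, one_mul, ← mul_assoc, ← map_mul, one_mul, mul_smul]
    simp only [h1]
    conv_rhs => rw [← one_smul R (φ x : Y), ← hab, Finset.sum_smul]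
    simp only [mul_smul]

end

/-- The module `Hom_S(e R, N)`. -/
def Coind (N : Type*) [AddCommGroup N] [Module S N] : AddSubgroup (R → N) where
  carrier := {f | (∀ x y, f (x + y) = f x + f y) ∧ ∀ s x, f (ι s * x) = s • f x}
  add_mem' {f g} hf hg := ⟨fun x y => by simp only [Pi.add_apply, hf.1, hg.1]; abel,
    fun s x => by simp only [Pi.add_apply, hf.2, hg.2, smul_add]⟩
  zero_mem' := ⟨fun x y => by simp, fun s x => by simp⟩
  neg_mem' {f} hf := ⟨fun x y => by simp only [Pi.neg_apply, hf.1]; abel,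
    fun s x => by simp only [Pi.neg_apply, hf.2, smul_neg]⟩

section

variable {ι} {N : Type t} [AddCommGroup N] [Module S N]

instance : SMul R (Coind ι N) := ⟨fun r f => ⟨fun x => f.1 (x * r),
  fun x y => by beta_reduce; rw [add_mul, f.2.1],
  fun s x => by beta_reduce; rw [mul_assoc, f.2.2]⟩⟩

lemma coind_smul_apply (r : R) (f : Coind ι N) (x : R) : (r • f).1 x = f.1 (x * r) := rfl

lemma coind_map_zero (f : Coind ι N) : f.1 0 = 0 := by
  have := f.2.1 0 0
  rwa [add_zero, left_eq_add] at this

instance : Module R (Coind ι N) where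
  one_smul f := Subtype.ext (funext fun x => by rw [coind_smul_apply, mul_one])
  mul_smul a b f := Subtype.ext (funext fun x => by simp only [coind_smul_apply, mul_assoc])
  smul_zero a := rfl
  smul_add a x y := rfl
  add_smul a b f := Subtype.ext (funext fun x => by
    rw [coind_smul_apply, mul_add, f.2.1]; rfl)
  zero_smul f := Subtype.ext (funext fun x => by
    rw [coind_smul_apply, mul_zero, coind_map_zero]; rfl)

/-- The corner part of `Hom_S(e R, N)` is `Hom_S(e R e, N)`, which is `N` by evaluation at `1`. This
supplies essential surjectivity of the corner functor. -/
lemma exists_cornerPart_coind_equiv (h : IsFullCorner ι) :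
    Nonempty (cornerPart ι (Coind ι N) ≃ₗ[S] N) := by
  have hS : ∀ s : S, ι 1 * ι s = ι s := fun s => by rw [← map_mul, one_mul]
  have hS' : ∀ s : S, ι s * ι 1 = ι s := fun s => by rw [← map_mul, mul_one]
  have hf : ∀ (f : cornerPart ι (Coind ι N)) x, f.1.1 (x * ι 1) = f.1.1 x := fun f x =>
    congrFun (congrArg Subtype.val f.2) x
  choose c hc using h.exists_eq
  let F : cornerPart ι (Coind ι N) →ₗ[S] N :=
    { toFun := fun f => f.1.1 1
      map_add' := fun f g => rfl
      map_smul' := fun s f => by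
        change f.1.1 (1 * ι s) = s • f.1.1 1
        rw [← f.1.2.2, one_mul, mul_one] }
  refine ⟨LinearEquiv.ofBijective F ⟨?_, ?_⟩⟩
  · rw [← LinearMap.ker_eq_bot, LinearMap.ker_eq_bot']
    intro f hf0
    refine Subtype.ext (Subtype.ext (funext fun x => ?_))
    change f.1.1 x = 0
    have h1 : f.1.1 (ι 1 * x) = f.1.1 x := by rw [f.1.2.2, one_smul]
    rw [← h1, ← hf f, ← hc, ← mul_one (ι _), f.1.2.2]
    have : f.1.1 1 = 0 := hf0
    rw [this, smul_zero]
  · intro n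
    refine ⟨⟨⟨fun x => c x • n, fun x y => ?_, fun s x => ?_⟩, ?_⟩, ?_⟩
    · beta_reduce
      rw [← add_smul]
      congr 1
      apply h.injective
      rw [map_add, hc, hc, hc]
      simp [mul_add, add_mul]
    · beta_reduce
      rw [smul_smul]
      congr 1
      apply h.injective
      rw [map_mul, hc, hc]
      simp only [← mul_assoc, hS, hS']
    · refine Subtype.ext (funext fun x => ?_)
      change c (x * ι 1) • n = c x • n
      congr 1
      apply h.injective
      rw [hc, hc]
      simp only [mul_assoc, hS]
    · change c 1 • n = n
      have : c 1 = 1 := h.injective (by rw [hc, mul_one, hS])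
      rw [this, one_smul]

end

/-- The functor `X ↦ e X`. -/
def cornerFunctor : ModuleCat.{t} R ⥤ ModuleCat.{t} S where
  obj X := ModuleCat.of S (cornerPart ι X)
  map f := ModuleCat.ofHom (cornerMap ι f.hom)

variable {ι}

lemma cornerFunctor_isEquivalence (h : IsFullCorner ι) :
    (cornerFunctor.{r, s, max r t} ι).IsEquivalence where
  faithful := ⟨fun {X Y f g} hfg => by
    ext1
    exact cornerMap_injective h (congrArg ModuleCat.Hom.hom hfg)⟩
  full := ⟨fun {X Y} φ => by
    obtain ⟨f, hf⟩ := cornerMap_surjective h φ.hom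
    exact ⟨ModuleCat.ofHom f, ModuleCat.hom_ext hf⟩⟩
  essSurj := ⟨fun N => by
    obtain ⟨e⟩ := exists_cornerPart_coind_equiv (N := N) h
    exact ⟨ModuleCat.of R (Coind ι N), ⟨e.toModuleIso⟩⟩⟩

end Corner

/-! ### Endomorphism rings of progenerators -/

section Endomorphisms

variable {C : Type u} [Category.{v} C] [Preadditive C]

/-- The embedding `End X → End Z` given by a retract `X` of `Z`. -/
def endCorner {X Z : C} (r : Retract X Z) : End X →ₙ+* End Z where
  toFun f := r.r ≫ f ≫ r.i
  map_mul' f g := by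
    change r.r ≫ (g ≫ f) ≫ r.i = (r.r ≫ g ≫ r.i) ≫ r.r ≫ f ≫ r.i
    simp
  map_zero' := by simp
  map_add' f g := (congrArg (r.r ≫ ·) (Preadditive.add_comp X X Z f g r.i)).trans
    (Preadditive.comp_add _ _ _ r.r _ _)

lemma isFullCorner_endCorner {X Z : C} (r : Retract X Z) (h : InAdd X Z) :
    IsFullCorner (endCorner r) where
  injective f g hfg := by
    have h1 : r.r ≫ f ≫ r.i = r.r ≫ g ≫ r.i := hfg
    have h2 := congrArg (fun k => r.i ≫ k ≫ r.r) h1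
    simpa using h2
  exists_eq k := by
    refine ⟨r.i ≫ k ≫ r.r, ?_⟩
    change r.r ≫ (r.i ≫ k ≫ r.r) ≫ r.i = (r.r ≫ 𝟙 X ≫ r.i) ≫ k ≫ r.r ≫ 𝟙 X ≫ r.i
    simp
  full := by
    obtain ⟨κ, _, f, g, hfg⟩ := h
    refine ⟨κ, inferInstance, fun i => r.r ≫ g i, fun i => f i ≫ r.i, ?_⟩
    change ∑ i, (f i ≫ r.i) ≫ (r.r ≫ 𝟙 X ≫ r.i) ≫ r.r ≫ g i = 𝟙 Z
    rw [← hfg]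
    refine Finset.sum_congr rfl fun i _ => ?_
    simp only [Category.assoc, Category.id_comp, r.retract_assoc]

end Endomorphisms

lemma IsFullCorner.comp_ringEquiv {R S S' : Type*} [Ring R] [Ring S] [Ring S'] {ι : S →ₙ+* R}
    (h : IsFullCorner ι) (e : S' ≃+* S) :
    IsFullCorner (ι.comp (e : S' →ₙ+* S)) where
  injective := h.injective.comp e.injective
  exists_eq r := by
    obtain ⟨s, hs⟩ := h.exists_eq r
    exact ⟨e.symm s, by simpa using hs⟩
  full := by simpa using h.full

/-- The regular left module, in a larger universe. -/
abbrev regular (R : Type u) [Ring R] : ModuleCat.{max u v} R := ModuleCat.of R (ULift.{v} R)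

/-- The endomorphism ring of the regular left module is the opposite ring. -/
def opEquivEnd (R : Type u) [Ring R] :
    Rᵐᵒᵖ ≃+* End (regular.{u, v} R) where
  toFun r := ModuleCat.ofHom
    { toFun := fun x => ULift.up (x.down * r.unop)
      map_add' := fun x y => ULift.ext _ _ (add_mul _ _ _)
      map_smul' := fun s x => ULift.ext _ _ (mul_assoc _ _ _) }
  invFun f := MulOpposite.op (f.hom (ULift.up (1 : R))).down
  left_inv r := by
    change MulOpposite.op (1 * r.unop) = r
    rw [one_mul, MulOpposite.op_unop]
  right_inv f := by
    refine ModuleCat.hom_ext (LinearMap.ext fun x => ULift.ext _ _ ?_)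
    change x.down * (f.hom (ULift.up (1 : R))).down = (f.hom x).down
    have h : x = x.down • (ULift.up (1 : R) : ULift.{v} R) := ULift.ext _ _ (mul_one _).symm
    conv_rhs => rw [h]
    rw [map_smul]
    rfl
  map_mul' r s := by
    exact ModuleCat.hom_ext (LinearMap.ext fun x => ULift.ext _ _ (mul_assoc _ _ _).symm)
  map_add' r s := by
    exact ModuleCat.hom_ext (LinearMap.ext fun x => ULift.ext _ _ (mul_add _ _ _))

/-- The regular module is a direct summand of a finite sum of copies of any separator. -/
lemma inAdd_of_isSeparator {R : Type u} [Ring R] {Y : ModuleCat.{max u v} R} (hY : IsSeparator Y) :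
    InAdd Y (regular.{u, v} R) := by
  set G := regular.{u, v} R with hG
  -- The trace of `Y` in the regular module. The quotient by it receives only zero from `Y`, so a
  -- separator has full trace, and `1` is a finite sum of values of maps from `Y`.
  let T : Submodule R G := ⨆ g : Y ⟶ G, LinearMap.range g.hom
  have hT : T = ⊤ := by
    have h1 : ModuleCat.ofHom T.mkQ = (0 : G ⟶ ModuleCat.of R (G ⧸ T)) := by
      rw [isSeparator_def] at hY
      refine hY _ _ fun h => ?_
      ext x
      change T.mkQ (h.hom x) = 0
      rw [Submodule.mkQ_apply, Submodule.Quotient.mk_eq_zero]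
      exact (le_iSup (fun g : Y ⟶ G => LinearMap.range g.hom) h) ⟨x, rfl⟩
    have h2 : T.mkQ = 0 := congrArg ModuleCat.Hom.hom h1
    rw [← Submodule.ker_mkQ T, h2, LinearMap.ker_zero]
  have h1 : (ULift.up (1 : R) : G) ∈ T := by rw [hT]; trivial
  obtain ⟨f, hf⟩ := (Submodule.mem_iSup_iff_exists_finsupp _ _).1 h1
  obtain ⟨hf1, hf2⟩ := hf
  choose y hy using fun g => hf1 g
  let e := f.support.equivFin
  refine ⟨Fin f.support.card, inferInstance, fun i => ModuleCat.ofHom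
    (LinearMap.toSpanSingleton R Y (y (e.symm i)) ∘ₗ ULift.moduleEquiv.toLinearMap),
    fun i => (e.symm i : Y ⟶ G), ?_⟩
  refine ModuleCat.hom_ext (LinearMap.ext fun x => ?_)
  rw [ModuleCat.hom_sum, LinearMap.sum_apply]
  change ∑ i, (e.symm i : Y ⟶ G).hom (x.down • y (e.symm i)) = x
  simp only [map_smul, hy]
  rw [← Finset.smul_sum, Equiv.sum_comp e.symm (fun i => f i), Finset.sum_coe_sort f.support f]
  rw [Finsupp.sum] at hf2
  rw [hf2]
  exact ULift.ext _ _ (mul_one _)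

end GendoBrauer

namespace GendoBrauer

/-! ### Morita equivalence -/

section Morita

open Limits

lemma isSeparator_regular (R : Type u) [Ring R] : IsSeparator (regular.{u, v} R) := by
  rw [isSeparator_def]
  intro X Y f g h
  ext x
  have := congrArg (fun k => k.hom (ULift.up 1)) (h (ModuleCat.ofHom
    (LinearMap.toSpanSingleton R X x ∘ₗ ULift.moduleEquiv.toLinearMap)))
  simpa using this

section

variable {A : Type w} [Ring A] {B : Type u} [Ring B]

lemma additive_of_equivalence (E : ModuleCat.{max u w} A ≌ ModuleCat.{max u w} B) :
    E.functor.Additive := E.functor.additive_of_preserves_binary_products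

lemma inAdd_regular_of_equivalence (E : ModuleCat.{max u w} A ≌ ModuleCat.{max u w} B) :
    InAdd (E.functor.obj (regular.{w, u} A)) (regular.{u, w} B) :=
  inAdd_of_isSeparator.{u, w} ((isSeparator_regular.{w, u} A).of_equivalence E)

lemma inAdd_regular_of_equivalence' (E : ModuleCat.{max u w} A ≌ ModuleCat.{max u w} B) :
    InAdd (regular.{u, w} B) (E.functor.obj (regular.{w, u} A)) := by
  have := additive_of_equivalence E
  exact ((inAdd_regular_of_equivalence E.symm).map E.functor).of_iso
    (E.counitIso.app _) (Iso.refl _)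

/-- An equivalence between categories of left modules gives one between categories of right
modules. -/
theorem exists_equivalence_op (E : ModuleCat.{max u w} A ≌ ModuleCat.{max u w} B) :
    Nonempty (ModuleCat.{max u w} Aᵐᵒᵖ ≌ ModuleCat.{max u w} Bᵐᵒᵖ) := by
  let Q := E.functor.obj (regular.{w, u} A)
  let G := regular.{u, w} B
  have := additive_of_equivalence E
  let eA : Aᵐᵒᵖ ≃+* End Q := (opEquivEnd.{w, u} A).trans
    { toFun := fun f => E.functor.map f
      invFun := fun f => E.functor.preimage f
      left_inv := fun f => E.functor.preimage_map f
      right_inv := fun f => E.functor.map_preimage f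
      map_mul' := fun f g => E.functor.map_comp g f
      map_add' := fun f g => E.functor.map_add }
  -- Each of `Q` and `G` generates the other, so `Aᵐᵒᵖ = End Q` and `Bᵐᵒᵖ = End G` are both full
  -- corners of `End (Q ⊞ G)`.
  have h1 : IsFullCorner ((endCorner (⟨biprod.inl, biprod.fst, biprod.inl_fst⟩ :
      Retract Q (Q ⊞ G))).comp (eA : Aᵐᵒᵖ →ₙ+* End Q)) :=
    (isFullCorner_endCorner _ ((InAdd.refl Q).biprod
      (inAdd_regular_of_equivalence E))).comp_ringEquiv eA
  have h2 : IsFullCorner ((endCorner (⟨biprod.inr, biprod.snd, biprod.inr_snd⟩ :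
      Retract G (Q ⊞ G))).comp (opEquivEnd.{u, w} B : Bᵐᵒᵖ →ₙ+* End G)) :=
    (isFullCorner_endCorner _ ((inAdd_regular_of_equivalence' E).biprod
      (InAdd.refl G))).comp_ringEquiv (opEquivEnd.{u, w} B)
  have e1 := cornerFunctor_isEquivalence.{_, _, max u w} h1
  have e2 := cornerFunctor_isEquivalence.{_, _, max u w} h2
  exact ⟨(@Functor.asEquivalence _ _ _ _ _ e1).symm.trans (@Functor.asEquivalence _ _ _ _ _ e2)⟩

end

/-- Dimension shifting along an injective presentation, which an exact functor preserving injectives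
carries to another one. -/
lemma hasInjectiveDimensionLT_map {C D : Type*} [Category* C] [Abelian C] [Category* D] [Abelian D]
    [EnoughInjectives C]
    (F : C ⥤ D) [F.Additive] [PreservesFiniteLimits F] [PreservesFiniteColimits F]
    [F.PreservesInjectiveObjects] (n : ℕ) (X : C) (h : HasInjectiveDimensionLT X n) :
    HasInjectiveDimensionLT (F.obj X) n := by
  match n with
  | 0 =>
    rw [hasInjectiveDimensionLT_zero_iff_isZero] at *
    exact F.map_isZero h
  | 1 =>
    rw [← injective_iff_hasInjectiveDimensionLT_one] at *
    exact F.injective_obj X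
  | n + 2 =>
    obtain ⟨p⟩ := EnoughInjectives.presentation X
    have hS := p.shortExact_shortComplex
    have h3 := (hS.hasInjectiveDimensionLT_X₃_iff n p.injective).2 h
    exact ((hS.map_of_exact F).hasInjectiveDimensionLT_X₃_iff n (F.injective_obj p.J)).1
      (hasInjectiveDimensionLT_map F (n + 1) _ h3)

lemma hasInjectiveDimensionLT_equivalence_iff {C D : Type*} [Category* C] [Abelian C]
    [Category* D] [Abelian D] [EnoughInjectives C] [EnoughInjectives D] (E : C ≌ D) (n : ℕ)
    (X : C) : HasInjectiveDimensionLT (E.functor.obj X) n ↔ HasInjectiveDimensionLT X n := by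
  have := E.functor.additive_of_preserves_binary_products
  have := E.inverse.additive_of_preserves_binary_products
  refine ⟨fun h => ?_, hasInjectiveDimensionLT_map E.functor n X⟩
  have := hasInjectiveDimensionLT_map E.inverse n _ h
  exact hasInjectiveDimensionLT_of_iso (X := E.inverse.obj (E.functor.obj X))
    (E.unitIso.app X).symm n

section

variable {A : Type w} [Ring A] {B : Type u} [Ring B]

/-- An equivalence need not send the regular module to the regular module, but the two generate the
same additive closure. -/
lemma addClosed_regular_iff (E : ModuleCat.{max u w} A ≌ ModuleCat.{max u w} B)
    {P : ModuleCat.{max u w} B → Prop} (hP : IsAddClosed P) :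
    P (E.functor.obj (regular.{w, u} A)) ↔ P (regular.{u, w} B) :=
  ⟨hP.of_inAdd (inAdd_regular_of_equivalence E), hP.of_inAdd (inAdd_regular_of_equivalence' E)⟩

lemma hasInjectiveDimensionLT_regular_iff (E : ModuleCat.{max u w} A ≌ ModuleCat.{max u w} B)
    (n : ℕ) : HasInjectiveDimensionLT (regular.{w, u} A) n ↔
      HasInjectiveDimensionLT (regular.{u, w} B) n := by
  rw [← hasInjectiveDimensionLT_equivalence_iff E]
  exact addClosed_regular_iff E (hasInjectiveDimensionLT_isAddClosed n)

lemma injectiveDimension_regular_eq (E : ModuleCat.{max u w} A ≌ ModuleCat.{max u w} B) :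
    injectiveDimension (ModuleCat.of A A) = injectiveDimension (ModuleCat.of B B) := by
  have h1 : injectiveDimension (ModuleCat.of A A) = injectiveDimension (regular.{w, u} A) :=
    ModuleCat.injectiveDimension_eq_of_linearEquiv ULift.moduleEquiv.symm
  have h2 : injectiveDimension (ModuleCat.of B B) = injectiveDimension (regular.{u, w} B) :=
    ModuleCat.injectiveDimension_eq_of_linearEquiv ULift.moduleEquiv.symm
  rw [h1, h2]
  simp only [injectiveDimension, hasInjectiveDimensionLT_regular_iff E]

lemma hasDomDimGE_equivalence_iff (E : ModuleCat.{max u w} A ≌ ModuleCat.{max u w} B) (n : ℕ)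
    (X : ModuleCat.{max u w} A) : HasDomDimGE n (E.functor.obj X) ↔ HasDomDimGE n X := by
  have := E.functor.additive_of_preserves_binary_products
  have := E.inverse.additive_of_preserves_binary_products
  have hp : E.functor.PreservesProjectiveObjects := ⟨fun {X} hX => (E.map_projective_iff X).2 hX⟩
  have hp' : E.inverse.PreservesProjectiveObjects :=
    ⟨fun {X} hX => (E.symm.map_projective_iff X).2 hX⟩
  refine ⟨fun h => ?_, fun h => h.map _⟩
  exact (h.map E.inverse).of_iso (E.unitIso.app X).symm

lemma hasDomDimGE_regular_iff (E : ModuleCat.{max u w} A ≌ ModuleCat.{max u w} B) (n : ℕ) :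
    HasDomDimGE n (ModuleCat.of A A) ↔ HasDomDimGE n (ModuleCat.of B B) := by
  rw [← hasDomDimGE_uliftFunctor_iff.{w, u} n (ModuleCat.of A A),
    ← hasDomDimGE_uliftFunctor_iff.{u, w} n (ModuleCat.of B B),
    ← hasDomDimGE_equivalence_iff E]
  exact addClosed_regular_iff E (HasDomDimGE.isAddClosed n)

/-- The number of simple modules is determined by the simple objects of the module category. -/
lemma numSimples_eq (E : ModuleCat.{max u w} Aᵐᵒᵖ ≌ ModuleCat.{max u w} B) {X : Type*}
    (S : X → ModuleCat.{max u w} B) (hS : ∀ x, Simple (S x))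
    (hinj : ∀ x y, Nonempty (S x ≅ S y) → x = y)
    (hsurj : ∀ M : ModuleCat.{max u w} B, Simple M → ∃ x, Nonempty (M ≅ S x)) :
    numSimples A = Nat.card X := by
  have := additive_of_equivalence E
  let F : {I : Submodule Aᵐᵒᵖ A // IsCoatom I} → ModuleCat.{max u w} Aᵐᵒᵖ := fun I =>
    ModuleCat.of Aᵐᵒᵖ (ULift.{u} (A ⧸ I.1))
  have hF : ∀ I, Simple (F I) := by
    intro I
    have h1 : IsSimpleModule Aᵐᵒᵖ (A ⧸ I.1) := isSimpleModule_iff_isCoatom.2 I.2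
    have : IsSimpleModule Aᵐᵒᵖ (ULift.{u} (A ⧸ I.1)) := IsSimpleModule.congr ULift.moduleEquiv
    exact simple_of_isSimpleModule
  have hiso : ∀ I J, Nonempty ((A ⧸ I.1) ≃ₗ[Aᵐᵒᵖ] (A ⧸ J.1)) ↔ Nonempty (F I ≅ F J) := by
    intro I J
    constructor
    · rintro ⟨e⟩
      exact ⟨((ULift.moduleEquiv.trans e).trans ULift.moduleEquiv.symm).toModuleIso⟩
    · rintro ⟨e⟩
      exact ⟨(ULift.moduleEquiv.symm.trans e.toLinearEquiv).trans ULift.moduleEquiv⟩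
  choose c hc using fun I => hsurj (E.functor.obj (F I)) (by
    have := hF I
    exact simple_obj E.functor (F I))
  have hcc : ∀ I J, c I = c J ↔ Nonempty ((A ⧸ I.1) ≃ₗ[Aᵐᵒᵖ] (A ⧸ J.1)) := by
    intro I J
    rw [hiso]
    obtain ⟨eI⟩ := hc I
    obtain ⟨eJ⟩ := hc J
    constructor
    · intro h
      exact ⟨E.functor.preimageIso (eI ≪≫ eqToIso (congrArg S h) ≪≫ eJ.symm)⟩
    · rintro ⟨e⟩
      exact hinj _ _ ⟨eI.symm ≪≫ E.functor.mapIso e ≪≫ eJ⟩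
  refine Nat.card_congr (Equiv.ofBijective (Quot.lift c fun I J h => (hcc I J).2 h) ⟨?_, ?_⟩)
  · rintro ⟨I⟩ ⟨J⟩ h
    exact Quot.sound ((hcc I J).1 h)
  · intro x
    have hSx := hS x
    have hM : IsSimpleModule Aᵐᵒᵖ (E.inverse.obj (S x)) := by
      rw [← simple_iff_isSimpleModule']
      exact simple_obj E.inverse (S x)
    have hn := hM.nontrivial
    -- A nonzero element generates the simple module, so its annihilator is a maximal right ideal
    -- representing the class `x`.
    obtain ⟨m, hm⟩ := exists_ne (0 : E.inverse.obj (S x))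
    let g : A →ₗ[Aᵐᵒᵖ] E.inverse.obj (S x) :=
      { toFun := fun a => MulOpposite.op a • m
        map_add' := fun a b => by rw [MulOpposite.op_add, add_smul]
        map_smul' := fun a b => by
          rw [RingHom.id_apply, smul_smul]; rfl }
    have hg : Function.Surjective g := by
      refine LinearMap.surjective_of_ne_zero fun h => hm ?_
      have := LinearMap.congr_fun h 1
      simpa [g] using this
    refine ⟨Quot.mk _ ⟨LinearMap.ker g, LinearMap.isCoatom_ker_of_surjective hg⟩, ?_⟩
    change c _ = x
    obtain ⟨e⟩ := hc ⟨LinearMap.ker g, LinearMap.isCoatom_ker_of_surjective hg⟩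
    have e2 : F ⟨LinearMap.ker g, LinearMap.isCoatom_ker_of_surjective hg⟩ ≅ E.inverse.obj (S x) :=
      (ULift.moduleEquiv.trans (g.quotKerEquivOfSurjective hg)).toModuleIso
    exact hinj _ _ ⟨e.symm ≪≫ E.functor.mapIso e2 ≪≫ E.counitIso.app (S x)⟩

end

/-! ### Symmetric algebras -/

/-- A trace form on the endomorphism ring of `G` yields one on the endomorphism ring of any object
that generates the same additive closure. -/
lemma exists_trace_form {K : Type*} [Field K] {C : Type u} [Category.{v} C] [Preadditive C]
    [Linear K C] {G Q : C} (h : InAdd G Q) (θ : (G ⟶ G) →+ K)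
    (hsmul : ∀ (k : K) f, θ (k • f) = k * θ f) (hsymm : ∀ f g, θ (f ≫ g) = θ (g ≫ f)) (hnd : ∀ f : G ⟶ G, (∀ g, θ (f ≫ g) = 0) → f = 0) :
    ∃ τ : (Q ⟶ Q) →ₗ[K] K, (∀ f g, τ (f ≫ g) = τ (g ≫ f)) ∧
      ∀ f : Q ⟶ Q, (∀ g, τ (f ≫ g) = 0) → f = 0 := by
  obtain ⟨κ, _, a, b, hab⟩ := h
  have hins : ∀ {X Y : C} (x : X ⟶ Q) (y : Q ⟶ Y), x ≫ y = ∑ i, (x ≫ a i) ≫ b i ≫ y := by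
    intro X Y x y
    conv_lhs => rw [← Category.id_comp y, ← hab, Preadditive.sum_comp, Preadditive.comp_sum]
    simp
  have hsymm' : ∀ (f : G ⟶ Q) (g : Q ⟶ G) (f' : G ⟶ Q) (g' : Q ⟶ G),
      θ ((f ≫ g) ≫ f' ≫ g') = θ ((f' ≫ g') ≫ f ≫ g) := fun f g f' g' => hsymm _ _
  -- The trace of the matrix of an endomorphism of `Q` in copies of `G`, relative to `∑ aᵢ ≫ bᵢ = 𝟙
  -- Q`.
  let τ : (Q ⟶ Q) →ₗ[K] K :=
    { toFun := fun φ => ∑ i, θ (b i ≫ φ ≫ a i)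
      map_add' := fun f g => by simp [Finset.sum_add_distrib]
      map_smul' := fun k f => by simp [Finset.mul_sum, hsmul] }
  have hτ : ∀ φ, τ φ = ∑ i, θ (b i ≫ φ ≫ a i) := fun _ => rfl
  have hmul : ∀ f g, τ (f ≫ g) = ∑ i, ∑ j, θ ((b i ≫ f ≫ a j) ≫ b j ≫ g ≫ a i) := by
    intro f g
    rw [hτ]
    refine Finset.sum_congr rfl fun i _ => ?_
    have : b i ≫ (f ≫ g) ≫ a i = (b i ≫ f) ≫ g ≫ a i := by simp
    rw [this, hins, map_sum]
    simp
  refine ⟨τ, fun f g => ?_, fun f hf => ?_⟩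
  · rw [hmul, hmul, Finset.sum_comm]
    exact Finset.sum_congr rfl fun i _ => Finset.sum_congr rfl fun j _ => hsymm _ _
  · have h0 : ∀ k j, b k ≫ f ≫ a j = 0 := by
      intro k j
      refine hnd _ fun ψ => ?_
      have h1 := hf (a j ≫ ψ ≫ b k)
      rw [hτ] at h1
      have h2 : ∀ i, θ (b i ≫ (f ≫ a j ≫ ψ ≫ b k) ≫ a i) =
          θ ((b k ≫ a i) ≫ b i ≫ f ≫ a j ≫ ψ) := by
        intro i
        rw [hsymm]
        simp
      simp only [h2] at h1
      rw [← map_sum, ← hins] at h1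
      simpa using h1
    have h1 : f = (∑ k, a k ≫ b k) ≫ f ≫ ∑ j, a j ≫ b j := by rw [hab]; simp
    rw [h1]
    simp only [Preadditive.sum_comp, Preadditive.comp_sum]
    refine Finset.sum_eq_zero fun k _ => Finset.sum_eq_zero fun j _ => ?_
    have : (a j ≫ b j) ≫ f ≫ a k ≫ b k = a j ≫ (b j ≫ f ≫ a k) ≫ b k := by simp
    rw [this, h0]
    simp

-- The form on `B` is read as a form `f ↦ t (f 1)` on endomorphisms of the regular module and moved
-- to the image of the regular `A`-module by `exists_trace_form`. Linearity of the equivalence over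
-- `K` makes the resulting form on `A` linear.
open scoped ModuleCat.Algebra in
theorem IsSymmetricAlgebra.of_isMoritaEquivalent {K : Type v} [Field K] {A : Type w} [Ring A]
    [Algebra K A] {B : Type u} [Ring B] [Algebra K B] (h : IsMoritaEquivalent K A B)
    (hB : IsSymmetricAlgebra B K) : IsSymmetricAlgebra A K := by
  obtain ⟨⟨E, hE⟩⟩ := h.cond
  obtain ⟨t, ht, hnd⟩ := hB
  have := additive_of_equivalence.{u, w} E
  let θ : (regular.{u, w} B ⟶ regular.{u, w} B) →+ K :=
    { toFun := fun f => t (f.hom (ULift.up 1)).down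
      map_zero' := map_zero t
      map_add' := fun f g => map_add t _ _ }
  have hθ : ∀ f g : regular.{u, w} B ⟶ regular.{u, w} B, θ (f ≫ g) = t ((f.hom (ULift.up 1)).down * (g.hom (ULift.up 1)).down) := by
    intro f g
    change t (g.hom (f.hom (ULift.up 1))).down = _
    congr 1
    have : f.hom (ULift.up 1) = (f.hom (ULift.up 1)).down • (ULift.up 1 : ULift.{w} B) :=
      ULift.ext _ _ (mul_one _).symm
    rw [this, map_smul]
    change _ = ((f.hom (ULift.up 1)).down * 1) * _
    rw [mul_one]
    rfl
  have hθsymm : ∀ f g : regular.{u, w} B ⟶ regular.{u, w} B, θ (f ≫ g) = θ (g ≫ f) := fun f g => by rw [hθ, hθ, ht]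
  have hθnd : ∀ f : regular.{u, w} B ⟶ regular.{u, w} B, (∀ g, θ (f ≫ g) = 0) → f = 0 := fun f hf => by
      have h1 : (f.hom (ULift.up 1)).down = 0 := hnd _ fun b => by
        have h2 := hf ((opEquivEnd.{u, w} B) (MulOpposite.op b))
        rw [hθ] at h2
        rw [← h2]
        congr 2
        exact (one_mul b).symm
      have h2 : f = opEquivEnd.{u, w} B (MulOpposite.op 0) := by
        rw [← h1]
        exact ((opEquivEnd.{u, w} B).apply_symm_apply f).symm
      rw [h2, MulOpposite.op_zero]
      exact map_zero _
  obtain ⟨τ, hτ1, hτ2⟩ := exists_trace_form (inAdd_regular_of_equivalence'.{u, w} E) θ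
    (fun k f => by
      refine Eq.trans ?_ (map_smul t k (f.hom (ULift.up 1)).down)
      refine congrArg t (Eq.trans ?_ (Algebra.smul_def k (f.hom (ULift.up 1)).down).symm)
      rfl) hθsymm hθnd
  let ρ : A → (regular.{w, u} A ⟶ regular.{w, u} A) := fun a =>
    opEquivEnd.{w, u} A (MulOpposite.op a)
  have hρmul : ∀ a b, ρ (a * b) = ρ a ≫ ρ b := fun a b => (opEquivEnd.{w, u} A).map_mul _ _
  let s : A →ₗ[K] K :=
    { toFun := fun a => τ (E.functor.map (ρ a))
      map_add' := fun a b => by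
        have : ρ (a + b) = ρ a + ρ b := (opEquivEnd.{w, u} A).map_add _ _
        rw [this, E.functor.map_add, map_add]
      map_smul' := fun k a => by
        refine Eq.trans (congrArg τ ?_) (map_smul τ k (E.functor.map (ρ a)))
        refine Eq.trans (congrArg E.functor.map ?_) (E.functor.map_smul k (ρ a))
        refine ModuleCat.hom_ext (LinearMap.ext fun x => ULift.ext _ _ ?_)
        change x.down * (k • a) = algebraMap K A k * (x.down * a)
        rw [Algebra.mul_smul_comm, Algebra.smul_def] }
  refine ⟨s, fun a b => ?_, fun a ha => ?_⟩
  · change τ (E.functor.map (ρ (a * b))) = τ (E.functor.map (ρ (b * a)))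
    rw [hρmul, hρmul, E.functor.map_comp, E.functor.map_comp, hτ1]
  · have h0 : E.functor.map (ρ a) = 0 := hτ2 _ fun φ => by
      obtain ⟨ψ, rfl⟩ := E.functor.map_surjective φ
      obtain ⟨b, hb⟩ := (opEquivEnd.{w, u} A).surjective ψ
      have h1 := ha b.unop
      change τ (E.functor.map (ρ (a * b.unop))) = 0 at h1
      rw [hρmul, E.functor.map_comp] at h1
      rw [← hb]
      exact h1
    have h1 : ρ a = 0 := E.functor.map_injective (by rw [h0, E.functor.map_zero])
    have h2 : MulOpposite.op a = 0 := (opEquivEnd.{w, u} A).injective (by rw [map_zero]; exact h1)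
    simpa using h2

end Morita

end GendoBrauer

namespace GendoBrauer

/-! ### Combinatorics of half-edges -/

namespace HalfEdgeData

variable {H : Type v}

/-- The axioms of a Brauer graph. -/
structure IsBrauer (T : HalfEdgeData H) : Prop where
  opp_opp : ∀ h, T.opp (T.opp h) = h
  opp_ne : ∀ h, T.opp h ≠ h
  mult_pos : ∀ h, 0 < T.mult h
  mult_succ : ∀ h, T.mult (T.succ h) = T.mult h

/-- The opposite cyclic orderings. -/
def rev (T : HalfEdgeData H) : HalfEdgeData H where
  opp := T.opp
  succ := T.succ.symm
  mult := T.mult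

lemma IsBrauer.rev {T : HalfEdgeData H} (hT : T.IsBrauer) : T.rev.IsBrauer where
  opp_opp := hT.opp_opp
  opp_ne := hT.opp_ne
  mult_pos := hT.mult_pos
  mult_succ h := by
    have := hT.mult_succ (T.succ.symm h)
    rw [Equiv.apply_symm_apply] at this
    exact this.symm

/-- The length of the cycle around the vertex of `h`, taken with multiplicity. -/
noncomputable def len (T : HalfEdgeData H) (h : H) : ℕ :=
  Function.minimalPeriod T.succ h * T.mult h

lemma minimalPeriod_succ_pos [Finite H] (T : HalfEdgeData H) (h : H) :
    0 < Function.minimalPeriod T.succ h :=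
  Function.minimalPeriod_pos_of_mem_periodicPts
    (Function.Injective.mem_periodicPts T.succ.injective h)

lemma IsBrauer.len_pos [Finite H] {T : HalfEdgeData H} (hT : T.IsBrauer) (h : H) : 0 < T.len h :=
  Nat.mul_pos (T.minimalPeriod_succ_pos h) (hT.mult_pos h)

lemma iterate_len (T : HalfEdgeData H) (h : H) : T.succ^[T.len h] h = h :=
  (Function.isPeriodicPt_minimalPeriod T.succ h).mul_const _

lemma IsBrauer.len_succ [Finite H] {T : HalfEdgeData H} (hT : T.IsBrauer) (h : H) :
    T.len (T.succ h) = T.len h := by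
  unfold len
  rw [hT.mult_succ, Function.minimalPeriod_apply
    (Function.Injective.mem_periodicPts T.succ.injective h)]

lemma IsBrauer.len_iterate [Finite H] {T : HalfEdgeData H} (hT : T.IsBrauer) (k : ℕ) (h : H) :
    T.len (T.succ^[k] h) = T.len h := by
  induction k with
  | zero => rfl
  | succ k ih => rw [Function.iterate_succ_apply', hT.len_succ, ih]

/-- The clockwise step of Green's walk. -/
def green (T : HalfEdgeData H) (h : H) : H := T.opp (T.succ.symm h)

/-- The product of `k` consecutive arrows around a vertex, written from right to left. -/
def path {C : Type*} [Mul C] (T : HalfEdgeData H) (e a : H → C) (h : H) : ℕ → C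
  | 0 => e h
  | k + 1 => a (T.succ^[k] h) * path T e a h k

end HalfEdgeData

open HalfEdgeData

/-- The structure of a path algebra modulo the zero relations of a Brauer graph algebra, with paths
multiplied from right to left. -/
structure PathSystem {H : Type v} (T : HalfEdgeData H) (C : Type w) [Ring C] where
  e : H → C
  a : H → C
  reps : Finset H
  e_opp : ∀ h, e (T.opp h) = e h
  e_mul_self : ∀ h, e h * e h = e h
  e_mul : ∀ h k, k ≠ h → k ≠ T.opp h → e k * e h = 0
  e_mul_a : ∀ h, e (T.succ h) * a h = a h
  a_mul_e : ∀ h, a h * e h = a h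
  turn : ∀ h, a (T.opp (T.succ h)) * a h = 0
  sum_e : ∑ h ∈ reps, e h = 1

/-! ### Calculus of paths. -/

namespace PathSystem

variable {H : Type v} {T : HalfEdgeData H} {C : Type w} [Ring C] (S : PathSystem T C)

/-- The path of length `k` starting with the half-edge `h`. -/
abbrev p (h : H) (k : ℕ) : C := T.path S.e S.a h k

lemma p_zero (h : H) : S.p h 0 = S.e h := rfl

lemma p_succ (h : H) (k : ℕ) : S.p h (k + 1) = S.a (T.succ^[k] h) * S.p h k := rfl

lemma p_one (h : H) : S.p h 1 = S.a h := S.a_mul_e h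

lemma p_mul_e (h : H) (k : ℕ) : S.p h k * S.e h = S.p h k := by
  induction k with
  | zero => exact S.e_mul_self h
  | succ k ih => rw [p_succ, mul_assoc, ih]

lemma e_mul_p (h : H) (k : ℕ) : S.e (T.succ^[k] h) * S.p h k = S.p h k := by
  cases k with
  | zero => exact S.e_mul_self h
  | succ k => rw [p_succ, Function.iterate_succ_apply', ← mul_assoc, S.e_mul_a]

lemma p_mul_e_of_ne (h k : H) (j : ℕ) (h1 : k ≠ h) (h2 : k ≠ T.opp h) : S.p k j * S.e h = 0 := by
  rw [← p_mul_e, mul_assoc, S.e_mul h k h1 h2, mul_zero]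

/-- Only the arrows at the two halves of the edge of `succ h` can follow `a h`, and the one at the
other half is killed by `turn`. -/
lemma a_mul_a_of_ne (h k : H) (hk : k ≠ T.succ h) : S.a k * S.a h = 0 := by
  by_cases h2 : k = T.opp (T.succ h)
  · rw [h2, S.turn]
  · rw [← S.a_mul_e k, ← S.e_mul_a h, mul_assoc, ← mul_assoc (S.e k), S.e_mul _ _ hk h2, zero_mul,
      mul_zero]

lemma a_mul_p_of_ne (h k : H) (j : ℕ) (hk : k ≠ T.succ^[j + 1] h) : S.a k * S.p h (j + 1) = 0 := by
  rw [p_succ, ← mul_assoc, S.a_mul_a_of_ne, zero_mul]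
  rwa [Function.iterate_succ_apply'] at hk

lemma p_mul_p (h : H) (i j : ℕ) : S.p (T.succ^[i] h) j * S.p h i = S.p h (i + j) := by
  induction j with
  | zero => exact S.e_mul_p h i
  | succ j ih =>
    rw [p_succ, mul_assoc, ih, ← Function.iterate_add_apply, add_comm j i]
    rfl

lemma p_succ' (h : H) (k : ℕ) : S.p h (k + 1) = S.p (T.succ h) k * S.a h := by
  have := S.p_mul_p h 1 k
  rw [p_one, add_comm] at this
  exact this.symm

lemma p_mul_p_of_ne (h k : H) (i j : ℕ) (hk : k ≠ T.succ^[i + 1] h) :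
    S.p k (j + 1) * S.p h (i + 1) = 0 := by
  rw [p_succ' S k, mul_assoc, S.a_mul_p_of_ne h k i hk, mul_zero]

lemma e_mul_p_cases (k h : H) (j : ℕ) : S.e k * S.p h j = S.p h j ∨ S.e k * S.p h j = 0 := by
  rw [← S.e_mul_p h j, ← mul_assoc]
  by_cases h1 : k = T.succ^[j] h
  · left; rw [h1, S.e_mul_self]
  by_cases h2 : k = T.opp (T.succ^[j] h)
  · left; rw [h2, S.e_opp, S.e_mul_self]
  · right; rw [S.e_mul _ _ h1 h2, zero_mul]

lemma p_mul_e_cases (h k : H) (j : ℕ) : S.p k j * S.e h = S.p k j ∨ S.p k j * S.e h = 0 := by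
  by_cases h1 : k = h
  · left; rw [h1, S.p_mul_e]
  by_cases h2 : k = T.opp h
  · left; rw [← S.e_opp, ← h2, S.p_mul_e]
  · right; exact S.p_mul_e_of_ne h k j h1 h2

lemma p_mul_p_cases (h k : H) (m n : ℕ) :
    S.p h m * S.p k n = 0 ∨ ∃ g, S.p h m * S.p k n = S.p g (m + n) := by
  cases m with
  | zero =>
    rw [zero_add]
    exact (S.e_mul_p_cases h k n).symm.imp_right fun h1 => ⟨k, h1⟩
  | succ m =>
    cases n with
    | zero => exact (S.p_mul_e_cases k h (m + 1)).symm.imp_right fun h1 => ⟨h, h1⟩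
    | succ n =>
      by_cases h1 : h = T.succ^[n + 1] k
      · right; exact ⟨k, by rw [h1, p_mul_p, add_comm]⟩
      · left; exact S.p_mul_p_of_ne _ _ _ _ h1

end PathSystem

/-- The structure of a Brauer graph algebra, with paths multiplied from right to left. -/
structure LeftSystem {H : Type v} (T : HalfEdgeData H) (K : Type u) [Field K] (C : Type w) [Ring C]
    [Algebra K C] extends PathSystem T C where
  t : C →ₗ[K] K
  χ : H → (C →ₐ[K] K)
  cycle : ∀ h, T.path e a h (T.len h) = T.path e a (T.opp h) (T.len (T.opp h))
  span : Submodule.span K (Set.range fun x : H × ℕ => T.path e a x.1 x.2) = ⊤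
  t_symm : ∀ x y, t (x * y) = t (y * x)
  t_len : ∀ h, t (T.path e a h (T.len h)) = 1
  t_ne : ∀ h k, k ≠ T.len h → t (T.path e a h k) = 0
  χ_self : ∀ h, χ h (e h) = 1
  χ_a : ∀ h k, χ h (a k) = 0

/-! ### Expansion in paths, annihilators of arrows, nondegeneracy of the form. -/

namespace LeftSystem

open PathSystem

variable {H : Type v} {T : HalfEdgeData H} {K : Type u} [Field K] {C : Type w} [Ring C]
  [Algebra K C] (S : LeftSystem T K C)

section

variable [Finite H] (hT : T.IsBrauer)
include hT

/-- The full cycle at `h` equals the full cycle at `opp h`, and the arrow at `h` does not continue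
the latter. -/
lemma p_len_succ (h : H) : S.p h (T.len h + 1) = 0 := by
  rw [p_succ, iterate_len]
  have h1 := hT.len_pos (T.opp h)
  rw [show S.p h (T.len h) = S.p (T.opp h) (T.len (T.opp h)) from S.cycle h]
  have h2 : T.len (T.opp h) = (T.len (T.opp h) - 1) + 1 := by omega
  rw [h2]
  refine S.a_mul_p_of_ne _ _ _ ?_
  rw [← h2, iterate_len]
  exact (hT.opp_ne h).symm

lemma p_eq_zero (h : H) (k : ℕ) (hk : T.len h < k) : S.p h k = 0 := by
  obtain ⟨j, rfl⟩ : ∃ j, k = T.len h + 1 + j := ⟨k - (T.len h + 1), by omega⟩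
  rw [← p_mul_p, S.p_len_succ hT, mul_zero]

/-- Elements of `C e_h` in terms of the paths that start in one of the two directions. -/
lemma exists_repr (h : H) (b : C) : ∃ (α : ℕ → K) (c : C),
    b * S.e h = ∑ j ∈ Finset.range (T.len h), α j • S.p h j + c * S.a (T.opp h) := by
  have hb : b ∈ Submodule.span K (Set.range fun x : H × ℕ => S.p x.1 x.2) := by
    rw [S.span]; trivial
  have hpos := hT.len_pos h
  induction hb using Submodule.span_induction with
  | mem x hx =>
    obtain ⟨⟨k, j⟩, rfl⟩ := hx
    have hopp : ∀ j, ∃ c, S.p (T.opp h) (j + 1) = c * S.a (T.opp h) := fun j => ⟨_, S.p_succ' _ _⟩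
    by_cases h1 : k = h
    · subst h1
      rcases lt_trichotomy j (T.len k) with h2 | h2 | h2
      · refine ⟨fun i => if i = j then 1 else 0, 0, ?_⟩
        simp only [p_mul_e, ite_smul, one_smul, zero_smul, zero_mul, add_zero]
        rw [Finset.sum_ite_eq' , if_pos (Finset.mem_range.2 h2)]
      -- The full cycle is rewritten as the one starting in the opposite direction. This is why the
      -- sum over paths from `h` stops before length `len h`.
      · obtain ⟨c, hc⟩ := hopp (T.len (T.opp k) - 1)
        rw [Nat.sub_add_cancel (hT.len_pos _)] at hc
        refine ⟨0, c, ?_⟩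
        rw [← hc, p_mul_e, h2]
        simpa using S.cycle k
      · exact ⟨0, 0, by simp [S.p_eq_zero hT k j h2]⟩
    · by_cases h2 : k = T.opp h
      · subst h2
        have h3 : S.p (T.opp h) j * S.e h = S.p (T.opp h) j := by
          rw [← S.e_opp h, p_mul_e]
        simp only [h3]
        cases j with
        | zero =>
          refine ⟨fun i => if i = 0 then 1 else 0, 0, ?_⟩
          simp only [ite_smul, one_smul, zero_smul, zero_mul, add_zero]
          rw [Finset.sum_ite_eq', if_pos (Finset.mem_range.2 hpos)]
          exact S.e_opp h
        | succ j =>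
          obtain ⟨c, hc⟩ := hopp j
          exact ⟨0, c, by simpa using hc⟩
      · exact ⟨0, 0, by simp [S.p_mul_e_of_ne h k j h1 h2]⟩
  | zero => exact ⟨0, 0, by simp⟩
  | add x y _ _ hx hy =>
    obtain ⟨α, c, h1⟩ := hx
    obtain ⟨α', c', h2⟩ := hy
    refine ⟨α + α', c + c', ?_⟩
    rw [add_mul, h1, h2]
    simp only [Pi.add_apply, add_smul, Finset.sum_add_distrib, add_mul]
    abel
  | smul k x _ hx =>
    obtain ⟨α, c, h1⟩ := hx
    refine ⟨k • α, k • c, ?_⟩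
    rw [smul_mul_assoc, h1]
    simp only [Pi.smul_apply, smul_eq_mul, mul_smul, Finset.smul_sum, smul_add, smul_mul_assoc]

/-- Linear independence of the paths starting with `h`. -/
lemma coeff_eq_zero (h : H) (α : ℕ → K) (n : ℕ) (hn : n ≤ T.len h)
    (x : C) (hx : x = ∑ j ∈ Finset.range n, α j • S.p h (j + 1)) (ht : ∀ c, S.t (c * x) = 0) :
    ∀ j < n, α j = 0 := by
  intro j
  induction j using Nat.strong_induction_on with
  | _ j ih =>
    intro hj
    -- The complementary path completes the term of index `j` to a full cycle, where `t` is `1`.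
    -- Shorter terms vanish by induction; longer ones do not compose or exceed the full cycle.
    have h1 := ht (S.p (T.succ^[j + 1] h) (T.len h - (j + 1)))
    rw [hx, Finset.mul_sum, map_sum, Finset.sum_eq_single j] at h1
    · rw [mul_smul_comm, p_mul_p, map_smul, Nat.add_sub_cancel' (by omega), S.t_len, smul_eq_mul,
        mul_one] at h1
      exact h1
    · intro i hi hij
      rcases lt_or_gt_of_ne hij with h2 | h2
      · rw [ih i h2 (by omega), zero_smul, mul_zero, map_zero]
      · have hi' := Finset.mem_range.1 hi
        rw [mul_smul_comm]
        by_cases h3 : T.succ^[j + 1] h = T.succ^[i + 1] h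
        · rw [h3, p_mul_p, S.p_eq_zero hT _ _ (by omega), smul_zero, map_zero]
        · obtain ⟨m, hm⟩ : ∃ m, T.len h - (j + 1) = m + 1 := ⟨T.len h - (j + 1) - 1, by omega⟩
          rw [hm, S.p_mul_p_of_ne _ _ _ _ h3, smul_zero, map_zero]
    · intro h2
      exact absurd (Finset.mem_range.2 hj) h2

/-- The annihilator of an arrow is generated by an arrow. -/
lemma exists_eq_mul_of_mul_a_eq_zero (h : H) (b : C) (hb : b * S.e (T.succ h) = b)
    (hba : b * S.a h = 0) : ∃ c, b = c * S.a (T.opp (T.succ h)) := by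
  obtain ⟨α, c, hc⟩ := S.exists_repr hT (T.succ h) b
  rw [hb] at hc
  have h1 : ∑ j ∈ Finset.range (T.len (T.succ h)), α j • S.p h (j + 1) = 0 := by
    rw [← hba, hc, add_mul, mul_assoc c, S.turn, mul_zero, add_zero, Finset.sum_mul]
    exact Finset.sum_congr rfl fun j _ => by rw [p_succ', smul_mul_assoc]
  have h2 := S.coeff_eq_zero hT h α _ (hT.len_succ h).le 0 h1.symm (by simp)
  refine ⟨c, ?_⟩
  rw [hc, Finset.sum_eq_zero, zero_add]
  intro j hj
  rw [h2 j (Finset.mem_range.1 hj), zero_smul]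

/-- Expand `x e_h` in the paths leaving along the two halves of the edge, with the full cycle
counted only on the side of `opp h`. Pairing with complementary paths kills the coefficients on the
side of `h` first, then those on the other side. -/
lemma eq_zero_of_t_eq_zero (x : C) (hx : ∀ c, S.t (c * x) = 0) : x = 0 := by
  have key : ∀ h, x * S.e h = 0 := by
    intro h
    have hy : ∀ c, S.t (c * (x * S.e h)) = 0 := fun c => by
      rw [← mul_assoc, S.t_symm, ← mul_assoc, hx]
    obtain ⟨α, c, hc⟩ := S.exists_repr hT h x
    obtain ⟨β, d, hd⟩ := S.exists_repr hT (T.succ (T.opp h)) c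
    have h1 : c * S.a (T.opp h) =
        ∑ j ∈ Finset.range (T.len (T.opp h)), β j • S.p (T.opp h) (j + 1) := by
      rw [← S.e_mul_a (T.opp h), ← mul_assoc, hd, add_mul, mul_assoc d, S.turn, mul_zero, add_zero,
        Finset.sum_mul, hT.len_succ]
      exact Finset.sum_congr rfl fun j _ => by rw [p_succ', smul_mul_assoc]
    rw [h1] at hc
    have hα : ∀ j < T.len h, α j = 0 := by
      intro j
      induction j using Nat.strong_induction_on with
      | _ j ih =>
        intro hj
        have h2 := hy (S.p (T.succ^[j] h) (T.len h - j))
        obtain ⟨m, hm⟩ : ∃ m, T.len h - j = m + 1 := ⟨T.len h - j - 1, by omega⟩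
        rw [hc, mul_add, map_add, Finset.mul_sum, map_sum, Finset.sum_eq_single j,
          Finset.mul_sum, map_sum, Finset.sum_eq_zero, add_zero, mul_smul_comm, p_mul_p, map_smul,
          Nat.add_sub_cancel' (by omega), S.t_len, smul_eq_mul, mul_one] at h2
        · exact h2
        · intro i hi
          have hi' := Finset.mem_range.1 hi
          rw [mul_smul_comm, map_smul]
          -- A cross term survives composition only if both halves of the edge lie at one vertex.
          -- Its total length is then the full one only when `j = i + 1`, which would give `h = opp
          -- h`.
          by_cases h3 : T.succ^[j] h = T.succ^[i + 1] (T.opp h)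
          · have h4 : T.len h = T.len (T.opp h) := by
              rw [← hT.len_iterate j h, h3, hT.len_iterate]
            rw [h3, p_mul_p, S.t_ne, smul_zero]
            intro h5
            have h6 : j = i + 1 := by omega
            rw [← h6] at h3
            exact hT.opp_ne h (T.succ.injective.iterate j h3).symm
          · rw [hm, S.p_mul_p_of_ne _ _ _ _ h3, map_zero, smul_zero]
        · intro i hi hij
          rcases lt_or_gt_of_ne hij with h3 | h3
          · rw [ih i h3 (by omega), zero_smul, mul_zero, map_zero]
          · have hi' := Finset.mem_range.1 hi
            obtain ⟨i, rfl⟩ : ∃ i', i = i' + 1 := ⟨i - 1, by omega⟩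
            rw [mul_smul_comm]
            by_cases h4 : T.succ^[j] h = T.succ^[i + 1] h
            · rw [h4, p_mul_p, S.p_eq_zero hT _ _ (by omega), smul_zero, map_zero]
            · rw [hm, S.p_mul_p_of_ne _ _ _ _ h4, smul_zero, map_zero]
        · intro h3
          exact absurd (Finset.mem_range.2 hj) h3
    rw [Finset.sum_eq_zero fun j hj => by rw [hα j (Finset.mem_range.1 hj), zero_smul],
      zero_add] at hc
    have hβ := S.coeff_eq_zero hT (T.opp h) β _ le_rfl _ hc hy
    rw [hc]
    exact Finset.sum_eq_zero fun j hj => by rw [hβ j (Finset.mem_range.1 hj), zero_smul]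
  rw [← mul_one x, ← S.sum_e, Finset.mul_sum]
  exact Finset.sum_eq_zero fun h _ => key h

end

end LeftSystem

end GendoBrauer

namespace GendoBrauer

/-! ### Dimensions along a chain of short exact sequences -/

section Chain

open Limits ZeroObject

variable {C : Type u} [Category.{v} C] [Abelian C]

lemma injective_and_projective_of_shortExact {Z : ShortComplex C} (hZ : Z.ShortExact)
    [Injective Z.X₁] [Injective Z.X₂] [Projective Z.X₂] :
    Projective Z.X₁ ∧ Injective Z.X₃ ∧ Projective Z.X₃ := by
  let s := hZ.splittingOfInjective
  let r1 : Retract Z.X₁ Z.X₂ := ⟨Z.f, s.r, s.f_r⟩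
  let r3 : Retract Z.X₃ Z.X₂ := ⟨s.s, Z.g, s.s_g⟩
  exact ⟨r1.projective, r3.injective, r3.projective⟩

/-- The sequences splice to a coresolution of `X 0` by projective-injectives ending in `X d`. Since
`X d` is injective but not projective, no sequence in the chain can be shortened by splitting, so
both dimensions are exactly `d`. -/
lemma dimensions_of_chain (d : ℕ) (X : ℕ → C)
    (hX : ∀ j < d, ∃ Z : ShortComplex C, Z.ShortExact ∧ Nonempty (Z.X₁ ≅ X j) ∧
      Nonempty (Z.X₃ ≅ X (j + 1)) ∧ Injective Z.X₂ ∧ Projective Z.X₂)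
    (hi : Injective (X d)) (hp : ¬ Projective (X d)) :
    (∀ n, HasInjectiveDimensionLT (X 0) n ↔ d < n) ∧ ∀ n, HasDomDimGE n (X 0) ↔ n ≤ d := by
  induction d generalizing X with
  | zero =>
    refine ⟨fun n => ⟨fun h => ?_, fun h => ?_⟩, fun n => ⟨fun h => ?_, fun h => ?_⟩⟩
    · by_contra h0
      obtain rfl : n = 0 := by omega
      exact hp (Projective.of_iso (isZero_of_hasInjectiveDimensionLT_zero (X 0)).isoZero.symm
        inferInstance)
    · exact hasInjectiveDimensionLT_of_ge (X 0) 1 n h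
    · by_contra h0
      obtain ⟨n, rfl⟩ : ∃ k, n = k + 1 := ⟨n - 1, by omega⟩
      obtain ⟨Z, hZ, ⟨e⟩, h2, h3, -⟩ := h
      have : Injective Z.X₁ := Injective.of_iso e.symm hi
      exact hp (Projective.of_iso e (injective_and_projective_of_shortExact hZ).1)
    · obtain rfl : n = 0 := by omega
      trivial
  | succ d ih =>
    obtain ⟨h1, h2⟩ := ih (fun j => X (j + 1)) (fun j hj => hX (j + 1) (by omega)) hi hp
    obtain ⟨Z, hZ, ⟨e1⟩, ⟨e3⟩, hZi, hZp⟩ := hX 0 (by omega)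
    have h3 : ∀ n, HasInjectiveDimensionLT (X 0) (n + 2) ↔ d < n + 1 := fun n => by
      rw [← h1]
      constructor
      · intro h
        have := hasInjectiveDimensionLT_of_iso e1.symm (n + 2)
        have := (hZ.hasInjectiveDimensionLT_X₃_iff n hZi).2 this
        exact hasInjectiveDimensionLT_of_iso e3 (n + 1)
      · intro h
        have := hasInjectiveDimensionLT_of_iso e3.symm (n + 1)
        have := (hZ.hasInjectiveDimensionLT_X₃_iff n hZi).1 this
        exact hasInjectiveDimensionLT_of_iso e1 (n + 2)
    have h4 : ¬ HasInjectiveDimensionLT (X 0) 1 := by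
      intro h
      have h5 : Injective (X 0) := injective_iff_hasInjectiveDimensionLT_one.2 h
      have : Injective Z.X₁ := Injective.of_iso e1.symm h5
      obtain ⟨-, h6, h7⟩ := injective_and_projective_of_shortExact hZ
      have h6 : Injective (X 1) := Injective.of_iso e3 h6
      have h7 : Projective (X 1) := Projective.of_iso e3 h7
      -- If `X 0` were injective, the first sequence would split and `X 1` would be injective and
      -- projective. The induction hypothesis then makes `X 1` the last term, which is not
      -- projective.
      have h8 : d < 1 := (h1 1).1 inferInstance
      obtain rfl : d = 0 := by omega
      exact hp h7
    refine ⟨fun n => ?_, fun n => ?_⟩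
    · match n with
      | 0 => exact ⟨fun h => absurd (hasInjectiveDimensionLT_of_ge (X 0) 0 1 (by omega)) h4,
          fun h => by omega⟩
      | 1 => exact ⟨fun h => absurd h h4, fun h => by omega⟩
      | n + 2 => exact (h3 n).trans (by omega)
    · match n with
      | 0 => exact ⟨fun _ => by omega, fun _ => trivial⟩
      | n + 1 =>
        rw [Nat.add_le_add_iff_right, ← h2]
        constructor
        · rintro ⟨Z', hZ', ⟨e⟩, h5, h6, h7⟩
          exact (h7.of_two_shortExact hZ' hZ (e ≪≫ e1.symm) h5 hZi hZp).of_iso e3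
        · intro h
          exact HasDomDimGE.of_iso e1 (HasDomDimGE.of_shortExact hZ hZi hZp (h.of_iso e3.symm))

end Chain

namespace LeftSystem

open PathSystem

variable {H : Type v} {T : HalfEdgeData H} {K : Type u} [Field K] {C : Type w} [Ring C]
  [Algebra K C] (S : LeftSystem T K C)

/-! ### The filtration by the length of paths -/

/-- The span of the paths of length at least `n`. -/
def filt (n : ℕ) : Submodule K C :=
  Submodule.span K {x | ∃ h j, n ≤ j ∧ x = S.p h j}

lemma p_mem_filt {n : ℕ} (h : H) {j : ℕ} (hj : n ≤ j) : S.p h j ∈ S.filt n :=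
  Submodule.subset_span ⟨h, j, hj, rfl⟩

lemma filt_zero : S.filt 0 = ⊤ := by
  rw [← S.span]
  refine congrArg _ (Set.ext fun x => ?_)
  exact ⟨fun ⟨h, j, _, hx⟩ => ⟨(h, j), hx.symm⟩, fun ⟨⟨h, j⟩, hx⟩ => ⟨h, j, Nat.zero_le _, hx.symm⟩⟩

lemma mul_mem_filt {i j : ℕ} {x y : C} (hx : x ∈ S.filt i) (hy : y ∈ S.filt j) :
    x * y ∈ S.filt (i + j) := by
  have h : x * y ∈ S.filt i * S.filt j := Submodule.mul_mem_mul hx hy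
  rw [filt, filt, Submodule.span_mul_span] at h
  refine Submodule.span_le.2 ?_ h
  rintro _ ⟨_, ⟨h, m, hm, rfl⟩, _, ⟨k, n, hn, rfl⟩, rfl⟩
  change S.p h m * S.p k n ∈ S.filt (i + j)
  rcases S.p_mul_p_cases h k m n with h1 | ⟨g, h1⟩
  · rw [h1]; exact zero_mem _
  · rw [h1]; exact S.p_mem_filt g (by omega)

lemma mul_a_mem_filt (x : C) (h : H) : x * S.a h ∈ S.filt 1 := by
  rw [← zero_add 1]
  exact S.mul_mem_filt (by rw [filt_zero]; trivial) (by rw [← p_one]; exact S.p_mem_filt _ le_rfl)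

lemma pow_mem_filt {x : C} (hx : x ∈ S.filt 1) (n : ℕ) : x ^ n ∈ S.filt n := by
  induction n with
  | zero => rw [filt_zero]; trivial
  | succ n ih => rw [pow_succ]; exact S.mul_mem_filt ih hx

section

variable [Finite H] (hT : T.IsBrauer)
include hT

lemma isNilpotent_of_mem_filt {x : C} (hx : x ∈ S.filt 1) : IsNilpotent x := by
  have := Fintype.ofFinite H
  -- A crude bound: the sum dominates every `len h`, and longer paths vanish.
  refine ⟨(∑ h : H, T.len h) + 1, ?_⟩
  have h1 := S.pow_mem_filt hx ((∑ h : H, T.len h) + 1)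
  suffices h2 : S.filt ((∑ h : H, T.len h) + 1) = ⊥ by rwa [h2, Submodule.mem_bot] at h1
  rw [filt, Submodule.span_eq_bot]
  rintro _ ⟨h, j, hj, rfl⟩
  refine S.p_eq_zero hT h j ?_
  have := Finset.single_le_sum (f := T.len) (fun _ _ => Nat.zero_le _) (Finset.mem_univ h)
  omega

include S in
lemma finite : Module.Finite K C := by
  have : Finite (Σ h : H, Fin (T.len h + 1)) := inferInstance
  refine ⟨⟨(Set.finite_range fun x : Σ h : H, Fin (T.len h + 1) => S.p x.1 x.2).toFinset, ?_⟩⟩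
  rw [Set.Finite.coe_toFinset, eq_top_iff, ← S.span, Submodule.span_le]
  rintro _ ⟨⟨h, j⟩, rfl⟩
  rcases Nat.lt_or_ge (T.len h) j with h1 | h1
  · change S.p h j ∈ _
    rw [S.p_eq_zero hT h j h1]
    exact zero_mem _
  · exact Submodule.subset_span ⟨⟨h, ⟨j, by omega⟩⟩, rfl⟩

/-- The Frobenius property: nondegeneracy makes `x ↦ t (· * x)` injective into the dual space, hence
surjective by dimension. -/
lemma exists_t_eq (μ : C →ₗ[K] K) : ∃ x, ∀ c, μ c = S.t (c * x) := by
  have := S.finite hT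
  let F : C →ₗ[K] (C →ₗ[K] K) := LinearMap.mk₂ K (fun x c => S.t (c * x))
    (fun a b c => by rw [mul_add, map_add]) (fun k a c => by rw [mul_smul_comm, map_smul])
    (fun a b c => by rw [add_mul, map_add]) (fun k a c => by rw [smul_mul_assoc, map_smul])
  have hF : Function.Injective F := (injective_iff_map_eq_zero F).2 fun x hx =>
    S.eq_zero_of_t_eq_zero hT x fun c => LinearMap.congr_fun hx c
  have hF2 : Function.Surjective F :=
    (LinearMap.injective_iff_surjective_of_finrank_eq_finrank
      (Subspace.dual_finrank_eq (K := K) (V := C)).symm).1 hF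
  obtain ⟨x, hx⟩ := hF2 μ
  exact ⟨x, fun c => by rw [← hx]; rfl⟩

/-- The arrow is a right factor of the full cycle, on which `t` is `1`. -/
lemma a_ne_zero (h : H) : S.a h ≠ 0 := by
  intro h0
  have h1 := S.t_len h
  obtain ⟨n, hn⟩ : ∃ n, T.len h = n + 1 := ⟨T.len h - 1, by have := hT.len_pos h; omega⟩
  rw [hn, show T.path S.e S.a h (n + 1) = _ from S.p_succ' h n, h0, mul_zero, map_zero] at h1
  exact zero_ne_one h1

/-! ### Leaves of multiplicity one -/

-- At such a leaf the loop is itself the full cycle, so its square is already too long to be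
-- nonzero.
include S in
lemma mul_a_leaf {h : H} (h1 : T.succ h = h) (h2 : T.mult h = 1) :
    T.len h = 1 ∧ (∀ k, S.a k * S.a h = 0) ∧ ∀ k, S.a h * S.a k = 0 := by
  have hlen : T.len h = 1 := by
    rw [HalfEdgeData.len, h2, mul_one]
    exact Function.minimalPeriod_eq_one_iff_isFixedPt.2 h1
  have h3 : S.a h * S.a h = 0 := by
    have h3 := S.p_len_succ hT h
    rwa [hlen, S.p_succ, S.p_one, Function.iterate_one, h1] at h3
  refine ⟨hlen, fun k => ?_, fun k => ?_⟩
  · by_cases h4 : k = h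
    · rw [h4, h3]
    · exact S.a_mul_a_of_ne _ _ (by rwa [h1])
  · by_cases h4 : k = h
    · rw [h4, h3]
    · exact S.a_mul_a_of_ne _ _ fun h5 => h4 (T.succ.injective (by rw [← h5, h1]))

end

end LeftSystem

end GendoBrauer

namespace GendoBrauer

/-! ### Left ideals as modules over a quotient algebra -/

section Cyclic

variable {K : Type u} [Field K] {C Γ : Type w} [Ring C] [Algebra K C] [Ring Γ] [Algebra K Γ]

/-- An element of `C` whose left ideal is a module over the quotient `Γ` of `C`. -/
structure Cyclic (π : C →ₐ[K] Γ) where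
  gen : C
  surj : Function.Surjective π
  mul_gen : ∀ z, π z = 0 → z * gen = 0

namespace Cyclic

variable {π : C →ₐ[K] Γ} (B : Cyclic π)

/-- The left ideal generated by the element. -/
def Mod : Type w := Submodule.span C {B.gen}

instance : AddCommGroup B.Mod := inferInstanceAs (AddCommGroup (Submodule.span C {B.gen}))

instance : Module C B.Mod := inferInstanceAs (Module C (Submodule.span C {B.gen}))

/-- The multiple of the generator by a given element. -/
def el (c : C) : B.Mod := ⟨c * B.gen, Submodule.mem_span_singleton.2 ⟨c, rfl⟩⟩

/-- The underlying element of `C`. -/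
def val (x : B.Mod) : C := x.1

lemma val_el (c : C) : B.val (B.el c) = c * B.gen := rfl

lemma val_add (x y : B.Mod) : B.val (x + y) = B.val x + B.val y := rfl

lemma val_injective : Function.Injective B.val := Subtype.val_injective

lemma el_surjective : Function.Surjective B.el := fun x => by
  obtain ⟨c, hc⟩ := Submodule.mem_span_singleton.1 x.2
  exact ⟨c, Subtype.ext hc⟩

lemma smul_el (d c : C) : d • B.el c = B.el (d * c) :=
  B.val_injective (by rw [val_el, mul_assoc]; rfl)

lemma smul_eq_zero_of_map_eq_zero (z : C) (hz : π z = 0) (x : B.Mod) : z • x = 0 := by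
  obtain ⟨c, rfl⟩ := B.el_surjective x
  rw [smul_el]
  exact B.val_injective (B.mul_gen _ (by rw [map_mul, hz, zero_mul]))

noncomputable instance : SMul Γ B.Mod := ⟨fun γ x => Function.surjInv B.surj γ • x⟩

lemma map_smul_eq (c : C) (x : B.Mod) : π c • x = c • x := by
  change Function.surjInv B.surj (π c) • x = c • x
  rw [← sub_eq_zero, ← sub_smul]
  exact B.smul_eq_zero_of_map_eq_zero _ (by
    rw [map_sub, Function.surjInv_eq B.surj, sub_self]) x

noncomputable instance : Module Γ B.Mod :=
  Function.Surjective.moduleLeft π.toRingHom B.surj B.map_smul_eq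

lemma map_smul_el (d c : C) : π d • B.el c = B.el (d * c) := by
  rw [map_smul_eq, smul_el]

lemma val_map_smul (d : C) (x : B.Mod) : B.val (π d • x) = d * B.val x := by
  rw [map_smul_eq]; rfl

lemma el_eq_map_smul (c : C) : B.el c = π c • B.el 1 := by rw [map_smul_el, mul_one]

/-- A cyclic module is the quotient by the annihilator of its generator; all maps between left
ideals below are built from this. -/
lemma exists_linearMap {Y : Type*} [AddCommGroup Y] [Module Γ Y] (y : Y)
    (h : ∀ c, c * B.gen = 0 → π c • y = 0) :
    ∃ f : B.Mod →ₗ[Γ] Y, ∀ c, f (B.el c) = π c • y := by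
  have key : ∀ c d, B.el c = B.el d → π c • y = π d • y := by
    intro c d hcd
    rw [← sub_eq_zero, ← sub_smul, ← map_sub]
    refine h _ ?_
    rw [sub_mul, sub_eq_zero]
    exact congrArg B.val hcd
  choose r hr using B.el_surjective
  refine ⟨{ toFun := fun x => π (r x) • y, map_add' := fun a b => ?_, map_smul' := fun γ a => ?_ },
    fun c => key _ _ (hr _)⟩
  · rw [← add_smul, ← map_add]
    refine key _ _ (B.val_injective ?_)
    rw [hr, val_el, add_mul, ← val_el, ← val_el, hr, hr]
    rfl
  · obtain ⟨d, rfl⟩ := B.surj γ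
    rw [RingHom.id_apply, smul_smul, ← map_mul]
    refine key _ _ ?_
    rw [hr, ← map_smul_el, hr]

/-- The left ideal generated by an idempotent is projective. -/
lemma projective_mod (h : B.gen * B.gen = B.gen) : Module.Projective Γ B.Mod := by
  obtain ⟨f, hf⟩ := B.exists_linearMap (π B.gen) fun c hc => by
    rw [smul_eq_mul, ← map_mul, hc, map_zero]
  refine Module.Projective.of_split f (LinearMap.toSpanSingleton Γ B.Mod (B.el 1)) ?_
  refine LinearMap.ext fun x => ?_
  obtain ⟨c, rfl⟩ := B.el_surjective x
  rw [LinearMap.comp_apply, hf, LinearMap.toSpanSingleton_apply, smul_eq_mul, ← map_mul,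
    map_smul_el, LinearMap.id_apply]
  exact B.val_injective (by rw [val_el, val_el, mul_one, mul_assoc, h])

/-- An injectivity criterion for left ideals in quotients of Frobenius algebras. -/
lemma injective_mod (t : C →ₗ[K] K) (ht : ∀ x, (∀ c, t (c * x) = 0) → x = 0)
    (ht' : ∀ μ : C →ₗ[K] K, ∃ x, ∀ c, μ c = t (c * x)) (e : C) (he : B.gen * e = B.gen)
    (hB : ∀ y, (∀ z, π z = 0 → z * y = 0) → ∃ c, y * e = c * B.gen) :
    Module.Injective Γ B.Mod := by
  refine Module.Baer.injective fun J g => ?_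
  let J' : Submodule K C := (J.restrictScalars K).comap π.toLinearMap
  -- Composing `g` with `t` gives a functional on the preimage of `J`. Its extension to `C` has the
  -- form `t (· * x)`, and nondegeneracy recovers `g (π c) = c * x`.
  let ν : J' →ₗ[K] K :=
    { toFun := fun c => t (B.val (g ⟨π c.1, c.2⟩))
      map_add' := fun a b => by
        rw [← map_add, ← val_add, ← map_add]
        congr 3
        exact Subtype.ext (map_add π _ _)
      map_smul' := fun k a => by
        rw [RingHom.id_apply, ← map_smul, Algebra.smul_def, ← val_map_smul, ← map_smul]
        congr 3
        refine Subtype.ext ?_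
        change π (k • a.1) = π (algebraMap K C k) * π a.1
        rw [← map_mul, Algebra.smul_def] }
  obtain ⟨μ, hμ⟩ := LinearMap.exists_extend ν
  obtain ⟨x, hx⟩ := ht' μ
  have h1 : ∀ (c : C) (hc : π c ∈ J), B.val (g ⟨π c, hc⟩) = c * x := by
    intro c hc
    rw [← sub_eq_zero]
    refine ht _ fun d => ?_
    have hdc : π (d * c) ∈ J := by rw [map_mul]; exact J.mul_mem_left _ hc
    rw [mul_sub, map_sub, sub_eq_zero, ← mul_assoc, ← hx, ← val_map_smul, ← map_smul]
    have h2 := LinearMap.congr_fun hμ ⟨d * c, hdc⟩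
    refine Eq.trans ?_ h2.symm
    change _ = t (B.val (g ⟨π (d * c), hdc⟩))
    congr 3
    exact Subtype.ext (map_mul π d c).symm
  -- Elements of the kernel of `π` annihilate `x` because `g 0 = 0`; so `x * e` is a multiple of the
  -- generator, and right multiplication by it extends `g`.
  obtain ⟨c, hc⟩ := hB x fun z hz => by
    rw [← h1 z (by rw [hz]; exact J.zero_mem)]
    have : (⟨π z, by rw [hz]; exact J.zero_mem⟩ : J) = 0 := Subtype.ext hz
    rw [this, map_zero]
    rfl
  refine ⟨LinearMap.toSpanSingleton Γ B.Mod (B.el c), fun γ hγ => ?_⟩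
  obtain ⟨d, rfl⟩ := B.surj γ
  rw [LinearMap.toSpanSingleton_apply]
  refine B.val_injective ?_
  have h3 : ∀ y : B.Mod, B.val y * e = B.val y := fun y => by
    obtain ⟨b, rfl⟩ := B.el_surjective y
    rw [val_el, mul_assoc, he]
  rw [val_map_smul, val_el, ← hc, ← mul_assoc, ← h1 d hγ, h3]

/-- The first map is the inclusion of left ideals, the second is right multiplication by `Y.gen`;
the last hypothesis identifies the kernel. -/
lemma shortExact {X P Y : Cyclic π} (h0 : P.gen * P.gen = P.gen) (h1 : X.gen * P.gen = X.gen) (h2 : P.gen * Y.gen = Y.gen)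
    (h3 : X.gen * Y.gen = 0)
    (h4 : ∀ c, c * P.gen = c → c * Y.gen = 0 → ∃ d, c = d * X.gen) :
    ∃ Z : ShortComplex (ModuleCat.{w} Γ), Z.ShortExact ∧ Z.X₁ = ModuleCat.of Γ X.Mod ∧
      Z.X₂ = ModuleCat.of Γ P.Mod ∧ Z.X₃ = ModuleCat.of Γ Y.Mod := by
  obtain ⟨f, hf⟩ := X.exists_linearMap (P.el X.gen) fun c hc => by
    rw [map_smul_el, hc]; exact P.val_injective (zero_mul _)
  obtain ⟨g, hg⟩ := P.exists_linearMap (Y.el 1) fun c hc => by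
    rw [← el_eq_map_smul]
    refine Y.val_injective ?_
    rw [val_el, ← h2, ← mul_assoc, hc, zero_mul]
    rfl
  have hgf : ∀ x, g (f x) = 0 := fun x => by
    obtain ⟨c, rfl⟩ := X.el_surjective x
    rw [hf, map_smul, hg, ← el_eq_map_smul, map_smul_el]
    refine Y.val_injective ?_
    rw [val_el, mul_assoc, h3, mul_zero]
    rfl
  refine ⟨ShortComplex.mk (ModuleCat.ofHom f) (ModuleCat.ofHom g)
    (ModuleCat.hom_ext (LinearMap.ext hgf)), ?_, rfl, rfl, rfl⟩
  refine { exact := ?_, mono_f := ?_, epi_g := ?_ }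
  · rw [ShortComplex.moduleCat_exact_iff]
    intro x hx
    obtain ⟨c, rfl⟩ := P.el_surjective x
    have h5 : c * P.gen * Y.gen = 0 := by
      rw [mul_assoc, h2, ← val_el, el_eq_map_smul, ← hg]
      exact congrArg Y.val hx
    have h6 : c * P.gen * P.gen = c * P.gen := by rw [mul_assoc, h0]
    obtain ⟨d, hd⟩ := h4 (c * P.gen) h6 h5
    refine ⟨X.el d, ?_⟩
    change f (X.el d) = P.el c
    rw [hf, map_smul_el, ← hd]
    exact P.val_injective h6
  · rw [ModuleCat.mono_iff_injective]
    refine (injective_iff_map_eq_zero f).2 fun x hx => ?_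
    obtain ⟨c, rfl⟩ := X.el_surjective x
    rw [hf, map_smul_el] at hx
    have := congrArg P.val hx
    rw [val_el, mul_assoc, h1] at this
    exact X.val_injective this
  · rw [ModuleCat.epi_iff_surjective]
    intro y
    obtain ⟨c, rfl⟩ := Y.el_surjective y
    exact ⟨P.el c, by rw [Y.el_eq_map_smul]; exact hg c⟩

end Cyclic

end Cyclic

end GendoBrauer

namespace GendoBrauer

open HalfEdgeData

/-! ### Brauer graph algebras modulo the socles of some leaves -/

section LeafQuotient

variable {H : Type v} {T : HalfEdgeData H} {K : Type u} [Field K] {C Γ : Type w} [Ring C]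
  [Algebra K C] [Ring Γ] [Algebra K Γ]

/-- The algebra `Γ` is the quotient of a Brauer graph algebra by the socles at the leaves in `L`,
which coincide with the loops at these leaves. -/
structure IsLeafQuotient (S : LeftSystem T K C) (L : Set H) (π : C →ₐ[K] Γ) : Prop where
  surj : Function.Surjective π
  ker : ∀ x, π x = 0 ↔ x ∈ Submodule.span K (S.a '' L)
  succ_leaf : ∀ h ∈ L, T.succ h = h
  mult_leaf : ∀ h ∈ L, T.mult h = 1
  opp_leaf : ∀ h ∈ L, T.opp h ∉ L

/-- The number of steps after which Green's walk returns to `L`. -/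
noncomputable def HalfEdgeData.returnTime (T : HalfEdgeData H) (L : Set H) (h : H) : ℕ :=
  sInf {k | 0 < k ∧ T.green^[k] h ∈ L}

lemma HalfEdgeData.IsBrauer.green_injective (hT : T.IsBrauer) : Function.Injective T.green :=
  fun a b h => T.succ.symm.injective
    (by rw [← hT.opp_opp (T.succ.symm a), ← hT.opp_opp (T.succ.symm b)]; exact congrArg T.opp h)

/-- Green's walk is an injective map of a finite set, so it comes back to its start; the infimum
defining the return time is therefore attained. -/
lemma HalfEdgeData.IsBrauer.returnTime_mem [Finite H] (hT : T.IsBrauer) (L : Set H) {h : H}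
    (hh : h ∈ L) : 0 < T.returnTime L h ∧ T.green^[T.returnTime L h] h ∈ L := by
  have : {k | 0 < k ∧ T.green^[k] h ∈ L}.Nonempty :=
    ⟨Function.minimalPeriod T.green h, Function.minimalPeriod_pos_of_mem_periodicPts
      (hT.green_injective.mem_periodicPts h), by
        rw [Function.iterate_minimalPeriod]; exact hh⟩
  exact Nat.sInf_mem this

lemma HalfEdgeData.notMem_of_lt_returnTime {L : Set H} {h : H} {k : ℕ} (h0 : 0 < k)
    (hk : k < T.returnTime L h) : T.green^[k] h ∉ L := fun h1 =>
  Nat.notMem_of_lt_sInf hk ⟨h0, h1⟩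

namespace IsLeafQuotient

variable {S : LeftSystem T K C} {L : Set H} {π : C →ₐ[K] Γ} (hQ : IsLeafQuotient S L π)
include hQ

lemma map_a_leaf {h : H} (hh : h ∈ L) : π (S.a h) = 0 :=
  (hQ.ker _).2 (Submodule.subset_span ⟨h, hh, rfl⟩)

lemma mul_eq_zero_of_map_eq_zero {y : C} (hy : ∀ h ∈ L, S.a h * y = 0) {z : C} (hz : π z = 0) :
    z * y = 0 := by
  have h1 := (hQ.ker z).1 hz
  induction h1 using Submodule.span_induction with
  | mem x hx => obtain ⟨h, hh, rfl⟩ := hx; exact hy h hh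
  | zero => exact zero_mul _
  | add x x' hx hx' h1 h2 =>
    rw [add_mul, h1 ((hQ.ker x).2 hx), h2 ((hQ.ker x').2 hx'), add_zero]
  | smul k x hx h1 => rw [smul_mul_assoc, h1 ((hQ.ker x).2 hx), smul_zero]

/-- Indecomposable projective modules of the Brauer graph algebra which are modules over the
quotient. -/
def projMod (h : H) (h1 : h ∉ L) (h2 : T.opp h ∉ L) : Cyclic π where
  gen := S.e h
  surj := hQ.surj
  mul_gen _ hz := hQ.mul_eq_zero_of_map_eq_zero (fun k hk => by
    have := S.p_mul_e_of_ne h k 1 (fun h3 => h1 (h3 ▸ hk)) (fun h3 => h2 (h3 ▸ hk))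
    rwa [S.p_one] at this) hz

lemma projective_projMod (h : H) (h1 : h ∉ L) (h2 : T.opp h ∉ L) :
    Projective (ModuleCat.of Γ (hQ.projMod h h1 h2).Mod) :=
  (IsProjective.iff_projective _).1 (Cyclic.projective_mod _ (S.e_mul_self h))

variable [Finite H] (hT : T.IsBrauer)
include hT

/-- The left ideals generated by the arrows. -/
def arrowMod (h : H) : Cyclic π where
  gen := S.a h
  surj := hQ.surj
  mul_gen _ hz := hQ.mul_eq_zero_of_map_eq_zero (fun k hk =>
    (S.mul_a_leaf hT (hQ.succ_leaf k hk) (hQ.mult_leaf k hk)).2.2 h) hz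

lemma injective_projMod (h : H) (h1 : h ∉ L) (h2 : T.opp h ∉ L) :
    Injective (ModuleCat.of Γ (hQ.projMod h h1 h2).Mod) := by
  have := Cyclic.injective_mod (hQ.projMod h h1 h2) S.t (S.eq_zero_of_t_eq_zero hT)
    (S.exists_t_eq hT) (S.e h) (S.e_mul_self h) fun y _ => ⟨y, rfl⟩
  exact Module.injective_object_of_injective_module _ _

/-- By the injectivity criterion, take `y` annihilated on the left by the loop at `opp q`. As this
loop has full length one, `y e_q = α e_q + c a_q` with a scalar `α`, and multiplying by the loop
shows `α = 0`. -/
lemma injective_arrowMod (q : H) (hq : T.opp q ∈ L) :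
    Injective (ModuleCat.of Γ (hQ.arrowMod hT q).Mod) := by
  have := Cyclic.injective_mod (hQ.arrowMod hT q) S.t (S.eq_zero_of_t_eq_zero hT)
    (S.exists_t_eq hT) (S.e q) (S.a_mul_e q) fun y hy => by
      obtain ⟨α, c, hc⟩ := S.exists_repr hT (T.opp q) y
      rw [(S.mul_a_leaf hT (hQ.succ_leaf _ hq) (hQ.mult_leaf _ hq)).1, Finset.sum_range_one, hT.opp_opp, S.e_opp, S.p_zero] at hc
      have h1 := hy _ (hQ.map_a_leaf hq)
      have h2 : S.a (T.opp q) * (y * S.e q) = α 0 • S.a (T.opp q) := by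
        rw [hc, mul_add, mul_smul_comm, S.a_mul_e, ← mul_assoc, add_eq_left]
        exact (hQ.arrowMod hT q).mul_gen _ (by rw [map_mul, hQ.map_a_leaf hq, zero_mul])
      rw [← mul_assoc, h1, zero_mul] at h2
      have h3 : α 0 = 0 := (smul_eq_zero.1 h2.symm).resolve_right (S.a_ne_zero hT _)
      exact ⟨c, by rw [hc, h3, zero_smul, zero_add]; rfl⟩
  exact Module.injective_object_of_injective_module _ _

/-- A section of `C e → C a_q`, where `e` belongs to the edge of `succ q`, gives `b e = e + d a_k`
with `k = opp (succ q)`. Since `a_k a_q = 0`, also `a_k b e = 0`, that is `(1 + a_k d) a_k = 0`. But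
`a_k d` is nilpotent, so `a_k` would vanish. -/
lemma not_projective_arrowMod (q : H) (h1 : T.succ q ∉ L) (h2 : T.opp (T.succ q) ∉ L) :
    ¬ Projective (ModuleCat.of Γ (hQ.arrowMod hT q).Mod) := by
  intro hp
  have hp := (IsProjective.iff_projective _).2 hp
  let P := hQ.projMod (T.succ q) h1 h2
  let N := hQ.arrowMod hT q
  obtain ⟨f, hf⟩ := P.exists_linearMap (N.el 1) fun c hc => by
    rw [← N.el_eq_map_smul]
    refine N.val_injective ?_
    rw [N.val_el]
    change c * S.a q = 0
    rw [← S.e_mul_a, ← mul_assoc, show c * S.e (T.succ q) = 0 from hc, zero_mul]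
  have hfs : Function.Surjective f := fun y => by
    obtain ⟨c, rfl⟩ := N.el_surjective y
    exact ⟨P.el c, by rw [hf, ← N.el_eq_map_smul]⟩
  obtain ⟨σ, hσ⟩ := Module.projective_lifting_property f LinearMap.id hfs
  obtain ⟨b, hb⟩ := P.el_surjective (σ (N.el 1))
  have h3 : f (P.el b) = N.el 1 := by rw [hb]; exact LinearMap.congr_fun hσ _
  rw [hf, ← N.el_eq_map_smul] at h3
  have h3 : b * S.a q = S.a q := by
    have := congrArg N.val h3
    rw [N.val_el, N.val_el, one_mul] at this
    exact this
  obtain ⟨d, hd⟩ := S.exists_eq_mul_of_mul_a_eq_zero hT q ((b - 1) * S.e (T.succ q))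
    (by rw [mul_assoc, S.e_mul_self])
    (by rw [mul_assoc, S.e_mul_a, sub_mul, h3, one_mul, sub_self])
  rw [sub_mul, one_mul, sub_eq_iff_eq_add] at hd
  set k := T.opp (T.succ q) with hk
  have h4 : π (S.a k) • N.el 1 = 0 := by
    rw [N.map_smul_el, mul_one]
    exact N.val_injective (S.turn q)
  have h5 : S.a k * (b * S.e (T.succ q)) = 0 := by
    have h6 := congrArg σ h4
    rw [map_smul, map_zero, ← hb, P.map_smul_el] at h6
    have h7 := congrArg P.val h6
    rw [P.val_el, mul_assoc] at h7
    exact h7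
  rw [hd, mul_add, ← S.e_opp (T.succ q), ← hk, S.a_mul_e, ← mul_assoc] at h5
  have h6 : IsUnit (1 + S.a k * d) := by
    have h7 := S.isNilpotent_of_mem_filt hT (S.mul_a_mem_filt d k)
    obtain ⟨n, hn⟩ := h7
    refine IsNilpotent.isUnit_one_add ⟨n + 1, ?_⟩
    rw [pow_succ, ← mul_assoc, mul_pow_mul, hn, mul_zero, zero_mul]
  have h8 : (1 + S.a k * d) * S.a k = 0 := by
    rw [add_mul, one_mul, ← h5, add_comm]
  exact S.a_ne_zero hT k ((h6.mul_right_eq_zero).1 h8)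

/-- Right multiplication by the arrow into the edge of `q` at its other end has kernel `C a_q`, by
the description of annihilators of arrows. The middle term is `C e_q`, untouched by the passage to
`Γ`. -/
lemma shortExact_arrowMod (q : H) (h1 : q ∉ L) (h2 : T.opp q ∉ L) :
    ∃ Z : ShortComplex (ModuleCat.{w} Γ), Z.ShortExact ∧
      Nonempty (Z.X₁ ≅ ModuleCat.of Γ (hQ.arrowMod hT q).Mod) ∧
      Nonempty (Z.X₃ ≅ ModuleCat.of Γ (hQ.arrowMod hT (T.succ.symm (T.opp q))).Mod) ∧
      Injective Z.X₂ ∧ Projective Z.X₂ := by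
  obtain ⟨Z, hZ, e1, e2, e3⟩ := Cyclic.shortExact (X := hQ.arrowMod hT q)
    (P := hQ.projMod q h1 h2) (Y := hQ.arrowMod hT (T.succ.symm (T.opp q))) (S.e_mul_self q)
    (S.a_mul_e q)
    (by
      have := S.e_mul_a (T.succ.symm (T.opp q))
      rwa [Equiv.apply_symm_apply, S.e_opp] at this)
    (by
      have := S.turn (T.succ.symm (T.opp q))
      rwa [Equiv.apply_symm_apply, hT.opp_opp] at this)
    (fun c hc hc2 => by
      have := S.exists_eq_mul_of_mul_a_eq_zero hT (T.succ.symm (T.opp q)) c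
        (by rw [Equiv.apply_symm_apply, S.e_opp]; exact hc) hc2
      rwa [Equiv.apply_symm_apply, hT.opp_opp] at this)
  exact ⟨Z, hZ, ⟨eqToIso e1⟩, ⟨eqToIso e3⟩, e2 ▸ hQ.injective_projMod hT q h1 h2,
    e2 ▸ hQ.projective_projMod q h1 h2⟩

lemma dimensions_arrowMod {h : H} (hh : h ∈ L) (hr : 3 ≤ T.returnTime L h) :
    (∀ n, HasInjectiveDimensionLT
      (ModuleCat.of Γ (hQ.arrowMod hT (T.succ.symm (T.opp h))).Mod) n ↔
        T.returnTime L h - 2 < n) ∧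
    ∀ n, HasDomDimGE n (ModuleCat.of Γ (hQ.arrowMod hT (T.succ.symm (T.opp h))).Mod) ↔
        n ≤ T.returnTime L h - 2 := by
  obtain ⟨d, hd⟩ : ∃ d, T.returnTime L h = d + 3 := ⟨_, (Nat.sub_add_cancel hr).symm⟩
  -- Here `opp (q j)` is the position of the walk after `j + 2` steps. The chain therefore stops,
  -- with `opp (q j)` in `L`, at `j` equal to the return time minus two.
  let q : ℕ → H := fun j => T.succ.symm (T.green^[j + 1] h)
  have hq0 : q 0 = T.succ.symm (T.opp h) := by
    have : T.succ.symm h = h := by rw [Equiv.symm_apply_eq, hQ.succ_leaf h hh]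
    simp only [q, zero_add, Function.iterate_one, green, this]
  have hq : ∀ j, T.opp (q j) = T.green^[j + 2] h := fun j => by
    rw [Function.iterate_succ_apply']; rfl
  have hq' : ∀ j, q (j + 1) = T.succ.symm (T.opp (q j)) := fun j => by rw [hq]
  have hopp : ∀ j, j < d + 1 → T.opp (q j) ∉ L := fun j hj => by
    rw [hq]; exact notMem_of_lt_returnTime (by omega) (by omega)
  have hmem : ∀ j, j < d + 2 → q j ∉ L := fun j hj hm => by
    have h1 := hQ.succ_leaf _ hm
    have h2 : T.green^[j + 1] h ∈ L := by
      have : T.green^[j + 1] h = q j := by rw [← h1]; simp only [q, Equiv.apply_symm_apply]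
      rw [this]; exact hm
    exact notMem_of_lt_returnTime (by omega) (by omega) h2
  have := dimensions_of_chain (d + 1) (fun j => ModuleCat.of Γ (hQ.arrowMod hT (q j)).Mod)
    (fun j hj => by
      rw [hq']
      exact hQ.shortExact_arrowMod hT (q j) (hmem j (by omega)) (hopp j (by omega)))
    (hQ.injective_arrowMod hT _ (by rw [hq, ← hd]; exact (hT.returnTime_mem L hh).2))
    (hQ.not_projective_arrowMod hT _
      (by rw [hq', Equiv.apply_symm_apply]; exact hopp d (by omega))
      (by rw [hq', Equiv.apply_symm_apply, hT.opp_opp]; exact hmem d (by omega)))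
  rw [hq0] at this
  rw [hd]
  exact this

end IsLeafQuotient

end LeafQuotient

end GendoBrauer

/-! ### Decomposition of the regular module of the quotient. -/

namespace GendoBrauer

open HalfEdgeData

section

variable {K : Type u} [Field K] {C Γ : Type w} [Ring C] [Algebra K C] [Ring Γ] [Algebra K Γ]

/-- Right multiplication as an endomorphism of the regular left module. -/
def rightMul (x : Γ) : ModuleCat.of Γ Γ ⟶ ModuleCat.of Γ Γ :=
  ModuleCat.ofHom (LinearMap.toSpanSingleton Γ Γ x)

/-- The conditions say that right multiplication by the generator identifies `Γ π(e)` with the left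
ideal of `B`. -/
lemma Cyclic.exists_retract {π : C →ₐ[K] Γ} (B : Cyclic π) (e : C) (he : e * B.gen = B.gen)
    (h : ∀ c, c * B.gen = 0 → π (c * e) = 0) :
    ∃ (f : ModuleCat.of Γ Γ ⟶ ModuleCat.of Γ B.Mod) (g : ModuleCat.of Γ B.Mod ⟶ ModuleCat.of Γ Γ),
      f ≫ g = rightMul (π e) ∧ g ≫ f = 𝟙 _ := by
  obtain ⟨g, hg⟩ := B.exists_linearMap (π e) fun c hc => by
    rw [smul_eq_mul, ← map_mul, h c hc]
  refine ⟨ModuleCat.ofHom (LinearMap.toSpanSingleton Γ B.Mod (B.el 1)), ModuleCat.ofHom g,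
    ModuleCat.hom_ext (LinearMap.ext fun (x : Γ) => ?_),
    ModuleCat.hom_ext (LinearMap.ext fun (x : B.Mod) => ?_)⟩
  · change g (x • B.el 1) = x • π e
    rw [map_smul, hg, map_one, one_smul]
  · obtain ⟨c, rfl⟩ := B.el_surjective x
    change g (B.el c) • B.el 1 = B.el c
    rw [hg, smul_eq_mul, ← map_mul, B.map_smul_el]
    refine B.val_injective ?_
    rw [B.val_el, B.val_el, mul_one, mul_assoc, he]

variable {H : Type v} {T : HalfEdgeData H}

namespace IsLeafQuotient

variable {S : LeftSystem T K C} {L : Set H} {π : C →ₐ[K] Γ} (hQ : IsLeafQuotient S L π)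
  [Finite H] (hT : T.IsBrauer)
include hQ hT

/-- Right multiplication by the arrow into the edge of `h` at the non-leaf end has kernel `C a_h` on
`C e_h`. This becomes zero in `Γ`, so `Γ e_h` is the left ideal generated by that arrow. -/
lemma exists_retract_leaf {h : H} (hh : h ∈ L) :
    ∃ (f : ModuleCat.of Γ Γ ⟶ ModuleCat.of Γ (hQ.arrowMod hT (T.succ.symm (T.opp h))).Mod)
      (g : ModuleCat.of Γ (hQ.arrowMod hT (T.succ.symm (T.opp h))).Mod ⟶ ModuleCat.of Γ Γ),
      f ≫ g = rightMul (π (S.e h)) ∧ g ≫ f = 𝟙 _ := by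
  refine Cyclic.exists_retract _ (S.e h) ?_ ?_
  · have := S.e_mul_a (T.succ.symm (T.opp h))
    rwa [Equiv.apply_symm_apply, S.e_opp] at this
  · intro c hc
    change c * S.a _ = 0 at hc
    obtain ⟨d, hd⟩ := S.exists_eq_mul_of_mul_a_eq_zero hT (T.succ.symm (T.opp h)) (c * S.e h)
      (by rw [Equiv.apply_symm_apply, S.e_opp, mul_assoc, S.e_mul_self])
      (by
        have := S.e_mul_a (T.succ.symm (T.opp h))
        rw [Equiv.apply_symm_apply, S.e_opp] at this
        rw [mul_assoc, this, hc])
    rw [hd, map_mul, Equiv.apply_symm_apply, hT.opp_opp, hQ.map_a_leaf hh, mul_zero]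

/-- The regular module is a summand of a sum of modules `Γ e_h`. Those away from `L` satisfy `P` by
assumption; those at `L` are arrow ideals, themselves retracts of the regular module. -/
lemma regular_iff {P : ModuleCat.{w} Γ → Prop} (hP : IsAddClosed P)
    (hproj : ∀ h h1 h2, P (ModuleCat.of Γ (hQ.projMod h h1 h2).Mod)) :
    P (ModuleCat.of Γ Γ) ↔
      ∀ h ∈ L, P (ModuleCat.of Γ (hQ.arrowMod hT (T.succ.symm (T.opp h))).Mod) := by
  constructor
  · intro h1 h hh
    obtain ⟨f, g, -, h2⟩ := hQ.exists_retract_leaf hT hh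
    exact hP.retract _ _ ⟨g, f, h2⟩ h1
  · intro h1
    have h2 : ∀ h, ∃ (X : ModuleCat.{w} Γ) (_ : P X) (f : ModuleCat.of Γ Γ ⟶ X)
        (g : X ⟶ ModuleCat.of Γ Γ), f ≫ g = rightMul (π (S.e h)) := by
      intro h
      by_cases h3 : h ∈ L
      · obtain ⟨f, g, hfg, -⟩ := hQ.exists_retract_leaf hT h3
        exact ⟨_, h1 h h3, f, g, hfg⟩
      by_cases h4 : T.opp h ∈ L
      · obtain ⟨f, g, hfg, -⟩ := hQ.exists_retract_leaf hT h4
        exact ⟨_, h1 _ h4, f, g, by rw [hfg, S.e_opp]⟩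
      · obtain ⟨f, g, hfg, -⟩ := Cyclic.exists_retract (hQ.projMod h h3 h4) (S.e h)
          (S.e_mul_self h) fun c hc => by
            rw [show c * S.e h = 0 from hc, map_zero]
        exact ⟨_, hproj h h3 h4, f, g, hfg⟩
    choose X hX f g hfg using h2
    refine IsAddClosed.of_sum_comp_eq_id hP S.reps X (fun h _ => hX h) f g ?_
    simp only [hfg]
    refine ModuleCat.hom_ext (LinearMap.ext fun (x : Γ) => ?_)
    rw [ModuleCat.hom_sum, LinearMap.sum_apply]
    change ∑ h ∈ S.reps, x • π (S.e h) = x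
    rw [← Finset.smul_sum, ← map_sum, S.sum_e, map_one, smul_eq_mul, mul_one]

/-- The bound is `n + 1` and not `n` because the projectives away from `L` are injective but
nonzero. -/
lemma hasInjectiveDimensionLT_regular_iff (hr : ∀ h ∈ L, 3 ≤ T.returnTime L h) (n : ℕ) :
    HasInjectiveDimensionLT (ModuleCat.of Γ Γ) (n + 1) ↔ ∀ h ∈ L, T.returnTime L h - 2 ≤ n := by
  rw [hQ.regular_iff hT (hasInjectiveDimensionLT_isAddClosed (n + 1)) fun h h1 h2 => by
    have := hQ.injective_projMod hT h h1 h2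
    exact hasInjectiveDimensionLT_of_ge _ 1 (n + 1) (by omega)]
  refine forall₂_congr fun h hh => ?_
  rw [(hQ.dimensions_arrowMod hT hh (hr h hh)).1, Nat.lt_succ_iff]

lemma hasDomDimGE_regular_iff (hr : ∀ h ∈ L, 3 ≤ T.returnTime L h) (n : ℕ) :
    HasDomDimGE n (ModuleCat.of Γ Γ) ↔ ∀ h ∈ L, n ≤ T.returnTime L h - 2 := by
  rw [hQ.regular_iff hT (HasDomDimGE.isAddClosed n) fun h h1 h2 => by
    have := hQ.injective_projMod hT h h1 h2
    have := hQ.projective_projMod h h1 h2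
    exact hasDomDimGE_of_injective_of_projective _ _]
  exact forall₂_congr fun h hh => (hQ.dimensions_arrowMod hT hh (hr h hh)).2 n

lemma injectiveDimension_regular (hr : ∀ h ∈ L, 3 ≤ T.returnTime L h) {a : ℕ}
    (ha : IsGreatest ((fun h => T.returnTime L h - 2) '' L) a) :
    injectiveDimension (ModuleCat.of Γ Γ) = ((a : ℕ∞) : WithBot ℕ∞) := by
  have h1 : ∀ n : ℕ, injectiveDimension (ModuleCat.of Γ Γ) < ((n + 1 : ℕ) : WithBot ℕ∞) ↔ a ≤ n := by
    intro n
    rw [injectiveDimension_lt_iff, hQ.hasInjectiveDimensionLT_regular_iff hT hr]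
    constructor
    · intro h
      obtain ⟨k, hk, rfl⟩ := ha.1
      exact h k hk
    · intro h k hk
      exact (ha.2 ⟨k, hk, rfl⟩).trans h
  refine le_antisymm ?_ ?_
  · exact (injectiveDimension_le_iff _ a).2 (injectiveDimension_lt_iff.1 ((h1 a).2 le_rfl))
  · by_contra h2
    rw [not_le] at h2
    obtain ⟨k, hk, hk2⟩ := ha.1
    -- Return times are at least three, so `a` has a predecessor at which the strict bound can be
    -- tested.
    have h3 : 1 ≤ a := by have := hr k hk; simp only at hk2; omega
    obtain ⟨b, rfl⟩ : ∃ b, a = b + 1 := ⟨a - 1, by omega⟩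
    have := (h1 b).1 h2
    omega

end IsLeafQuotient

end

end GendoBrauer

namespace GendoBrauer

universe t

open HalfEdgeData

/-! ### Simple modules -/

lemma HalfEdgeData.IsBrauer.edge_eq_iff {H : Type v} {T : HalfEdgeData H} (hT : T.IsBrauer)
    (h k : H) : T.edge h = T.edge k ↔ k = h ∨ k = T.opp h := by
  constructor
  · intro hk
    -- The set of both halves is an invariant of the edge, which makes the quotient effective.
    let F : T.Edge → Set H := Quot.lift (fun h => {k | k = h ∨ k = T.opp h}) (by
      rintro a _ rfl
      ext k
      rw [Set.mem_ofPred_eq, Set.mem_ofPred_eq, hT.opp_opp, or_comm])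
    have h1 : k ∈ F (T.edge k) := Or.inl rfl
    rw [← hk] at h1
    exact h1
  · rintro (rfl | rfl)
    · rfl
    · exact Quot.sound rfl

section

variable {K : Type u} [Field K] {C Γ : Type w} [Ring C] [Algebra K C] [Ring Γ] [Algebra K Γ]
  {H : Type v} {T : HalfEdgeData H}

/-- The kernel of a ring homomorphism, as a left submodule. -/
def kerSubmodule {R : Type*} [Ring R] (ψ : R →+* K) : Submodule R R where
  carrier := {x | ψ x = 0}
  add_mem' ha hb := by
    rw [Set.mem_ofPred_eq, map_add, show ψ _ = 0 from ha, show ψ _ = 0 from hb, add_zero]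
  zero_mem' := map_zero ψ
  smul_mem' c x hx := by
    rw [Set.mem_ofPred_eq, smul_eq_mul, map_mul, show ψ _ = 0 from hx, mul_zero]

lemma mem_kerSubmodule {R : Type*} [Ring R] (ψ : R →+* K) (x : R) :
    x ∈ kerSubmodule ψ ↔ ψ x = 0 := Iff.rfl

lemma isSimpleModule_quotient_kerSubmodule {R : Type*} [Ring R] (ψ : R →+* K)
    (hψ : Function.Surjective ψ) : IsSimpleModule R (R ⧸ kerSubmodule ψ) := by
  rw [isSimpleModule_iff_isCoatom]
  refine ⟨fun h => ?_, fun N hN => ?_⟩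
  · have : (1 : R) ∈ kerSubmodule ψ := by rw [h]; trivial
    rw [mem_kerSubmodule, map_one] at this
    exact one_ne_zero this
  · obtain ⟨x, hx, hx2⟩ := SetLike.exists_of_lt hN
    rw [mem_kerSubmodule] at hx2
    obtain ⟨y, hy⟩ := hψ (ψ x)⁻¹
    rw [Ideal.eq_top_iff_one]
    have h1 : 1 - y * x ∈ N := hN.le (by
      rw [mem_kerSubmodule, map_sub, map_mul, hy, map_one, inv_mul_cancel₀ hx2, sub_self])
    have h2 := N.add_mem h1 (N.smul_mem y hx)
    rwa [smul_eq_mul, sub_add_cancel] at h2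

namespace LeftSystem

variable (S : LeftSystem T K C)

lemma χ_e_of_e_mul_eq_zero (h k : H) (hk : S.e k * S.e h = 0) : S.χ h (S.e k) = 0 := by
  have := congrArg (S.χ h) hk
  rwa [map_mul, S.χ_self, mul_one, map_zero] at this

end LeftSystem

namespace IsLeafQuotient

variable {S : LeftSystem T K C} {L : Set H} {π : C →ₐ[K] Γ} (hQ : IsLeafQuotient S L π)
include hQ

lemma exists_character (h : H) : ∃ ψ : Γ →+* K, ∀ c, ψ (π c) = S.χ h c := by
  refine ⟨(π : C →+* Γ).liftOfSurjective hQ.surj ⟨(S.χ h : C →+* K), fun c hc => ?_⟩, fun c =>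
    RingHom.liftOfRightInverse_comp_apply _ _ _ _ c⟩
  change S.χ h c = 0
  replace hc := (hQ.ker c).1 hc
  induction hc using Submodule.span_induction with
  | mem x hx => obtain ⟨k, -, rfl⟩ := hx; exact S.χ_a h k
  | zero => exact map_zero _
  | add x y _ _ hx hy => rw [map_add, hx, hy, add_zero]
  | smul k x _ hx => rw [map_smul, hx, smul_zero]

variable [Finite H] (hT : T.IsBrauer)
include hT

/-- If `a_k m` were nonzero it would generate the simple module, so `m = d a_k m` for some `d`; but
`d a_k` is nilpotent. -/
lemma arrow_smul_eq_zero {M : Type*} [AddCommGroup M] [Module Γ M] [IsSimpleModule Γ M] (k : H)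
    (m : M) : π (S.a k) • m = 0 := by
  by_contra h
  have h1 : m ∈ Submodule.span Γ {π (S.a k) • m} := by
    rw [(eq_bot_or_eq_top _).resolve_left fun h2 => h (Submodule.span_singleton_eq_bot.1 h2)]
    trivial
  obtain ⟨γ, hγ⟩ := Submodule.mem_span_singleton.1 h1
  obtain ⟨d, rfl⟩ := hQ.surj γ
  rw [smul_smul, ← map_mul] at hγ
  obtain ⟨n, hn⟩ := S.isNilpotent_of_mem_filt hT (S.mul_a_mem_filt d k)
  have h2 : ∀ n, π ((d * S.a k) ^ n) • m = m := by
    intro n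
    induction n with
    | zero => rw [pow_zero, map_one, one_smul]
    | succ n ih => rw [pow_succ, map_mul, mul_smul, hγ, ih]
  apply h
  rw [← h2 n, hn, map_zero, zero_smul, smul_zero]

/-- Arrows act as zero on a simple module, so only the trivial paths act on `e_h m`, through the
character `χ h`. -/
lemma smul_e_smul {M : Type*} [AddCommGroup M] [Module Γ M] [IsSimpleModule Γ M] (h : H)
    (m : M) (c : C) : π c • π (S.e h) • m = π (algebraMap K C (S.χ h c)) • π (S.e h) • m := by
  have hc : c ∈ Submodule.span K (Set.range fun x : H × ℕ => S.p x.1 x.2) := by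
    rw [S.span]; trivial
  induction hc using Submodule.span_induction with
  | mem x hx =>
    obtain ⟨⟨k, j⟩, rfl⟩ := hx
    cases j with
    | zero =>
      have h1 : S.e k * S.e h = S.e h ∧ S.χ h (S.e k) = 1 ∨
          S.e k * S.e h = 0 ∧ S.χ h (S.e k) = 0 := by
        have h3 : S.e k = S.e h ∨ S.e k * S.e h = 0 := by
          by_cases h1 : k = h
          · left; rw [h1]
          by_cases h2 : k = T.opp h
          · left; rw [h2, S.e_opp]
          · right; exact S.e_mul h k h1 h2
        rcases h3 with h3 | h3
        · left; rw [h3]; exact ⟨S.e_mul_self h, S.χ_self h⟩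
        · right; exact ⟨h3, S.χ_e_of_e_mul_eq_zero h k h3⟩
      simp only [S.p_zero]
      rcases h1 with ⟨h1, h2⟩ | ⟨h1, h2⟩
      · rw [smul_smul, ← map_mul, h1, h2, map_one, map_one, one_smul]
      · rw [smul_smul, ← map_mul, h1, h2, map_zero, map_zero, map_zero, zero_smul, zero_smul]
    | succ j =>
      simp only [S.p_succ']
      rw [map_mul, mul_smul, hQ.arrow_smul_eq_zero hT, smul_zero, map_mul, S.χ_a, mul_zero,
        map_zero, map_zero, zero_smul]
  | zero => rw [map_zero, map_zero, map_zero, map_zero]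
  | add x y _ _ hx hy => rw [map_add, add_smul, hx, hy, map_add, map_add, map_add, add_smul]
  | smul k x _ hx =>
    rw [Algebra.smul_def, map_mul, mul_smul, hx, map_mul, map_mul, map_mul, mul_smul]
    simp only [AlgHom.commutes, Algebra.algebraMap_self, RingHom.id_apply]

/-- The simple modules of the quotient correspond to the edges. -/
theorem numSimples_eq_card_edge (A : Type t) [Ring A]
    (E : ModuleCat.{max w t} Aᵐᵒᵖ ≌ ModuleCat.{max w t} Γ) : numSimples A = Nat.card T.Edge := by
  choose ψ hψ using hQ.exists_character
  have hsurj : ∀ h, Function.Surjective (ψ h) := fun h k =>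
    ⟨π (algebraMap K C k), by rw [hψ, AlgHom.commutes]; rfl⟩
  have hsimp : ∀ h, IsSimpleModule Γ (ULift.{t} (Γ ⧸ kerSubmodule (ψ h))) := fun h =>
    have := isSimpleModule_quotient_kerSubmodule (ψ h) (hsurj h)
    IsSimpleModule.congr ULift.moduleEquiv
  let R : T.Edge → H := fun x => Quot.out x
  have hR : ∀ h, S.e (R (T.edge h)) = S.e h := fun h => by
    have h1 : T.edge (R (T.edge h)) = T.edge h := Quot.out_eq _
    rcases (hT.edge_eq_iff _ _).1 h1 with h2 | h2
    · rw [← h2]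
    · rw [← S.e_opp, ← h2]
  refine numSimples_eq E (fun x => ModuleCat.of Γ (ULift.{t} (Γ ⧸ kerSubmodule (ψ (R x)))))
    (fun x => ?_) ?_ ?_
  · have := hsimp (R x)
    exact simple_of_isSimpleModule
  · rintro x y ⟨i⟩
    by_contra hxy
    let F : (Γ ⧸ kerSubmodule (ψ (R x))) ≃ₗ[Γ] (Γ ⧸ kerSubmodule (ψ (R y))) :=
      (ULift.moduleEquiv.symm.trans i.toLinearEquiv).trans ULift.moduleEquiv
    have h1 : S.e (R x) * S.e (R y) = 0 := by
      refine S.e_mul _ _ (fun h => hxy ?_) (fun h => hxy ?_)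
      · rw [← Quot.out_eq x, ← Quot.out_eq y]; exact congrArg _ h
      · rw [← Quot.out_eq x, ← Quot.out_eq y]
        exact ((hT.edge_eq_iff _ _).2 (Or.inr h)).symm
    -- The idempotent of the edge `x` acts as zero on the simple module of `y` but not on that of
    -- `x`.
    have h2 : ∀ m : Γ ⧸ kerSubmodule (ψ (R y)), π (S.e (R x)) • m = 0 := by
      intro m
      obtain ⟨γ, rfl⟩ := Submodule.Quotient.mk_surjective _ m
      rw [← Submodule.Quotient.mk_smul, Submodule.Quotient.mk_eq_zero, mem_kerSubmodule,
        smul_eq_mul, map_mul, hψ, S.χ_e_of_e_mul_eq_zero _ _ h1, zero_mul]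
    have h3 := h2 (F (Submodule.Quotient.mk 1))
    rw [← map_smul, EmbeddingLike.map_eq_zero_iff, ← Submodule.Quotient.mk_smul,
      Submodule.Quotient.mk_eq_zero, mem_kerSubmodule, smul_eq_mul, mul_one, hψ, S.χ_self] at h3
    exact one_ne_zero h3
  · intro M hM
    have hM' : IsSimpleModule Γ M := (simple_iff_isSimpleModule' M).1 hM
    have hn := hM'.nontrivial
    obtain ⟨m, hm⟩ := exists_ne (0 : M)
    obtain ⟨h, hh⟩ : ∃ h, π (S.e h) • m ≠ 0 := by
      by_contra! h
      apply hm
      rw [← one_smul Γ m, ← map_one π, ← S.sum_e, map_sum, Finset.sum_smul]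
      exact Finset.sum_eq_zero fun k _ => h k
    let r := R (T.edge h)
    rw [← hR h] at hh
    refine ⟨T.edge h, ?_⟩
    let f : (Γ ⧸ kerSubmodule (ψ r)) →ₗ[Γ] M := Submodule.liftQ _
      (LinearMap.toSpanSingleton Γ M (π (S.e r) • m)) (by
        intro γ hγ
        obtain ⟨c, rfl⟩ := hQ.surj γ
        rw [mem_kerSubmodule, hψ] at hγ
        rw [LinearMap.mem_ker, LinearMap.toSpanSingleton_apply, hQ.smul_e_smul hT, hγ, map_zero,
          map_zero, zero_smul])
    have hf : f ≠ 0 := by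
      intro hf
      apply hh
      have := LinearMap.congr_fun hf (Submodule.Quotient.mk 1)
      rw [Submodule.liftQ_apply, LinearMap.toSpanSingleton_apply, one_smul] at this
      exact this
    have := isSimpleModule_quotient_kerSubmodule (ψ r) (hsurj r)
    let F := LinearEquiv.ofBijective f (LinearMap.bijective_of_ne_zero hf)
    exact ⟨(F.symm.trans ULift.moduleEquiv.symm).toModuleIso⟩

end IsLeafQuotient

end

end GendoBrauer

namespace GendoBrauer

open HalfEdgeData

/-! ### Opposite algebras -/

namespace HalfEdgeData

variable {H : Type v} (T : HalfEdgeData H)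

lemma iterate_symm_eq_iff (f : Equiv.Perm H) (k : ℕ) (x y : H) :
    f.symm^[k] x = y ↔ x = f^[k] y := by
  induction k generalizing y with
  | zero => rfl
  | succ k ih => rw [Function.iterate_succ_apply', Equiv.symm_apply_eq, ih,
      ← Function.iterate_succ_apply]

lemma len_rev (h : H) : T.rev.len h = T.len h := by
  have : Function.minimalPeriod T.succ.symm h = Function.minimalPeriod T.succ h :=
    Function.minimalPeriod_eq_minimalPeriod_iff.2 fun n => by
      change T.succ.symm^[n] h = h ↔ T.succ^[n] h = h
      rw [iterate_symm_eq_iff, eq_comm]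
  rw [len, len, ← this]
  rfl

end HalfEdgeData

section

variable {H : Type v} {T : HalfEdgeData H} {K : Type u} [Field K] {C Γ : Type w} [Ring C]
  [Algebra K C] [Ring Γ] [Algebra K Γ]

open MulOpposite

/-- The opposite of a path system. -/
def PathSystem.op (hT : T.IsBrauer) (S : PathSystem T C) : PathSystem T.rev Cᵐᵒᵖ where
  e h := .op (S.e h)
  a h := .op (S.a (T.succ.symm h))
  reps := S.reps
  e_opp h := congrArg _ (S.e_opp h)
  e_mul_self h := congrArg _ (S.e_mul_self h)
  e_mul h k h1 h2 := by
    rw [← op_mul, S.e_mul k h h1.symm fun h3 => h2 ?_, op_zero]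
    rw [h3]; exact (hT.opp_opp k).symm
  e_mul_a h := congrArg MulOpposite.op (S.a_mul_e (T.succ.symm h))
  a_mul_e h := by
    have := S.e_mul_a (T.succ.symm h)
    rw [Equiv.apply_symm_apply] at this
    exact congrArg MulOpposite.op this
  turn h := by
    have := S.turn (T.succ.symm (T.opp (T.succ.symm h)))
    rw [Equiv.apply_symm_apply, hT.opp_opp] at this
    exact congrArg MulOpposite.op this
  sum_e := by rw [← op_one, ← S.sum_e, Finset.op_sum]

lemma PathSystem.p_op (hT : T.IsBrauer) (S : PathSystem T C) (h : H) (k : ℕ) :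
    (S.op hT).p h k = .op (S.p (T.succ.symm^[k] h) k) := by
  induction k with
  | zero => rfl
  | succ k ih =>
    rw [PathSystem.p_succ, ih, Function.iterate_succ_apply', PathSystem.p_succ',
      Equiv.apply_symm_apply]
    rfl

/-- The opposite of a Brauer graph algebra. -/
def LeftSystem.op [Finite H] (hT : T.IsBrauer) (S : LeftSystem T K C) :
    LeftSystem T.rev K Cᵐᵒᵖ where
  toPathSystem := S.toPathSystem.op hT
  t := S.t ∘ₗ (opLinearEquiv K).symm.toLinearMap
  χ h := AlgHom.fromOpposite (S.χ h) fun _ _ => mul_comm _ _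
  cycle h := by
    refine (S.toPathSystem.p_op hT h _).trans (Eq.trans ?_ (S.toPathSystem.p_op hT _ _).symm)
    rw [len_rev, len_rev, (iterate_symm_eq_iff _ _ _ _).2 (T.iterate_len h).symm]
    rw [show T.rev.opp h = T.opp h from rfl,
      (iterate_symm_eq_iff _ _ _ _).2 (T.iterate_len (T.opp h)).symm]
    exact congrArg MulOpposite.op (S.cycle h)
  span := by
    have h1 := congrArg (Submodule.map (opLinearEquiv K : C ≃ₗ[K] Cᵐᵒᵖ).toLinearMap) S.span
    rw [Submodule.map_span, Submodule.map_top, LinearEquiv.range] at h1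
    rw [eq_top_iff, ← h1, Submodule.span_le]
    rintro _ ⟨_, ⟨⟨h, k⟩, rfl⟩, rfl⟩
    refine Submodule.subset_span ⟨(T.succ^[k] h, k), ?_⟩
    refine (S.toPathSystem.p_op hT _ _).trans ?_
    rw [(iterate_symm_eq_iff _ _ _ _).2 rfl]
    rfl
  t_symm x y := S.t_symm y.unop x.unop
  t_len h := by
    refine Eq.trans (congrArg _ (S.toPathSystem.p_op hT h _)) ?_
    rw [len_rev, (iterate_symm_eq_iff _ _ _ _).2 (T.iterate_len h).symm]
    exact S.t_len h
  t_ne h k hk := by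
    refine Eq.trans (congrArg _ (S.toPathSystem.p_op hT h _)) ?_
    refine S.t_ne (T.succ.symm^[k] h) k ?_
    rw [len_rev] at hk
    rwa [← hT.len_iterate k, ← (iterate_symm_eq_iff T.succ k h _).1 rfl]
  χ_self h := S.χ_self h
  χ_a h k := S.χ_a h (T.succ.symm k)

lemma IsLeafQuotient.op [Finite H] (hT : T.IsBrauer) {S : LeftSystem T K C} {L : Set H}
    {π : C →ₐ[K] Γ} (hQ : IsLeafQuotient S L π) : IsLeafQuotient (S.op hT) L (AlgHom.op π) where
  surj x := by
    obtain ⟨c, hc⟩ := hQ.surj x.unop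
    exact ⟨.op c, unop_injective hc⟩
  ker x := by
    -- Reversal shifts the indices of the arrows by `succ`, which fixes the leaves; so the loops
    -- stay the same.
    have h1 : (opLinearEquiv K : C ≃ₗ[K] Cᵐᵒᵖ).toLinearMap '' (S.a '' L) = (S.op hT).a '' L := by
      rw [← Set.image_comp]
      refine Set.image_congr fun h hh => ?_
      change MulOpposite.op (S.a h) = .op (S.a (T.succ.symm h))
      rw [(Equiv.symm_apply_eq _).2 (hQ.succ_leaf h hh).symm]
    rw [← h1, ← Submodule.map_span]
    constructor
    · intro hx
      exact ⟨x.unop, (hQ.ker _).1 (op_injective hx), rfl⟩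
    · rintro ⟨y, hy, rfl⟩
      exact unop_injective ((hQ.ker y).2 hy)
  succ_leaf h hh := (Equiv.symm_apply_eq _).2 (hQ.succ_leaf h hh).symm
  mult_leaf := hQ.mult_leaf
  opp_leaf := hQ.opp_leaf

end

end GendoBrauer

namespace GendoBrauer

/-! ### The Brauer graph algebra -/

/-- A linear form which is compatible with the relations factors through the quotient. -/
lemma exists_linearMap_ringQuot {K : Type u} [Field K] {A : Type v} [Ring A] [Algebra K A]
    (r : A → A → Prop) (f : A →ₗ[K] K)
    (hf : ∀ a b, r a b → ∀ u v, f (u * a * v) = f (u * b * v)) :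
    ∃ g : RingQuot r →ₗ[K] K, ∀ x, g (RingQuot.mkAlgHom K r x) = f x := by
  -- A ring congruence whose zero class lies in the kernel of `f`; it contains the given relations,
  -- so the quotient by them maps onto the quotient by this congruence.
  let c : RingCon A :=
    { r := fun x y => ∀ u v, f (u * x * v) = f (u * y * v)
      iseqv := ⟨fun _ _ _ => rfl, fun h u v => (h u v).symm, fun h h' u v => (h u v).trans (h' u v)⟩
      mul' := fun {a b x y} h h' u v => by
        rw [← mul_assoc, mul_assoc (u * a), h, ← mul_assoc, h']
        simp only [mul_assoc]
      add' := fun {a b x y} h h' u v => by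
        rw [mul_add, add_mul, map_add, h, h', ← map_add, ← add_mul, ← mul_add] }
  let F : RingQuot r →+* c.Quotient := RingQuot.lift ⟨c.mk', fun {x y} h =>
    (RingCon.eq c).2 (hf x y h)⟩
  have hF : ∀ x, F (RingQuot.mkAlgHom K r x) = c.mk' x := fun x => by
    have h1 := congrArg (fun φ : A →+* RingQuot r => φ x) (RingQuot.mkAlgHom_coe K r)
    exact (congrArg F h1).trans (RingQuot.lift_mkRingHom_apply _ _ _)
  have hsurj := RingQuot.mkAlgHom_surjective K r
  have hker : LinearMap.ker (RingQuot.mkAlgHom K r).toLinearMap ≤ LinearMap.ker f := by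
    intro x hx
    have h1 : RingQuot.mkAlgHom K r x = 0 := hx
    have h2 : c x 0 := (RingCon.eq c).1 (by
      change c.mk' x = c.mk' 0
      rw [← hF, h1, map_zero, map_zero])
    have h3 := h2 1 1
    simpa using h3
  refine ⟨(RingQuot.mkAlgHom K r).toLinearMap.ker.liftQ f hker ∘ₗ
    ((RingQuot.mkAlgHom K r).toLinearMap.quotKerEquivOfSurjective hsurj).symm.toLinearMap,
    fun x => ?_⟩
  have : ((RingQuot.mkAlgHom K r).toLinearMap.quotKerEquivOfSurjective hsurj).symm
      (RingQuot.mkAlgHom K r x) = Submodule.Quotient.mk x := by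
    rw [LinearEquiv.symm_apply_eq]; rfl
  rw [LinearMap.comp_apply, LinearEquiv.coe_coe, this, Submodule.liftQ_apply]

namespace HalfEdgeData

variable {H : Type v} (K : Type u) [Field K] (T : HalfEdgeData H)

/-- The quotient map onto the Brauer graph algebra. -/
noncomputable def brauerMk : T.Free K →ₐ[K] T.BrauerAlgebra K := RingQuot.mkAlgHom K (Rel K T)

lemma brauerMk_surjective : Function.Surjective (T.brauerMk K) :=
  RingQuot.mkAlgHom_surjective K (Rel K T)

/-- The image of the trivial path at the edge of a half-edge in the Brauer graph algebra. -/
noncomputable def brauerE (h : H) : T.BrauerAlgebra K := T.brauerMk K (T.gene K (T.edge h))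

/-- The image of an arrow in the Brauer graph algebra. -/
noncomputable def brauerA (h : H) : T.BrauerAlgebra K := T.brauerMk K (T.gena K h)

variable {T} in
lemma brauerMk_eq {x y : T.Free K} (h : Rel K T x y) : T.brauerMk K x = T.brauerMk K y :=
  RingQuot.mkAlgHom_rel K h

lemma brauerMk_rho (h : H) : T.brauerMk K (T.rho K h) =
    ((List.range (Function.minimalPeriod T.succ h)).map fun i => T.brauerA K (T.succ^[i] h)).prod := by
  rw [rho, map_list_prod, List.map_map]
  rfl

variable [Finite H]

instance : Finite T.Edge := Finite.of_surjective T.edge Quot.mk_surjective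

open Classical in
/-- One half of each edge. -/
noncomputable def halves : Finset H :=
  have := Fintype.ofFinite T.Edge
  Finset.univ.image fun x : T.Edge => (Quot.out x : H)

lemma sum_halves {M : Type*} [AddCommMonoid M] (f : T.Edge → M) :
    ∑ h ∈ T.halves, f (T.edge h) = ∑ᶠ x, f x := by
  classical
  have := Fintype.ofFinite T.Edge
  have h1 : ∀ x : T.Edge, T.edge (Quot.out x) = x := Quot.out_eq
  rw [halves, Finset.sum_image fun x _ y _ h => by rw [← h1 x, ← h1 y]; exact congrArg _ h,
    finsum_eq_sum_of_fintype]
  refine Finset.sum_congr ?_ fun x _ => by rw [h1]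
  ext; simp

variable {T} (hT : T.IsBrauer)

/-- The path system of the Brauer graph algebra. -/
noncomputable def brauerPathSystem : PathSystem T.rev (T.BrauerAlgebra K) where
  e := T.brauerE K
  -- Products read from left to right for `T` are products read from right to left for `T.rev`: its
  -- arrow at `h` is the original arrow that ends at the edge of `h`.
  a h := T.brauerA K (T.succ.symm h)
  reps := T.halves
  e_opp h := congrArg (fun x => T.brauerMk K (T.gene K x))
    (((hT.edge_eq_iff _ _).2 (Or.inr rfl)).symm : T.edge (T.opp h) = T.edge h)
  e_mul_self h := (map_mul _ _ _).symm.trans (brauerMk_eq (T := T) K (Rel.idem (T.edge h)))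
  e_mul h k h1 h2 := (map_mul _ _ _).symm.trans ((brauerMk_eq (T := T) K (Rel.orth _ _ fun h3 =>
    ((hT.edge_eq_iff _ _).1 h3.symm).elim h1 h2)).trans (map_zero _))
  e_mul_a h := (map_mul _ _ _).symm.trans (brauerMk_eq (T := T) K (Rel.source (T.succ.symm h)))
  a_mul_e h := by
    have h1 := brauerMk_eq (T := T) K (Rel.target (T.succ.symm h))
    rw [Equiv.apply_symm_apply, map_mul] at h1
    exact h1
  turn h := by
    have h1 := brauerMk_eq (T := T) K (Rel.turn (T.succ.symm (T.opp (T.succ.symm h))))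
    rw [Equiv.apply_symm_apply, hT.opp_opp, map_mul, map_zero] at h1
    exact h1
  sum_e := by
    have h1 := brauerMk_eq (T := T) K (Rel.one (T := T))
    have := Fintype.ofFinite T.Edge
    rw [← T.sum_halves, map_sum, map_one] at h1
    exact h1

/-! ### Cycles -/

lemma brauer_p_eq (h : H) (k : ℕ) : (T.brauerPathSystem K hT).p h k =
    ((List.range k).map fun i => T.brauerA K (T.succ^[i] (T.succ.symm^[k] h))).prod *
      T.brauerE K h := by
  induction k with
  | zero => exact (one_mul _).symm
  | succ k ih =>
    rw [PathSystem.p_succ, ih, List.range_succ_eq_map, List.map_cons, List.prod_cons, mul_assoc,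
      List.map_map]
    congr 1
    · exact congrArg (T.brauerA K) (Function.iterate_succ_apply' T.succ.symm k h).symm
    · congr 3
      funext i
      rw [Function.comp_apply, Function.iterate_succ_apply, Function.iterate_succ_apply',
        Equiv.apply_symm_apply]

lemma brauer_p_minimalPeriod (h : H) :
    (T.brauerPathSystem K hT).p h (Function.minimalPeriod T.succ h) =
      T.brauerMk K (T.rho K h) := by
  rw [brauer_p_eq, brauerMk_rho, (iterate_symm_eq_iff _ _ _ _).2 (Function.iterate_minimalPeriod
    (f := T.succ) (x := h)).symm]
  obtain ⟨n, hn⟩ : ∃ n, Function.minimalPeriod T.succ h = n + 1 :=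
    ⟨_, (Nat.sub_add_cancel (T.minimalPeriod_succ_pos h)).symm⟩
  have h1 : T.succ^[n + 1] h = h := by rw [← hn]; exact Function.iterate_minimalPeriod
  rw [hn, List.range_succ, List.map_append, List.prod_append, mul_assoc]
  congr 1
  rw [List.map_singleton, List.prod_singleton]
  have h2 := (T.brauerPathSystem K hT).a_mul_e (T.succ^[n + 1] h)
  rw [Function.iterate_succ_apply'] at h2
  change T.brauerA K (T.succ.symm (T.succ _)) * T.brauerE K _ = T.brauerA K _ at h2
  rw [Equiv.symm_apply_apply, ← Function.iterate_succ_apply' (f := T.succ), h1] at h2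
  exact h2

lemma brauer_p_len (h : H) : (T.brauerPathSystem K hT).p h (T.len h) =
    T.brauerMk K (T.rho K h ^ T.mult h) := by
  have h1 : ∀ j, (T.brauerPathSystem K hT).p h (Function.minimalPeriod T.succ h * (j + 1)) =
      T.brauerMk K (T.rho K h ^ (j + 1)) := by
    intro j
    induction j with
    | zero => rw [zero_add, mul_one, pow_one, brauer_p_minimalPeriod]
    | succ j ih =>
      rw [mul_add_one, ← PathSystem.p_mul_p, ih]
      have h2 : T.rev.succ^[Function.minimalPeriod T.succ h * (j + 1)] h = h :=
        (iterate_symm_eq_iff _ _ _ _).2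
          ((Function.isPeriodicPt_minimalPeriod T.succ h).mul_const _).symm
      rw [h2, brauer_p_minimalPeriod, ← map_mul, ← pow_succ']
  have h2 := h1 (T.mult h - 1)
  rwa [Nat.sub_add_cancel (hT.mult_pos h)] at h2

lemma brauer_cycle (h : H) : (T.brauerPathSystem K hT).p h (T.rev.len h) =
    (T.brauerPathSystem K hT).p (T.opp h) (T.rev.len (T.opp h)) := by
  rw [len_rev, len_rev, brauer_p_len, brauer_p_len]
  exact brauerMk_eq (T := T) K (Rel.cycle h)

lemma brauer_span : Submodule.span K
    (Set.range fun x : H × ℕ => (T.brauerPathSystem K hT).p x.1 x.2) = ⊤ := by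
  set S := T.brauerPathSystem K hT
  set N := Submodule.span K (Set.range fun x : H × ℕ => S.p x.1 x.2) with hN
  have hp : ∀ h k, S.p h k ∈ N := fun h k => Submodule.subset_span ⟨(h, k), rfl⟩
  have hone : (1 : T.BrauerAlgebra K) ∈ N := by
    rw [← S.sum_e]
    exact Submodule.sum_mem _ fun h _ => hp h 0
  have hmul : ∀ x ∈ N, ∀ y ∈ N, x * y ∈ N := by
    intro x hx y hy
    have h := Submodule.mul_mem_mul hx hy
    rw [hN, Submodule.span_mul_span] at h
    refine Submodule.span_le.2 ?_ h
    rintro _ ⟨_, ⟨⟨h, m⟩, rfl⟩, _, ⟨⟨k, n⟩, rfl⟩, rfl⟩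
    rcases S.p_mul_p_cases h k m n with h1 | ⟨g, h1⟩
    · simp only [h1]; exact zero_mem _
    · simp only [h1]; exact hp _ _
  rw [eq_top_iff]
  rintro x -
  obtain ⟨x, rfl⟩ := T.brauerMk_surjective K x
  induction x using FreeAlgebra.induction with
  | grade0 r =>
    rw [AlgHom.commutes, Algebra.algebraMap_eq_smul_one]
    exact N.smul_mem _ hone
  | grade1 x =>
    rcases x with x | h
    · obtain ⟨h, rfl⟩ := Quot.mk_surjective x
      exact hp h 0
    · have h1 := hp (T.succ h) 1
      rw [PathSystem.p_one] at h1
      change T.brauerA K _ ∈ N at h1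
      rwa [Equiv.symm_apply_apply] at h1
  | mul a b ha hb => rw [map_mul]; exact hmul _ ha _ hb
  | add a b ha hb => rw [map_add]; exact N.add_mem ha hb

/-! ### Characters -/

include hT in
lemma exists_brauer_character (h : H) : ∃ χ : T.BrauerAlgebra K →ₐ[K] K,
    χ (T.brauerE K h) = 1 ∧ ∀ k, χ (T.brauerA K k) = 0 := by
  classical
  let f : T.Free K →ₐ[K] K := FreeAlgebra.lift K
    (Sum.elim (fun x => if x = T.edge h then 1 else 0) fun _ => 0)
  have hfe : ∀ x, f (T.gene K x) = if x = T.edge h then 1 else 0 := fun x =>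
    FreeAlgebra.lift_ι_apply _ _
  have hfa : ∀ k, f (T.gena K k) = 0 := fun x => FreeAlgebra.lift_ι_apply _ _
  have hrho : ∀ k, f (T.rho K k ^ T.mult k) = 0 := fun k => by
    have h1 : f (T.rho K k) = 0 := by
      rw [rho, map_list_prod, List.prod_eq_zero]
      obtain ⟨n, hn⟩ : ∃ n, Function.minimalPeriod T.succ k = n + 1 :=
        ⟨_, (Nat.sub_add_cancel (T.minimalPeriod_succ_pos k)).symm⟩
      rw [hn, List.mem_map]
      exact ⟨_, List.mem_map.2 ⟨0, List.mem_range.2 (Nat.succ_pos n), rfl⟩, hfa _⟩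
    rw [map_pow, h1, zero_pow (hT.mult_pos k).ne']
  have hf : ∀ ⦃x y : T.Free K⦄, Rel K T x y → f x = f y := by
    intro x y hxy
    induction hxy with
    | idem x => rw [map_mul, hfe]; split_ifs <;> simp
    | orth x y hxy =>
      rw [map_mul, hfe, hfe, map_zero]
      by_cases h1 : x = T.edge h
      · rw [if_neg fun h2 : y = _ => hxy (h1.trans h2.symm), mul_zero]
      · rw [if_neg h1, zero_mul]
    | one =>
      have := Fintype.ofFinite T.Edge
      rw [finsum_eq_sum_of_fintype, map_sum, map_one]
      simp [hfe]
    | source k => rw [map_mul, hfa, mul_zero]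
    | target k => rw [map_mul, hfa, zero_mul]
    | turn k => rw [map_mul, hfa, hfa, map_zero, zero_mul]
    | cycle k => rw [hrho, hrho]
  refine ⟨RingQuot.liftAlgHom K ⟨f, hf⟩, ?_, fun k => ?_⟩
  · exact (RingQuot.liftAlgHom_mkAlgHom_apply _ _ _ _).trans (by rw [hfe, if_pos rfl])
  · exact (RingQuot.liftAlgHom_mkAlgHom_apply _ _ _ _).trans (hfa k)

end HalfEdgeData

end GendoBrauer

namespace GendoBrauer

namespace HalfEdgeData

/-! ### The symmetrizing form of the Brauer graph algebra -/

section Representation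

open Polynomial

variable {H : Type v} (K : Type u) [Field K] (T : HalfEdgeData H) [Fintype H]

open Classical in
/-- A representation of the path algebra by matrices of polynomials, where the degree records the
length of paths. -/
noncomputable def brauerRep : T.Free K →ₐ[K] Matrix H H K[X] :=
  FreeAlgebra.lift K (Sum.elim (fun x => Matrix.diagonal fun h => if T.edge h = x then 1 else 0)
    fun h => Matrix.single h (T.succ h) X)

open Classical in
lemma brauerRep_gene (x : T.Edge) : T.brauerRep K (T.gene K x) =
    Matrix.diagonal fun h => if T.edge h = x then 1 else 0 := FreeAlgebra.lift_ι_apply _ _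

open Classical in
lemma brauerRep_gena (h : H) : T.brauerRep K (T.gena K h) = Matrix.single h (T.succ h) X :=
  FreeAlgebra.lift_ι_apply _ _

open Classical in
lemma brauerRep_path (h : H) (n : ℕ) :
    T.brauerRep K ((List.range (n + 1)).map fun i => T.gena K (T.succ^[i] h)).prod =
      Matrix.single h (T.succ^[n + 1] h) (X ^ (n + 1)) := by
  induction n with
  | zero => simp [brauerRep_gena]
  | succ n ih =>
    rw [List.range_succ, List.map_append, List.prod_append, map_mul, ih, List.map_singleton,
      List.prod_singleton, brauerRep_gena, Matrix.single_mul_single_same, ← pow_succ,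
      Function.iterate_succ_apply' _ (n + 1)]

open Classical in
lemma brauerRep_cycle {T : HalfEdgeData H} (hT : T.IsBrauer) (h : H) :
    T.brauerRep K (T.rho K h ^ T.mult h) = Matrix.single h h (X ^ T.len h) := by
  have h1 : T.brauerRep K (T.rho K h) =
      Matrix.single h h (X ^ Function.minimalPeriod T.succ h) := by
    obtain ⟨n, hn⟩ : ∃ n, Function.minimalPeriod T.succ h = n + 1 :=
      ⟨_, (Nat.sub_add_cancel (T.minimalPeriod_succ_pos h)).symm⟩
    have h2 : T.succ^[n + 1] h = h := by rw [← hn]; exact Function.iterate_minimalPeriod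
    rw [rho, hn, brauerRep_path, h2]
  have h2 : ∀ m, T.brauerRep K (T.rho K h ^ (m + 1)) =
      Matrix.single h h (X ^ (Function.minimalPeriod T.succ h * (m + 1))) := by
    intro m
    induction m with
    | zero => rw [zero_add, pow_one, mul_one, h1]
    | succ m ih =>
      rw [pow_succ, map_mul, ih, h1, Matrix.single_mul_single_same, ← pow_add, ← mul_add_one]
  have h3 := h2 (T.mult h - 1)
  rwa [Nat.sub_add_cancel (hT.mult_pos h)] at h3

open Classical in
/-- The linear form on the path algebra. -/
noncomputable def traceForm : T.Free K →ₗ[K] K :=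
  ∑ h : H, lcoeff K (T.len h) ∘ₗ (Matrix.entryLinearMap K K[X] h h) ∘ₗ (T.brauerRep K).toLinearMap

lemma traceForm_apply (x : T.Free K) :
    T.traceForm K x = ∑ h : H, (T.brauerRep K x h h).coeff (T.len h) := by
  rw [traceForm, LinearMap.sum_apply]
  rfl

variable {T} (hT : T.IsBrauer)
include hT

/-- Nonzero matrix entries join only half-edges around one vertex. Hence the degree picked out at
two such indices is the same, which makes the trace form symmetric. -/
lemma len_eq_of_brauerRep_ne_zero (x : T.Free K) (h k : H) (hx : T.brauerRep K x h k ≠ 0) :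
    T.len h = T.len k := by
  classical
  induction x using FreeAlgebra.induction generalizing h k with
  | grade0 r =>
    rw [AlgHom.commutes, Matrix.algebraMap_eq_diagonal] at hx
    by_contra h1
    exact hx (Matrix.diagonal_apply_ne _ fun h2 => h1 (congrArg _ h2))
  | grade1 x =>
    rcases x with x | g
    · rw [show FreeAlgebra.ι K (Sum.inl x) = T.gene K x from rfl, brauerRep_gene] at hx
      by_contra h1
      exact hx (Matrix.diagonal_apply_ne _ fun h2 => h1 (congrArg _ h2))
    · rw [show FreeAlgebra.ι K (Sum.inr g) = T.gena K g from rfl, brauerRep_gena,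
        Matrix.single_apply] at hx
      rcases of_not_not fun h1 => hx (if_neg h1) with ⟨rfl, rfl⟩
      exact (hT.len_succ _).symm
  | mul a b ha hb =>
    rw [map_mul, Matrix.mul_apply] at hx
    obtain ⟨j, -, hj⟩ := Finset.exists_ne_zero_of_sum_ne_zero hx
    exact (ha h j (left_ne_zero_of_mul hj)).trans (hb j k (right_ne_zero_of_mul hj))
  | add a b ha hb =>
    rw [map_add, Matrix.add_apply] at hx
    by_cases h1 : T.brauerRep K a h k = 0
    · rw [h1, zero_add] at hx
      exact hb h k hx
    · exact ha h k h1

-- Arrows have positive degree, so the degree zero part only sees trivial paths, which treat both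
-- halves of an edge alike. This is what the cycle relation needs, as its two sides have different
-- matrices.
open Classical in
lemma exists_brauerRep_constantCoeff (x : T.Free K) : ∃ d : H → K, (∀ h, d (T.opp h) = d h) ∧
    (T.brauerRep K x).map constantCoeff = Matrix.diagonal d := by
  induction x using FreeAlgebra.induction with
  | grade0 r =>
    refine ⟨fun _ => r, fun _ => rfl, ?_⟩
    rw [AlgHom.commutes, Matrix.algebraMap_eq_diagonal, Matrix.diagonal_map (map_zero _)]
    congr 1
    funext h
    simp
  | grade1 x =>
    rcases x with x | g
    · refine ⟨fun h => if T.edge h = x then 1 else 0, fun h => ?_, ?_⟩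
      · beta_reduce
        rw [(hT.edge_eq_iff (T.opp h) h).2 (Or.inr (hT.opp_opp h).symm)]
      · rw [show FreeAlgebra.ι K (Sum.inl x) = T.gene K x from rfl, brauerRep_gene,
          Matrix.diagonal_map (map_zero _)]
        congr 1
        funext h
        split_ifs <;> simp
    · refine ⟨0, fun _ => rfl, ?_⟩
      rw [show FreeAlgebra.ι K (Sum.inr g) = T.gena K g from rfl, brauerRep_gena]
      ext h k
      simp [Matrix.single_apply, apply_ite]
  | mul a b ha hb =>
    obtain ⟨d, h1, h2⟩ := ha
    obtain ⟨d', h1', h2'⟩ := hb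
    refine ⟨fun h => d h * d' h, fun h => by beta_reduce; rw [h1, h1'], ?_⟩
    rw [map_mul, Matrix.map_mul, h2, h2', Matrix.diagonal_mul_diagonal]
  | add a b ha hb =>
    obtain ⟨d, h1, h2⟩ := ha
    obtain ⟨d', h1', h2'⟩ := hb
    refine ⟨fun h => d h + d' h, fun h => by beta_reduce; rw [h1, h1'], ?_⟩
    rw [map_add, Matrix.map_add _ (map_add _), h2, h2', Matrix.diagonal_add]

lemma traceForm_mul_comm (x y : T.Free K) : T.traceForm K (x * y) = T.traceForm K (y * x) := by
  simp only [traceForm_apply, map_mul, Matrix.mul_apply, finsetSum_coeff]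
  rw [Finset.sum_comm]
  refine Finset.sum_congr rfl fun k _ => Finset.sum_congr rfl fun h _ => ?_
  by_cases h1 : T.brauerRep K x h k = 0
  · rw [h1, zero_mul, mul_zero, coeff_zero, coeff_zero]
  · rw [len_eq_of_brauerRep_ne_zero K hT x h k h1, mul_comm]

open Classical in
lemma traceForm_mul_cycle (x : T.Free K) (h : H) :
    T.traceForm K (x * T.rho K h ^ T.mult h) = (T.brauerRep K x h h).coeff 0 := by
  rw [traceForm_apply, map_mul, brauerRep_cycle K hT, Finset.sum_eq_single h]
  · rw [Matrix.mul_single_apply_same, coeff_mul_X_pow', if_pos le_rfl, Nat.sub_self]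
  · intro k _ hk
    rw [Matrix.mul_single_apply_of_ne _ _ _ _ _ hk, coeff_zero]
  · intro h1
    exact absurd (Finset.mem_univ h) h1

/-- All relations except the last hold for the matrices. For the last one, multiplying by a full
cycle at `h` reduces the form to the constant coefficient of the diagonal entry at `h`, which equals
the one at `opp h`. -/
lemma traceForm_rel {a b : T.Free K} (hab : Rel K T a b) (u v : T.Free K) :
    T.traceForm K (u * a * v) = T.traceForm K (u * b * v) := by
  classical
  suffices h : ∀ w, T.traceForm K (w * a) = T.traceForm K (w * b) by
    rw [traceForm_mul_comm K hT, traceForm_mul_comm K hT (u * b), ← mul_assoc, ← mul_assoc, h]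
  intro w
  suffices h : T.brauerRep K a = T.brauerRep K b ∨
      ∃ h, a = T.rho K h ^ T.mult h ∧ b = T.rho K (T.opp h) ^ T.mult (T.opp h) by
    rcases h with h | ⟨h, rfl, rfl⟩
    · rw [traceForm_apply, traceForm_apply, map_mul, map_mul, h]
    · rw [traceForm_mul_cycle K hT, traceForm_mul_cycle K hT]
      obtain ⟨d, h1, h2⟩ := exists_brauerRep_constantCoeff K hT w
      have h3 : ∀ k, (T.brauerRep K w k k).coeff 0 = d k := fun k => by
        have := congrFun (congrFun h2 k) k
        rw [Matrix.diagonal_apply_eq, Matrix.map_apply, constantCoeff_apply] at this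
        exact this
      rw [h3, h3, h1]
  cases hab with
  | idem x =>
    left
    rw [map_mul, brauerRep_gene, Matrix.diagonal_mul_diagonal]
    congr 1; funext h; split_ifs <;> simp
  | orth x y hxy =>
    left
    rw [map_mul, brauerRep_gene, brauerRep_gene, Matrix.diagonal_mul_diagonal, map_zero,
      ← Matrix.diagonal_zero]
    congr 1; funext h
    by_cases h1 : T.edge h = x
    · rw [if_neg fun h2 : T.edge h = y => hxy (h1.symm.trans h2), mul_zero]
    · rw [if_neg h1, zero_mul]
  | one =>
    left
    have := Fintype.ofFinite T.Edge
    rw [finsum_eq_sum_of_fintype, map_sum, map_one]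
    ext h k : 2
    rw [Matrix.sum_apply]
    simp only [brauerRep_gene, Matrix.diagonal_apply, Matrix.one_apply]
    split_ifs <;> simp
  | source h =>
    left
    rw [map_mul, brauerRep_gene, brauerRep_gena]
    ext i j : 2
    rw [Matrix.diagonal_mul, Matrix.single_apply]
    split_ifs with h1 h2 h2 <;> simp_all
  | target h =>
    left
    rw [map_mul, brauerRep_gene, brauerRep_gena]
    ext i j : 2
    rw [Matrix.mul_diagonal, Matrix.single_apply]
    by_cases h1 : h = i ∧ T.succ h = j
    · rw [if_pos h1, h1.2, if_pos rfl, mul_one]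
    · rw [if_neg h1, zero_mul]
  | turn h =>
    left
    rw [map_mul, brauerRep_gena, brauerRep_gena, map_zero,
      Matrix.single_mul_single_of_ne _ _ _ _ (hT.opp_ne _).symm]
  | cycle h => right; exact ⟨h, rfl, rfl⟩

open Classical in
lemma traceForm_path (h : H) (k : ℕ) : T.traceForm K
    (((List.range k).map fun i => T.gena K (T.succ^[i] (T.succ.symm^[k] h))).prod *
      T.gene K (T.edge h)) = if T.len h = k then 1 else 0 := by
  have hpos := fun h => hT.len_pos h
  rw [traceForm_apply]
  cases k with
  | zero =>
    rw [if_neg (hpos h).ne']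
    refine Finset.sum_eq_zero fun g _ => ?_
    rw [List.range_zero, List.map_nil, List.prod_nil, one_mul, brauerRep_gene,
      Matrix.diagonal_apply_eq]
    split_ifs
    · rw [coeff_one, if_neg (hpos g).ne']
    · exact coeff_zero _
  | succ k =>
    have h1 : T.brauerRep K (((List.range (k + 1)).map fun i =>
        T.gena K (T.succ^[i] (T.succ.symm^[k + 1] h))).prod * T.gene K (T.edge h)) =
        Matrix.single (T.succ.symm^[k + 1] h) h (X ^ (k + 1)) := by
      rw [map_mul, brauerRep_path, brauerRep_gene, ← (iterate_symm_eq_iff T.succ (k + 1) h _).1 rfl]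
      ext i j : 2
      rw [Matrix.mul_diagonal, Matrix.single_apply]
      split_ifs with h1 h2 h2 <;> simp_all
    rw [h1, Finset.sum_eq_single h]
    · rw [Matrix.single_apply]
      by_cases h2 : T.len h = k + 1
      · have h3 : T.succ.symm^[k + 1] h = h := by
          rw [iterate_symm_eq_iff, ← h2, iterate_len]
        rw [if_pos ⟨h3, rfl⟩, if_pos h2, coeff_X_pow, if_pos h2]
      · rw [if_neg h2]
        split_ifs
        · rw [coeff_X_pow, if_neg h2]
        · exact coeff_zero _
    · intro g _ hg
      rw [Matrix.single_apply, if_neg fun h2 => hg h2.2.symm, coeff_zero]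
    · intro h2
      exact absurd (Finset.mem_univ h) h2

end Representation

variable {H : Type v} (K : Type u) [Field K] {T : HalfEdgeData H} [Finite H] (hT : T.IsBrauer)

include hT in
open Classical in
lemma exists_brauer_form : ∃ t : T.BrauerAlgebra K →ₗ[K] K, (∀ x y, t (x * y) = t (y * x)) ∧
    ∀ h k, t ((T.brauerPathSystem K hT).p h k) = if T.len h = k then 1 else 0 := by
  have := Fintype.ofFinite H
  obtain ⟨t, ht⟩ : ∃ t : T.BrauerAlgebra K →ₗ[K] K, ∀ x, t (T.brauerMk K x) = T.traceForm K x :=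
    exists_linearMap_ringQuot (Rel K T) (T.traceForm K) fun _ _ h => traceForm_rel K hT h
  refine ⟨t, fun x y => ?_, fun h k => ?_⟩
  · obtain ⟨x, rfl⟩ := T.brauerMk_surjective K x
    obtain ⟨y, rfl⟩ := T.brauerMk_surjective K y
    rw [← map_mul, ← map_mul, ht, ht, traceForm_mul_comm K hT]
  · rw [← traceForm_path K hT, ← ht, brauer_p_eq, map_mul (T.brauerMk K), map_list_prod (T.brauerMk K),
      List.map_map]
    rfl

/-- The Brauer graph algebra as a system. -/
noncomputable def brauerSystem : LeftSystem T.rev K (T.BrauerAlgebra K) where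
  toPathSystem := T.brauerPathSystem K hT
  t := (exists_brauer_form K hT).choose
  χ h := (exists_brauer_character K hT h).choose
  cycle := brauer_cycle K hT
  span := brauer_span K hT
  t_symm := (exists_brauer_form K hT).choose_spec.1
  t_len h := ((exists_brauer_form K hT).choose_spec.2 h _).trans (if_pos (T.len_rev h).symm)
  t_ne h k hk := ((exists_brauer_form K hT).choose_spec.2 h k).trans
    (if_neg fun h1 => hk (h1.symm.trans (T.len_rev h).symm))
  χ_self h := (exists_brauer_character K hT h).choose_spec.1
  χ_a h _ := (exists_brauer_character K hT h).choose_spec.2 _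

end HalfEdgeData

end GendoBrauer

namespace GendoBrauer

open HalfEdgeData

/-! ### Socles at the leaves -/

lemma IsLeafQuotient.id {H : Type v} {T : HalfEdgeData H} {K : Type u} [Field K] {C : Type w}
    [Ring C] [Algebra K C] (S : LeftSystem T K C) : IsLeafQuotient S ∅ (AlgHom.id K C) where
  surj := Function.surjective_id
  ker x := by rw [Set.image_empty, Submodule.span_empty, Submodule.mem_bot]; rfl
  succ_leaf _ h := h.elim
  mult_leaf _ h := h.elim
  opp_leaf _ h := h.elim

namespace LeftSystem

variable {H : Type v} {T : HalfEdgeData H} {K : Type u} [Field K] {C : Type w} [Ring C]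
  [Algebra K C] (S : LeftSystem T K C)

lemma induction_path {P : C → Prop} (h0 : ∀ h, P (S.e h)) (h1 : ∀ c h, P (S.a h * c))
    (hadd : ∀ x y, P x → P y → P (x + y)) (hzero : P 0) (hsmul : ∀ (k : K) x, P x → P (k • x))
    (c : C) : P c := by
  have hc : c ∈ Submodule.span K (Set.range fun x : H × ℕ => S.p x.1 x.2) := by
    rw [S.span]; trivial
  induction hc using Submodule.span_induction with
  | mem x hx =>
    obtain ⟨⟨k, j⟩, rfl⟩ := hx
    cases j with
    | zero => exact h0 k
    | succ j => exact h1 _ _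
  | zero => exact hzero
  | add x y _ _ hx hy => exact hadd x y hx hy
  | smul k x _ hx => exact hsmul k x hx

lemma e_mul_a_cases (k h : H) : S.e k * S.a h = S.a h ∨ S.e k * S.a h = 0 := by
  have := S.e_mul_p_cases k h 1
  rwa [S.p_one] at this

lemma a_mul_e_cases (k h : H) : S.a h * S.e k = S.a h ∨ S.a h * S.e k = 0 := by
  have := S.p_mul_e_cases k h 1
  rwa [S.p_one] at this

variable [Finite H] (hT : T.IsBrauer)
include hT

/-- The span of the loops at a set of leaves of multiplicity one is closed under right
multiplication. -/
lemma mul_mem_span_leaf {L : Set H} (hL : ∀ h ∈ L, T.succ h = h ∧ T.mult h = 1) {x : C}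
    (hx : x ∈ Submodule.span K (S.a '' L)) (c : C) : x * c ∈ Submodule.span K (S.a '' L) := by
  induction hx using Submodule.span_induction with
  | mem x hx =>
    obtain ⟨h, hh, rfl⟩ := hx
    have hmem : S.a h ∈ Submodule.span K (S.a '' L) := Submodule.subset_span ⟨h, hh, rfl⟩
    induction c using S.induction_path with
    | h0 k =>
      rcases S.a_mul_e_cases k h with h1 | h1
      · rwa [h1]
      · rw [h1]; exact zero_mem _
    | h1 c k =>
      rw [← mul_assoc, (S.mul_a_leaf hT (hL h hh).1 (hL h hh).2).2.2, zero_mul]; exact zero_mem _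
    | hadd x y hx hy => rw [mul_add]; exact add_mem hx hy
    | hzero => rw [mul_zero]; exact zero_mem _
    | hsmul k x hx => rw [mul_smul_comm]; exact Submodule.smul_mem _ _ hx
  | zero => rw [zero_mul]; exact zero_mem _
  | add x y _ _ hx hy => rw [add_mul]; exact add_mem hx hy
  | smul k x _ hx => rw [smul_mul_assoc]; exact Submodule.smul_mem _ _ hx

lemma mul_mem_span_leaf' {L : Set H} (hL : ∀ h ∈ L, T.succ h = h ∧ T.mult h = 1) {x : C}
    (hx : x ∈ Submodule.span K (S.a '' L)) (c : C) : c * x ∈ Submodule.span K (S.a '' L) := by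
  induction hx using Submodule.span_induction with
  | mem x hx =>
    obtain ⟨h, hh, rfl⟩ := hx
    have hmem : S.a h ∈ Submodule.span K (S.a '' L) := Submodule.subset_span ⟨h, hh, rfl⟩
    have hp : ∀ k, ∀ j, S.p k j * S.a h ∈ Submodule.span K (S.a '' L) := by
      intro k j
      cases j with
      | zero =>
        rcases S.e_mul_a_cases k h with h1 | h1
        · rwa [S.p_zero, h1]
        · rw [S.p_zero, h1]; exact zero_mem _
      | succ j =>
        rw [S.p_succ', mul_assoc, (S.mul_a_leaf hT (hL h hh).1 (hL h hh).2).2.1, mul_zero]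
        exact zero_mem _
    have hc : c ∈ Submodule.span K (Set.range fun x : H × ℕ => S.p x.1 x.2) := by
      rw [S.span]; trivial
    induction hc using Submodule.span_induction with
    | mem x hx => obtain ⟨⟨k, j⟩, rfl⟩ := hx; exact hp k j
    | zero => rw [zero_mul]; exact zero_mem _
    | add x y _ _ hx hy => rw [add_mul]; exact add_mem hx hy
    | smul k x _ hx => rw [smul_mul_assoc]; exact Submodule.smul_mem _ _ hx
  | zero => rw [mul_zero]; exact zero_mem _
  | add x y _ _ hx hy => rw [mul_add]; exact add_mem hx hy
  | smul k x _ hx => rw [mul_smul_comm]; exact Submodule.smul_mem _ _ hx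

open MulOpposite

/-- A simple right module is a simple left module over `Cᵐᵒᵖ`, which is a leaf quotient of itself
for the empty set of leaves. -/
lemma mul_a_eq_zero_of_mem_simple {N : Submodule Cᵐᵒᵖ C} [IsSimpleModule Cᵐᵒᵖ N] {x : C}
    (hx : x ∈ N) (k : H) : x * S.a k = 0 := by
  have h1 := (IsLeafQuotient.id (S.op hT)).arrow_smul_eq_zero hT.rev (T.succ k) (⟨x, hx⟩ : N)
  have h2 := congrArg Subtype.val h1
  change x * S.a (T.succ.symm (T.succ k)) = 0 at h2
  rwa [Equiv.symm_apply_apply] at h2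

/-- The socle of the projective right module at a leaf of multiplicity one. -/
lemma mem_socleOf_leaf {h : H} (h1 : T.succ h = h) (h2 : T.mult h = 1) (x : C) :
    x ∈ socleOf (S.e h) ↔ x ∈ Submodule.span K {S.a h} := by
  obtain ⟨hlen, hl, hr⟩ := S.mul_a_leaf hT h1 h2
  have hL : ∀ k ∈ ({h} : Set H), T.succ k = k ∧ T.mult k = 1 := by rintro k rfl; exact ⟨h1, h2⟩
  let Z : Submodule Cᵐᵒᵖ C :=
    { carrier := Submodule.span K {S.a h}
      add_mem' := fun ha hb => add_mem ha hb
      zero_mem' := zero_mem _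
      smul_mem' := fun c x hx => by
        have := S.mul_mem_span_leaf hT hL (x := x) (by rwa [Set.image_singleton]) c.unop
        rwa [Set.image_singleton] at this }
  have hZ : ∀ y, y ∈ Z ↔ y ∈ Submodule.span K {S.a h} := fun y => Iff.rfl
  have ht1 : S.t (S.a h) = 1 := by
    have := S.t_len h
    rw [hlen] at this
    rwa [← S.p_one]
  suffices hs : socleOf (S.e h) = Z by rw [hs, hZ]
  apply le_antisymm
  · refine sSup_le ?_
    rintro N ⟨hN, hle⟩ y hy
    rw [hZ, Submodule.mem_span_singleton]
    have hey : S.e h * y = y := by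
      obtain ⟨c, rfl⟩ := Submodule.mem_span_singleton.1 (hle hy)
      change S.e h * (S.e h * c.unop) = S.e h * c.unop
      rw [← mul_assoc, S.e_mul_self]
    -- Both `y` and the loop are killed by right multiplication with arrows and are fixed by `e_h`
    -- on the left. The difference `y - t(y) a_h` then pairs to zero with every path.
    refine ⟨S.t y, Eq.symm (sub_eq_zero.1 (S.eq_zero_of_t_eq_zero hT _ fun c => ?_))⟩
    rw [S.t_symm]
    induction c using S.induction_path with
    | h0 k =>
      rw [sub_mul, map_sub, S.t_symm y, smul_mul_assoc, map_smul, S.t_symm (S.a h)]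
      by_cases h3 : S.e k = S.e h
      · have h4 : S.e h * S.a h = S.a h := by have := S.e_mul_a h; rwa [h1] at this
        rw [h3, hey, h4, ht1, smul_eq_mul, mul_one, sub_self]
      · have h4 : S.e k * S.e h = 0 := S.e_mul _ _ (fun h5 => h3 (by rw [h5]))
          (fun h5 => h3 (by rw [h5, S.e_opp]))
        have h5 : S.e k * S.a h = 0 := by
          have := S.e_mul_a h
          rw [h1] at this
          rw [← this, ← mul_assoc, h4, zero_mul]
        rw [← hey, ← mul_assoc, h4, zero_mul, h5, map_zero, smul_zero, sub_zero]
    | h1 c k =>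
      rw [← mul_assoc, sub_mul, smul_mul_assoc, hr, S.mul_a_eq_zero_of_mem_simple hT hy, smul_zero,
        sub_zero, zero_mul, map_zero]
    | hadd a b ha hb => rw [mul_add, map_add, ha, hb, add_zero]
    | hzero => rw [mul_zero, map_zero]
    | hsmul k a ha => rw [mul_smul_comm, map_smul, ha, smul_zero]
  · refine le_sSup ⟨?_, ?_⟩
    · rw [isSimpleModule_iff_isAtom]
      refine ⟨fun h3 => S.a_ne_zero hT h ?_, fun N hN => ?_⟩
      · have : S.a h ∈ Z := Submodule.mem_span_singleton_self _
        rwa [h3, Submodule.mem_bot] at this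
      · rw [eq_bot_iff]
        intro y hy
        rw [Submodule.mem_bot]
        by_contra hy0
        obtain ⟨k, rfl⟩ := Submodule.mem_span_singleton.1 ((hZ _).1 (hN.le hy))
        have hk : k ≠ 0 := fun h3 => hy0 (by rw [h3, zero_smul])
        refine hN.not_ge fun x hx => ?_
        obtain ⟨l, rfl⟩ := Submodule.mem_span_singleton.1 ((hZ _).1 hx)
        have h3 := N.smul_mem (MulOpposite.op (algebraMap K C (l * k⁻¹))) hy
        rw [op_smul_eq_mul, ← Algebra.commutes, ← Algebra.smul_def, smul_smul, mul_assoc,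
          inv_mul_cancel₀ hk, mul_one] at h3
        exact h3
    · intro y hy
      obtain ⟨k, rfl⟩ := Submodule.mem_span_singleton.1 ((hZ _).1 hy)
      refine Submodule.mem_span_singleton.2 ⟨MulOpposite.op (k • S.a h), ?_⟩
      have := S.e_mul_a h
      rw [h1] at this
      rw [op_smul_eq_mul, mul_smul_comm, this]

lemma exists_ringHom_ker_leaf {L : Set H} (hL : ∀ h ∈ L, T.succ h = h ∧ T.mult h = 1) :
    ∃ (R : Type w) (_ : Ring R) (f : C →+* R), ∀ x, f x = 0 ↔ x ∈ Submodule.span K (S.a '' L) := by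
  let I : Ideal C :=
    { carrier := Submodule.span K (S.a '' L)
      add_mem' := fun ha hb => add_mem ha hb
      zero_mem' := zero_mem _
      smul_mem' := fun c x hx => S.mul_mem_span_leaf' hT hL hx c }
  have : I.IsTwoSided := ⟨fun c hx => S.mul_mem_span_leaf hT hL hx c⟩
  exact ⟨C ⧸ I, inferInstance, Ideal.Quotient.mk I, fun x => Ideal.Quotient.eq_zero_iff_mem⟩

/-- The span of the loops is already a two-sided ideal, so imposing the relations kills nothing
more. -/
lemma isLeafQuotient_ringQuot {L : Set H} (hL : ∀ h ∈ L, T.succ h = h ∧ T.mult h = 1)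
    (hL' : ∀ h ∈ L, T.opp h ∉ L) (r : C → C → Prop)
    (hr : ∀ a b, r a b ↔ a ∈ Submodule.span K (S.a '' L) ∧ b = 0) :
    IsLeafQuotient S L (RingQuot.mkAlgHom K r) where
  surj := RingQuot.mkAlgHom_surjective K r
  ker x := by
    constructor
    · intro hx
      obtain ⟨R, _, f, hf⟩ := S.exists_ringHom_ker_leaf hT hL
      let F : RingQuot r →+* R := RingQuot.lift ⟨f, fun {a b} h => by
        obtain ⟨h1, rfl⟩ := (hr _ _).1 h
        rw [map_zero, (hf a).2 h1]⟩
      rw [← hf]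
      have h1 : RingQuot.mkRingHom r x = 0 := by
        rw [← RingQuot.mkAlgHom_coe K r]
        exact hx
      have h2 : F (RingQuot.mkRingHom r x) = f x := RingQuot.lift_mkRingHom_apply _ _ _
      rw [← h2, h1, map_zero]
    · intro hx
      rw [RingQuot.mkAlgHom_rel K ((hr x 0).2 ⟨hx, rfl⟩), map_zero]
  succ_leaf h hh := (hL h hh).1
  mult_leaf h hh := (hL h hh).2
  opp_leaf := hL'

end LeftSystem

/-! ### Gendo-Brauer tree algebras -/

namespace PlanarTree

variable (K : Type u) [Field K] {V : Type v} (T : PlanarTree V) (m : V → ℕ) (W : Set T.graph.Dart)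

/-- The new half-edges at the new vertices. -/
def leaves : Set (T.graph.Dart ⊕ (W ⊕ W)) := Set.range fun h : W => .inr (.inr h)

/-- The quotient map from the Brauer tree algebra of the enlarged tree. -/
noncomputable def gendoMk : (T.enlarged m W).BrauerAlgebra K →ₐ[K] T.GendoAlgebra K m W :=
  RingQuot.mkAlgHom K _

lemma rev_succ_leaf {h} (hh : h ∈ T.leaves W) : (T.enlarged m W).rev.succ h = h := by
  obtain ⟨k, rfl⟩ := hh; rfl

lemma rev_mult_leaf {h} (hh : h ∈ T.leaves W) : (T.enlarged m W).rev.mult h = 1 := by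
  obtain ⟨k, rfl⟩ := hh; rfl

lemma opp_leaf {h} (hh : h ∈ T.leaves W) : (T.enlarged m W).opp h ∉ T.leaves W := by
  obtain ⟨k, rfl⟩ := hh
  rintro ⟨k', h⟩
  exact absurd (Sum.inr_injective h) Sum.inr_ne_inl

variable [Finite T.graph.Dart] (hT : (T.enlarged m W).IsBrauer)

lemma mem_leafSocles (x : (T.enlarged m W).BrauerAlgebra K) : x ∈ T.leafSocles K m W ↔
    x ∈ Submodule.span K ((brauerSystem K hT).a '' T.leaves W) := by
  set S := brauerSystem K hT
  have he : ∀ h : W, (T.enlarged m W).idemp K ((T.enlarged m W).edge (.inr (.inl h))) =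
      S.e (.inr (.inr h)) := fun h => (S.e_opp (.inr (.inr h)) : _)
  have hmem : ∀ h : W, (Sum.inr (Sum.inr h) : T.graph.Dart ⊕ (W ⊕ W)) ∈ T.leaves W := fun h => ⟨h, rfl⟩
  have hs : ∀ (h : W) y, y ∈ socleOf ((T.enlarged m W).idemp K
      ((T.enlarged m W).edge (.inr (.inl h)))) ↔ y ∈ Submodule.span K {S.a (.inr (.inr h))} := by
    intro h y
    rw [he]
    exact S.mem_socleOf_leaf hT.rev (T.rev_succ_leaf m W (hmem h)) (T.rev_mult_leaf m W (hmem h)) y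
  constructor
  · intro hx
    let I : Submodule ((T.enlarged m W).BrauerAlgebra K)ᵐᵒᵖ ((T.enlarged m W).BrauerAlgebra K) :=
      { carrier := Submodule.span K (S.a '' T.leaves W)
        add_mem' := fun ha hb => add_mem ha hb
        zero_mem' := zero_mem _
        smul_mem' := fun c x hx => S.mul_mem_span_leaf hT.rev (L := T.leaves W)
          (fun h hh => ⟨T.rev_succ_leaf m W hh, T.rev_mult_leaf m W hh⟩) hx c.unop }
    have hle : T.leafSocles K m W ≤ I := iSup_le fun h y hy => by
      have h2 : S.a (.inr (.inr h)) ∈ S.a '' T.leaves W := ⟨_, hmem h, rfl⟩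
      exact Submodule.span_mono (Set.singleton_subset_iff.2 h2) ((hs h y).1 hy)
    exact hle hx
  · intro hx
    induction hx using Submodule.span_induction with
    | mem x hx =>
      obtain ⟨_, ⟨h, rfl⟩, rfl⟩ := hx
      refine (le_iSup (fun h : W => socleOf ((T.enlarged m W).idemp K
        ((T.enlarged m W).edge (.inr (.inl h))))) h) ?_
      exact (hs h _).2 (Submodule.mem_span_singleton_self (R := K) _)
    | zero => exact zero_mem _
    | add x y _ _ hx hy => exact add_mem hx hy
    | smul k x _ hx =>
      have := (T.leafSocles K m W).smul_mem (.op (algebraMap K _ k)) hx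
      rwa [op_smul_eq_mul, ← Algebra.commutes, ← Algebra.smul_def] at this

/-- The gendo-Brauer tree algebra as a quotient of the Brauer tree algebra of the enlarged tree. -/
lemma isLeafQuotient_gendoMk :
    IsLeafQuotient (brauerSystem K hT) (T.leaves W) (T.gendoMk K m W) :=
  (brauerSystem K hT).isLeafQuotient_ringQuot (L := T.leaves W) hT.rev
    (fun _ hh => ⟨T.rev_succ_leaf m W hh, T.rev_mult_leaf m W hh⟩)
    (fun _ hh => T.opp_leaf m W hh)
    (fun a b => a ∈ T.leafSocles K m W ∧ b = 0)
    fun a _ => and_congr_left fun _ => T.mem_leafSocles K m W hT a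

end PlanarTree

end GendoBrauer

namespace GendoBrauer

open HalfEdgeData

/-! ### Return times of Green's walk -/

namespace HalfEdgeData

variable {H : Type v} {T : HalfEdgeData H}

/-- Conjugated by `opp`, the walk for the reversed orders is the inverse of Green's walk. -/
lemma IsBrauer.green_rev_iterate (hT : T.IsBrauer) (k : ℕ) (x y : H) :
    T.rev.green^[k] (T.opp x) = T.opp y ↔ T.green^[k] y = x := by
  have hinj : Function.Injective T.opp := Function.LeftInverse.injective hT.opp_opp
  induction k generalizing x with
  | zero => exact ⟨fun h => (hinj h).symm, fun h => congrArg T.opp h.symm⟩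
  | succ k ih =>
    have h1 : T.rev.green (T.opp x) = T.opp (T.succ (T.opp x)) := rfl
    rw [Function.iterate_succ_apply, h1]
    refine (ih (T.succ (T.opp x))).trans ?_
    rw [Function.iterate_succ_apply']
    constructor
    · intro h
      rw [h]
      change T.opp (T.succ.symm (T.succ (T.opp x))) = x
      rw [Equiv.symm_apply_apply, hT.opp_opp]
    · intro h
      rw [← h]
      change _ = T.succ (T.opp (T.opp (T.succ.symm _)))
      rw [hT.opp_opp, Equiv.apply_symm_apply]

/-- At a leaf `green` and `opp` coincide, and the extra step this introduces on both sides cancels.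
-/
lemma IsBrauer.green_rev_mem_iff (hT : T.IsBrauer) {L : Set H} (hL : ∀ h ∈ L, T.succ h = h) {h : H}
    (hh : h ∈ L) (k : ℕ) : T.rev.green^[k] h ∈ L ↔ ∃ h' ∈ L, T.green^[k] h' = h := by
  have hg : ∀ h ∈ L, T.green h = T.opp h := fun h hh => by
    rw [green, (Equiv.symm_apply_eq _).2 (hL h hh).symm]
  have key : ∀ h' ∈ L, T.rev.green^[k] h = h' ↔ T.green^[k] h' = h := by
    intro h' hh'
    have h1 := hT.green_rev_iterate k (T.opp h) (T.opp h')
    rw [hT.opp_opp, hT.opp_opp, ← hg h hh, ← hg h' hh', ← Function.iterate_succ_apply,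
      Function.iterate_succ_apply'] at h1
    rw [h1]
    exact hT.green_injective.eq_iff
  constructor
  · intro h1
    exact ⟨_, h1, (key _ h1).1 rfl⟩
  · rintro ⟨h', hh', h1⟩
    rw [(key h' hh').2 h1]
    exact hh'

lemma IsBrauer.card_eq (hT : T.IsBrauer) : Nat.card H = 2 * Nat.card T.Edge := by
  have h1 : Nat.card H = Nat.card (T.Edge × Bool) := by
    symm
    refine Nat.card_congr (Equiv.ofBijective
      (fun x => bif x.2 then T.opp (Quot.out x.1) else Quot.out x.1) ⟨?_, ?_⟩)
    · have ho : ∀ x : T.Edge, T.edge (Quot.out x) = x := Quot.out_eq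
      have ho' : ∀ x : T.Edge, T.edge (T.opp (Quot.out x)) = x := fun x => by
        rw [(hT.edge_eq_iff _ (Quot.out x)).2 (Or.inr (hT.opp_opp _).symm), ho]
      rintro ⟨x, b⟩ ⟨y, c⟩ h
      have hxy : x = y := by
        have := congrArg T.edge h
        cases b <;> cases c <;> simpa [ho, ho'] using this
      subst hxy
      cases b <;> cases c
      · rfl
      · exact absurd h.symm (hT.opp_ne _)
      · exact absurd h (hT.opp_ne _)
      · rfl
    · intro h
      have h1 : T.edge h = T.edge (Quot.out (T.edge h)) := (Quot.out_eq (T.edge h)).symm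
      rcases (hT.edge_eq_iff _ _).1 h1 with h2 | h2
      · exact ⟨(T.edge h, false), h2⟩
      · refine ⟨(T.edge h, true), ?_⟩
        change T.opp (Quot.out (T.edge h)) = h
        rw [h2, hT.opp_opp]
  rw [h1, Nat.card_prod, Nat.card_eq_fintype_card (α := Bool), Fintype.card_bool, mul_comm]

lemma greenWalk_add {n : ℕ} {g : ZMod (2 * n) → H} (hg : IsGreenWalk T n g) (i : ZMod (2 * n))
    (k : ℕ) : g (i + k) = T.green^[k] (g i) := by
  induction k with
  | zero => rw [Nat.cast_zero, add_zero]; rfl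
  | succ k ih => rw [Nat.cast_succ, ← add_assoc, hg.2, ih, Function.iterate_succ_apply']; rfl

variable [Finite H]

/-- A gap from `h` to its next visit of `L` is the backward gap from that visit: an earlier backward
return would be a visit of `L` strictly in between. -/
lemma IsBrauer.returnTime_image_subset_rev (hT : T.IsBrauer) {L : Set H}
    (hL : ∀ h ∈ L, T.succ h = h) : T.returnTime L '' L ⊆ T.rev.returnTime L '' L := by
  rintro _ ⟨h, hh, rfl⟩
  obtain ⟨h1, h2⟩ := hT.returnTime_mem L hh
  refine ⟨_, h2, le_antisymm (Nat.sInf_le ⟨h1, ?_⟩) ?_⟩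
  · exact (hT.green_rev_mem_iff hL h2 _).2 ⟨h, hh, rfl⟩
  · obtain ⟨h3, h4⟩ := hT.rev.returnTime_mem L h2
    by_contra! hlt
    obtain ⟨h', hh', h5⟩ := (hT.green_rev_mem_iff hL h2 _).1 h4
    set k := T.rev.returnTime L (T.green^[T.returnTime L h] h)
    obtain ⟨j, hj⟩ : ∃ j, T.returnTime L h = k + j := ⟨_, (Nat.add_sub_cancel' hlt.le).symm⟩
    rw [hj, Function.iterate_add_apply] at h5
    have h6 := hT.green_injective.iterate k h5
    exact notMem_of_lt_returnTime (L := L) (h := h) (k := j) (by omega) (by omega) (h6 ▸ hh')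

lemma IsBrauer.returnTime_image_rev (hT : T.IsBrauer) {L : Set H}
    (hL : ∀ h ∈ L, T.succ h = h) : T.rev.returnTime L '' L = T.returnTime L '' L :=
  Set.Subset.antisymm
    (hT.rev.returnTime_image_subset_rev fun h hh => (Equiv.symm_apply_eq _).2 (hL h hh).symm)
    (hT.returnTime_image_subset_rev hL)

/-! ### Walks that run through all half-edges -/

/-- The single orbit has as many elements as there are half-edges, twice the number of edges, so
exponents may be read modulo that number. -/
lemma IsBrauer.exists_greenWalk (hT : T.IsBrauer) [Nonempty H]
    (horb : ∀ x y, ∃ k, T.green^[k] x = y) :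
    ∃ g : ZMod (2 * Nat.card T.Edge) → H, IsGreenWalk T (Nat.card T.Edge) g := by
  obtain ⟨x⟩ := ‹Nonempty H›
  have hmem : x ∈ Function.periodicPts T.green := hT.green_injective.mem_periodicPts x
  have hp : Function.minimalPeriod T.green x = 2 * Nat.card T.Edge := by
    rw [← hT.card_eq, ← Nat.card_fin (Function.minimalPeriod T.green x)]
    refine Nat.card_congr (Equiv.ofBijective (fun i => T.green^[i.1] x) ⟨fun i j h => ?_, fun y => ?_⟩)
    · exact Fin.ext (Function.iterate_injOn_Iio_minimalPeriod i.2 j.2 h)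
    · obtain ⟨k, rfl⟩ := horb x y
      exact ⟨⟨k % Function.minimalPeriod T.green x,
        Nat.mod_lt _ (Function.minimalPeriod_pos_of_mem_periodicPts hmem)⟩,
        Function.iterate_mod_minimalPeriod_eq⟩
  have hpos := Function.minimalPeriod_pos_of_mem_periodicPts hmem
  rw [hp] at hpos
  have : NeZero (2 * Nat.card T.Edge) := ⟨hpos.ne'⟩
  refine ⟨fun i => T.green^[i.val] x, rfl, fun i => ?_⟩
  change T.green^[(i + 1).val] x = T.green (T.green^[i.val] x)
  rw [← Function.iterate_succ_apply' T.green, ZMod.val_add]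
  by_cases h1 : 2 * Nat.card T.Edge = 1
  · omega
  · have : Fact (1 < 2 * Nat.card T.Edge) := ⟨by omega⟩
    have h2 : Function.IsPeriodicPt T.green (2 * Nat.card T.Edge) x :=
      hp ▸ Function.isPeriodicPt_minimalPeriod _ _
    rw [ZMod.val_one, h2.iterate_mod_apply]

end HalfEdgeData

lemma gaps_eq {H : Type v} {W : Set H} [Finite H] {T : HalfEdgeData (H ⊕ (W ⊕ W))}
    (hT : T.IsBrauer) (horb : ∀ x y, ∃ k, T.green^[k] x = y) {n : ℕ} (hn : 0 < n)
    {g : ZMod (2 * n) → H ⊕ (W ⊕ W)} (hg : IsGreenWalk T n g) :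
    gaps g = (fun h => T.returnTime (Set.range fun h : W => .inr (.inr h)) h - 2) ''
      (Set.range fun h : W => .inr (.inr h)) := by
  set L : Set (H ⊕ (W ⊕ W)) := Set.range fun h : W => .inr (.inr h)
  have homega : ∀ i, i ∈ omega g ↔ g i ∈ L := fun i =>
    ⟨fun ⟨h, hh⟩ => ⟨h, hh.symm⟩, fun ⟨h, hh⟩ => ⟨h, hh.symm⟩⟩
  have : NeZero (2 * n) := ⟨by omega⟩
  have hsurj : Function.Surjective g := fun y => by
    obtain ⟨k, hk⟩ := horb (g 0) y
    exact ⟨0 + k, by rw [greenWalk_add hg, hk]⟩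
  have key : ∀ i ∈ omega g, bar (eta (omega g) i - i) = T.returnTime L (g i) := by
    intro i hi
    have hi := (homega i).1 hi
    have h1 : sInf {k : ℕ | 0 < k ∧ i + (k : ZMod (2 * n)) ∈ omega g} = T.returnTime L (g i) := by
      rw [returnTime]
      congr 1
      ext k
      rw [Set.mem_ofPred_eq, Set.mem_ofPred_eq, homega, greenWalk_add hg]
    have h2 : eta (omega g) i - i = (T.returnTime L (g i) : ZMod (2 * n)) := by
      rw [eta, h1, add_sub_cancel_left]
    have h3 : T.returnTime L (g i) ≤ 2 * n := Nat.sInf_le ⟨by omega, by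
      rw [← greenWalk_add hg, ZMod.natCast_self, add_zero]; exact hi⟩
    have h4 := (hT.returnTime_mem L hi).1
    rw [h2, bar]
    -- The return time lies between `1` and `2 * n`. Its residue is zero only if the walk goes round
    -- completely, where `bar` takes the value `2 * n`.
    split_ifs with h5
    · rw [ZMod.natCast_eq_zero_iff] at h5
      exact le_antisymm (Nat.le_of_dvd h4 h5) h3
    · rw [ZMod.val_natCast]
      refine Nat.mod_eq_of_lt (lt_of_le_of_ne h3 fun h6 => h5 ?_)
      rw [h6, ZMod.natCast_self]
  ext d
  constructor
  · rintro ⟨i, hi, rfl⟩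
    exact ⟨g i, (homega i).1 hi, by rw [key i hi]⟩
  · rintro ⟨h, hh, rfl⟩
    obtain ⟨i, rfl⟩ := hsurj h
    exact ⟨i, (homega i).2 hh, by rw [key i ((homega i).2 hh)]⟩

end GendoBrauer

namespace GendoBrauer

open HalfEdgeData

/-! ### Green's walk around a tree -/

namespace PlanarTree

variable {V : Type v} (T : PlanarTree V) (m : V → ℕ) (W : Set T.graph.Dart)

lemma finite_dart [Finite V] : Finite T.graph.Dart :=
  Finite.of_injective _ (SimpleGraph.Dart.toProd_injective (G := T.graph))

lemma succ_fst (h : T.graph.Dart) : (T.succ h).fst = h.fst :=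
  ((T.sameCycle_iff h (T.succ h)).1 ⟨1, by rw [zpow_one]⟩).symm

lemma isBrauer_enlarged (hm : ∀ a, 0 < m a) : (T.enlarged m W).IsBrauer where
  opp_opp := by
    rintro (h | h | h)
    · exact congrArg Sum.inl (SimpleGraph.Dart.symm_symm h)
    · rfl
    · rfl
  opp_ne := by
    rintro (h | h | h)
    · exact fun h1 => SimpleGraph.Dart.symm_ne h (Sum.inl_injective h1)
    · exact fun h1 => Sum.inr_ne_inl (Sum.inr_injective h1)
    · exact fun h1 => Sum.inl_ne_inr (Sum.inr_injective h1)
  mult_pos := by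
    rintro (h | h | h)
    · exact hm _
    · exact hm _
    · exact Nat.one_pos
  mult_succ := by
    rintro (h | h | h)
    · by_cases hW : h ∈ W
      · have h1 : (T.enlarged m W).succ (.inl h) = .inr (.inl ⟨h, hW⟩) := dif_pos hW
        rw [h1]; rfl
      · have h1 : (T.enlarged m W).succ (.inl h) = .inl (T.succ h) := dif_neg hW
        rw [h1]
        exact congrArg m (T.succ_fst h)
    · exact congrArg m (T.succ_fst _)
    · rfl

/-- The clockwise step of Green's walk around the original tree. -/
def step (h : T.graph.Dart) : T.graph.Dart := (T.succ.symm h).symm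

lemma step_snd (h : T.graph.Dart) : (T.step h).snd = h.fst := by
  change (T.succ.symm h).fst = h.fst
  rw [← T.succ_fst, Equiv.apply_symm_apply]

lemma step_injective : Function.Injective T.step :=
  (SimpleGraph.Dart.symm_involutive.injective).comp T.succ.symm.injective

/-- Removing the edge of `h` disconnects the tree. The walk permutes `O` and its darts link end to
start, so within `O` the edge is crossed equally often in both directions. -/
lemma symm_mem_of_step_mem [Finite T.graph.Dart] {O : Set T.graph.Dart}
    (hO : ∀ h ∈ O, T.step h ∈ O) {h : T.graph.Dart} (hh : h ∈ O) : h.symm ∈ O := by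
  classical
  have := Fintype.ofFinite T.graph.Dart
  have hbr := SimpleGraph.isAcyclic_iff_forall_adj_isBridge.1 T.isTree.isAcyclic h.adj
  rw [SimpleGraph.isBridge_iff] at hbr
  set G' := T.graph.deleteEdges {s(h.fst, h.snd)}
  -- The indicator of the side of `h.fst`. Its increments along `O` sum to zero, while only `h` and
  -- `h.symm` have a nonzero increment.
  let f : V → ℤ := fun x => if G'.Reachable h.fst x then 1 else 0
  let s : Finset T.graph.Dart := Finset.univ.filter (· ∈ O)
  have hs : ∀ k, k ∈ s ↔ k ∈ O := fun k => by simp [s]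
  have himg : s.image T.step = s := by
    refine Finset.eq_of_subset_of_card_le (fun k hk => ?_)
      (Finset.card_image_of_injective s T.step_injective).ge
    obtain ⟨j, hj, rfl⟩ := Finset.mem_image.1 hk
    exact (hs _).2 (hO j ((hs j).1 hj))
  have hsum : ∑ k ∈ s, (f k.snd - f k.fst) = 0 := by
    rw [Finset.sum_sub_distrib, sub_eq_zero]
    conv_lhs => rw [← himg]
    rw [Finset.sum_image T.step_injective.injOn]
    exact Finset.sum_congr rfl fun k _ => by rw [T.step_snd]
  by_contra hsymm
  have h1 : ∑ k ∈ s, (f k.snd - f k.fst) = f h.snd - f h.fst := by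
    refine Finset.sum_eq_single_of_mem h ((hs h).2 hh) fun k hk hkh => ?_
    have hke : k.edge ≠ h.edge := by
      intro h2
      rcases SimpleGraph.dart_edge_eq_iff k h |>.1 h2 with h3 | h3
      · exact hkh h3
      · exact hsymm (h3 ▸ (hs k).1 hk)
    have hadj : G'.Adj k.fst k.snd := by
      rw [SimpleGraph.deleteEdges_adj]
      exact ⟨k.adj, fun h2 => hke h2⟩
    have h2 : G'.Reachable h.fst k.snd ↔ G'.Reachable h.fst k.fst :=
      ⟨fun h3 => h3.trans hadj.reachable.symm, fun h3 => h3.trans hadj.reachable⟩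
    simp only [f, h2, sub_self]
  rw [hsum] at h1
  simp only [f, if_pos (SimpleGraph.Reachable.refl h.fst)] at h1
  rw [if_neg hbr] at h1
  exact absurd h1 (by norm_num)

/-- Closure under `step` and under reversal gives closure under `succ⁻¹`, so `O` contains all darts
at a vertex once it contains one. Reversal then moves along edges, and the tree is connected. -/
lemma mem_of_step_mem [Finite T.graph.Dart] {O : Set T.graph.Dart}
    (hO : ∀ h ∈ O, T.step h ∈ O) {h : T.graph.Dart} (hh : h ∈ O) (k : T.graph.Dart) : k ∈ O := by
  have h1 : ∀ h ∈ O, T.succ.symm h ∈ O := fun h hh => by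
    have := T.symm_mem_of_step_mem hO (hO h hh)
    rwa [step, SimpleGraph.Dart.symm_symm] at this
  have h2 : ∀ h ∈ O, ∀ k, k.fst = h.fst → k ∈ O := by
    intro h hh k hk
    obtain ⟨n, rfl⟩ := ((T.sameCycle_iff h k).2 hk.symm).inv.exists_nat_pow_eq
    clear hk
    induction n with
    | zero => exact hh
    | succ n ih => rw [pow_succ', Equiv.Perm.mul_apply]; exact h1 _ ih
  have h3 : ∀ x y, T.graph.Walk x y → (∀ k : T.graph.Dart, k.fst = x → k ∈ O) →
      ∀ k : T.graph.Dart, k.fst = y → k ∈ O := by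
    intro x y p
    induction p with
    | nil => exact id
    | cons hadj p ih =>
      intro hx
      refine ih fun k hk => h2 _ (T.symm_mem_of_step_mem hO (hx ⟨(_, _), hadj⟩ rfl)) k hk
  obtain ⟨p⟩ := T.isTree.connected.preconnected h.fst k.fst
  exact h3 _ _ p (h2 h hh) k rfl

/-- A step of the original walk is either unchanged or replaced by three steps: to the new leaf,
back from it, and on. -/
lemma green_inl (h : T.graph.Dart) : ∃ k, (T.enlarged m W).green^[k] (.inl h) = .inl (T.step h) := by
  by_cases hW : T.succ.symm h ∈ W
  · have h1 : (T.enlarged m W).succ.symm (.inl h) = .inr (.inl ⟨T.succ.symm h, hW⟩) := dif_pos hW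
    refine ⟨3, ?_⟩
    change (T.enlarged m W).green ((T.enlarged m W).green ((T.enlarged m W).opp
      ((T.enlarged m W).succ.symm (.inl h)))) = _
    rw [h1]
    rfl
  · have h1 : (T.enlarged m W).succ.symm (.inl h) = .inl (T.succ.symm h) := dif_neg hW
    refine ⟨1, ?_⟩
    change (T.enlarged m W).opp ((T.enlarged m W).succ.symm (.inl h)) = _
    rw [h1]
    rfl

/-- Green's walk runs through all half-edges. -/
lemma exists_iterate_green_eq [Finite T.graph.Dart] (x y : T.graph.Dart ⊕ (W ⊕ W)) :
    ∃ k, (T.enlarged m W).green^[k] x = y := by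
  set f := (T.enlarged m W).green with hf
  have htrans : ∀ {x y z}, (∃ k, f^[k] x = y) → (∃ k, f^[k] y = z) → ∃ k, f^[k] x = z := by
    rintro x y z ⟨k, rfl⟩ ⟨l, rfl⟩
    exact ⟨l + k, Function.iterate_add_apply f l k x⟩
  have hll : ∀ h k : T.graph.Dart, ∃ n, f^[n] (.inl h) = .inl k := by
    intro h k
    exact T.mem_of_step_mem (O := {k | ∃ n, f^[n] (.inl h) = .inl k})
      (fun k hk => htrans hk (T.green_inl m W k)) ⟨0, rfl⟩ k
  have hto : ∀ x, ∃ h : T.graph.Dart, ∃ n, f^[n] x = .inl h := by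
    rintro (h | h | h)
    · exact ⟨h, 0, rfl⟩
    · exact ⟨h.1.symm, 1, rfl⟩
    · exact ⟨h.1.symm, 2, rfl⟩
  have hfrom : ∀ y, ∃ h : T.graph.Dart, ∃ n, f^[n] (.inl h) = y := by
    have hW : ∀ h : W, f (.inl (T.succ h)) = .inr (.inr h) := fun h => by
      have h1 : (T.enlarged m W).succ.symm (.inl (T.succ h)) = .inr (.inl h) :=
        (Equiv.symm_apply_eq _).2 rfl
      rw [hf, green, h1]
      rfl
    rintro (h | h | h)
    · exact ⟨h, 0, rfl⟩
    · refine ⟨T.succ h, 2, ?_⟩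
      change f (f (.inl (T.succ h))) = _
      rw [hW]
      rfl
    · exact ⟨T.succ h, 1, hW h⟩
  obtain ⟨h, hx⟩ := hto x
  obtain ⟨k, hy⟩ := hfrom y
  exact htrans hx (htrans (hll h k) hy)

lemma succ_leaf {h} (hh : h ∈ T.leaves W) : (T.enlarged m W).succ h = h := by
  obtain ⟨k, rfl⟩ := hh; rfl

/-- After one step from a leaf the walk is at the inner half of the new edge, after two at an old
half-edge. So subtracting two never truncates. -/
lemma three_le_returnTime [Finite T.graph.Dart] (hT : (T.enlarged m W).IsBrauer) {h}
    (hh : h ∈ T.leaves W) : 3 ≤ (T.enlarged m W).returnTime (T.leaves W) h := by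
  obtain ⟨h0, hmem⟩ := hT.returnTime_mem _ hh
  obtain ⟨k, rfl⟩ := hh
  by_contra! hlt
  beta_reduce at h0 hmem hlt
  obtain h1 | h1 : (T.enlarged m W).returnTime (T.leaves W) (.inr (.inr k)) = 1 ∨
    (T.enlarged m W).returnTime (T.leaves W) (.inr (.inr k)) = 2 := by omega
  · rw [h1] at hmem
    obtain ⟨j, hj⟩ := hmem
    exact absurd (Sum.inr_injective hj) Sum.inr_ne_inl
  · rw [h1] at hmem
    obtain ⟨j, hj⟩ := hmem
    exact absurd hj Sum.inr_ne_inl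

lemma three_le_returnTime_rev [Finite T.graph.Dart] (hT : (T.enlarged m W).IsBrauer) {h}
    (hh : h ∈ T.leaves W) : 3 ≤ (T.enlarged m W).rev.returnTime (T.leaves W) h := by
  have h1 : (T.enlarged m W).rev.returnTime (T.leaves W) h ∈
      (T.enlarged m W).returnTime (T.leaves W) '' T.leaves W := by
    rw [← hT.returnTime_image_rev fun h hh => T.succ_leaf m W hh]
    exact ⟨h, hh, rfl⟩
  obtain ⟨k, hk, h2⟩ := h1
  rw [← h2]
  exact T.three_le_returnTime m W hT hk

end PlanarTree

end GendoBrauer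

namespace GendoBrauer

open HalfEdgeData

/-! ### Homological dimensions of gendo-Brauer tree algebras -/

section Morita

variable {K : Type u} [Field K] {A : Type w} {B : Type v} [Ring A] [Algebra K A] [Ring B]
  [Algebra K B]

lemma exists_regular_op_iso (A : Type w) [Ring A] :
    Nonempty (ModuleCat.of Aᵐᵒᵖ A ≅ ModuleCat.of Aᵐᵒᵖ Aᵐᵒᵖ) :=
  ⟨LinearEquiv.toModuleIso
    { MulOpposite.opAddEquiv (α := A) with map_smul' := fun _ _ => rfl }⟩

lemma dimensions_of_isMoritaEquivalent (h : IsMoritaEquivalent K A B) :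
    injectiveDimension (ModuleCat.of A A) = injectiveDimension (ModuleCat.of B B) ∧
    injectiveDimension (ModuleCat.of Aᵐᵒᵖ A) = injectiveDimension (ModuleCat.of Bᵐᵒᵖ Bᵐᵒᵖ) ∧
    (∀ n, HasDomDimGE n (ModuleCat.of Aᵐᵒᵖ A) ↔ HasDomDimGE n (ModuleCat.of Bᵐᵒᵖ Bᵐᵒᵖ)) ∧
    Nonempty (ModuleCat.{max v w} Aᵐᵒᵖ ≌ ModuleCat.{max v w} Bᵐᵒᵖ) := by
  obtain ⟨M⟩ := h.cond
  obtain ⟨E⟩ := exists_equivalence_op M.eqv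
  obtain ⟨e⟩ := exists_regular_op_iso A
  refine ⟨injectiveDimension_regular_eq M.eqv, ?_, fun n => ?_, ⟨E⟩⟩
  · rw [injectiveDimension_eq_of_iso e]
    exact injectiveDimension_regular_eq E
  · exact ⟨fun h => (hasDomDimGE_regular_iff E n).1 (h.of_iso e),
      fun h => ((hasDomDimGE_regular_iff E n).2 h).of_iso e.symm⟩

lemma domDim_eq (A : Type w) [Ring A] :
    domDim A = sSup {c : ℕ∞ | ∃ n : ℕ, c = n ∧ HasDomDimGE n (ModuleCat.of Aᵐᵒᵖ A)} :=
  moduleDomDim_eq _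

end Morita

/-! ### The case of no leaves: the symmetric algebra itself. -/

namespace IsLeafQuotient

variable {H : Type v} {T : HalfEdgeData H} {K : Type u} [Field K] {C Γ : Type w} [Ring C]
  [Algebra K C] [Ring Γ] [Algebra K Γ] {S : LeftSystem T K C} {π : C →ₐ[K] Γ}
  (hQ : IsLeafQuotient S ∅ π)
include hQ

lemma bijective_of_empty : Function.Bijective π := by
  refine ⟨(injective_iff_map_eq_zero π).2 fun x hx => ?_, hQ.surj⟩
  have := (hQ.ker x).1 hx
  rwa [Set.image_empty, Submodule.span_empty, Submodule.mem_bot] at this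

variable [Finite H] (hT : T.IsBrauer)
include hT

lemma isSymmetricAlgebra_of_empty : IsSymmetricAlgebra Γ K := by
  let E := AlgEquiv.ofBijective π (hQ.bijective_of_empty)
  refine ⟨S.t ∘ₗ E.symm.toLinearMap, fun a b => ?_, fun a ha => ?_⟩
  · change S.t (E.symm (a * b)) = S.t (E.symm (b * a))
    rw [map_mul E.symm, map_mul E.symm, S.t_symm]
  · rw [← map_eq_zero_iff E.symm E.symm.injective]
    refine S.eq_zero_of_t_eq_zero hT _ fun c => ?_
    have h1 := ha (E c)
    change S.t (E.symm (a * E c)) = 0 at h1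
    rw [map_mul E.symm, AlgEquiv.symm_apply_apply] at h1
    rw [S.t_symm, h1]

lemma subsingleton_iff_of_empty : Subsingleton Γ ↔ IsEmpty H := by
  constructor
  · intro h
    refine ⟨fun k => S.a_ne_zero hT k ((hQ.bijective_of_empty).1 (Subsingleton.elim _ _))⟩
  · intro h
    refine subsingleton_of_zero_eq_one ?_
    rw [← map_one π, ← S.sum_e, Finset.sum_eq_zero fun k _ => isEmptyElim k, map_zero]

-- The algebra is self-injective; the value `⊥` occurs exactly when there are no edges, since the
-- algebra is then zero.
open Classical in
lemma injectiveDimension_of_empty :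
    injectiveDimension (ModuleCat.of Γ Γ) = if IsEmpty H then ⊥ else 0 := by
  have h1 : injectiveDimension (ModuleCat.of Γ Γ) ≤ 0 :=
    (injectiveDimension_le_iff _ 0).2
      ((hQ.hasInjectiveDimensionLT_regular_iff hT (fun _ h => h.elim) 0).2 fun _ h => h.elim)
  have h2 : injectiveDimension (ModuleCat.of Γ Γ) = ⊥ ↔ IsEmpty H := by
    rw [injectiveDimension_eq_bot_iff, ← hQ.subsingleton_iff_of_empty hT,
      ModuleCat.isZero_iff_subsingleton]
  split_ifs with h
  · exact h2.2 h
  · refine le_antisymm h1 ?_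
    have h3 : injectiveDimension (ModuleCat.of Γ Γ) ≠ ⊥ := fun h4 => h (h2.1 h4)
    obtain ⟨x, hx⟩ := WithBot.ne_bot_iff_exists.1 h3
    rw [← hx]
    exact WithBot.coe_le_coe.2 zero_le

end IsLeafQuotient

namespace PlanarTree

variable {K : Type u} [Field K] {V : Type v} [Finite V] (T : PlanarTree V) {m : V → ℕ}
  (hm : ∀ a, 0 < m a) {A : Type w} [Ring A] [Algebra K A]
include hm

section

variable {W : Set T.graph.Dart} (hA : T.IsSpecialGendoBrauer K m W A)
include hA

lemma numSimples_eq_card : numSimples A = Nat.card (T.enlarged m W).Edge := by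
  have := T.finite_dart
  have hT := T.isBrauer_enlarged m W hm
  obtain ⟨-, -, -, ⟨E⟩⟩ := dimensions_of_isMoritaEquivalent hA.morita
  exact ((T.isLeafQuotient_gendoMk K m W hT).op hT.rev).numSimples_eq_card_edge hT A E

/-- Left modules follow the walk of the reversed tree, right modules that of the tree itself, since
reversing twice gives it back. The two sets of return times agree, hence the two injective
dimensions. -/
lemma hasGorensteinDim_and_domDim {a b : ℕ}
    (ha : IsGreatest ((fun h => (T.enlarged m W).returnTime (T.leaves W) h - 2) '' T.leaves W) a)
    (hb : IsLeast ((fun h => (T.enlarged m W).returnTime (T.leaves W) h - 2) '' T.leaves W) b) :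
    (∀ d : WithBot ℕ∞, HasGorensteinDim A d ↔ d = (a : ℕ∞)) ∧ domDim A = b := by
  have := T.finite_dart
  have hT := T.isBrauer_enlarged m W hm
  obtain ⟨h1, h2, h3, -⟩ := dimensions_of_isMoritaEquivalent hA.morita
  have hQ := T.isLeafQuotient_gendoMk K m W hT
  have hQ' := hQ.op hT.rev
  have ha' : IsGreatest
      ((fun h => (T.enlarged m W).rev.returnTime (T.leaves W) h - 2) '' T.leaves W) a := by
    have h4 := hT.returnTime_image_rev fun h hh => T.succ_leaf m W hh
    have h5 := congrArg (fun s => (fun n => n - 2) '' s) h4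
    simp only [Set.image_image] at h5
    rwa [h5]
  rw [hQ.injectiveDimension_regular hT.rev
    (fun h hh => T.three_le_returnTime_rev m W hT hh) ha'] at h1
  rw [hQ'.injectiveDimension_regular hT (fun h hh => T.three_le_returnTime m W hT hh) ha] at h2
  refine ⟨fun d => ?_, ?_⟩
  · rw [HasGorensteinDim, h1, h2, and_self, eq_comm]
  · rw [domDim_eq]
    have h4 : ∀ n, HasDomDimGE n (ModuleCat.of Aᵐᵒᵖ A) ↔ n ≤ b := by
      intro n
      rw [h3, hQ'.hasDomDimGE_regular_iff hT fun h hh => T.three_le_returnTime m W hT hh]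
      constructor
      · intro h
        obtain ⟨k, hk, hk2⟩ := hb.1
        exact (h k hk).trans hk2.le
      · intro h k hk
        exact h.trans (hb.2 ⟨k, hk, rfl⟩)
    simp only [h4]
    refine le_antisymm (sSup_le ?_) (le_sSup ⟨b, rfl, le_rfl⟩)
    rintro _ ⟨n, rfl, hn⟩
    exact_mod_cast hn

end

variable (hA : T.IsSpecialGendoBrauer K m ∅ A)
include hA

open Classical in
lemma dimensions_of_empty : IsSymmetricAlgebra A K ∧
    (∀ d : WithBot ℕ∞, HasGorensteinDim A d ↔ d = if IsEmpty T.graph.Dart then ⊥ else 0) ∧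
    domDim A = ⊤ := by
  have := T.finite_dart
  have hT := T.isBrauer_enlarged m ∅ hm
  obtain ⟨h1, h2, h3, -⟩ := dimensions_of_isMoritaEquivalent hA.morita
  have hQ := T.isLeafQuotient_gendoMk K m ∅ hT
  have hL : T.leaves ∅ = ∅ := Set.range_eq_empty _
  rw [hL] at hQ
  have hQ' := hQ.op hT.rev
  have hemp : IsEmpty (T.graph.Dart ⊕ ((∅ : Set T.graph.Dart) ⊕ (∅ : Set T.graph.Dart))) ↔
      IsEmpty T.graph.Dart := by
    rw [isEmpty_sum, isEmpty_sum]
    exact and_iff_left ⟨inferInstance, inferInstance⟩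
  rw [hQ.injectiveDimension_of_empty hT.rev, if_congr hemp rfl rfl] at h1
  rw [hQ'.injectiveDimension_of_empty hT, if_congr hemp rfl rfl] at h2
  refine ⟨IsSymmetricAlgebra.of_isMoritaEquivalent hA.morita
    (hQ.isSymmetricAlgebra_of_empty hT.rev), fun d => ?_, ?_⟩
  · rw [HasGorensteinDim, h1, h2, and_self, eq_comm]
  · rw [domDim_eq, eq_top_iff]
    refine le_of_forall_lt fun c hc => ?_
    lift c to ℕ using hc.ne
    refine lt_of_lt_of_le (b := ((c + 1 : ℕ) : ℕ∞)) (by exact_mod_cast Nat.lt_succ_self c)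
      (le_sSup ⟨c + 1, rfl, ?_⟩)
    exact (h3 _).2 ((hQ'.hasDomDimGE_regular_iff hT (fun _ h => h.elim) _).2 fun _ h => h.elim)

end PlanarTree

end GendoBrauer

/-! ### Extremal gaps and the main theorem. -/

namespace GendoBrauer

open HalfEdgeData

lemma exists_isGreatest_isLeast (s : Set ℕ) (hs : s.Finite) (hne : s.Nonempty) :
    ∃ a b, IsGreatest s a ∧ IsLeast s b :=
  ⟨sSup s, sInf s, ⟨Nat.sSup_mem hne hs.bddAbove, fun _ hx => le_csSup hs.bddAbove hx⟩,
    ⟨Nat.sInf_mem hne, fun _ hx => Nat.sInf_le hx⟩⟩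

lemma PlanarTree.exists_extrema {V : Type v} [Finite V] (T : PlanarTree V) (m : V → ℕ)
    {W : Set T.graph.Dart} (hW : W.Nonempty) :
    ∃ a b, IsGreatest ((fun h => (T.enlarged m W).returnTime (T.leaves W) h - 2) '' T.leaves W) a ∧
      IsLeast ((fun h => (T.enlarged m W).returnTime (T.leaves W) h - 2) '' T.leaves W) b := by
  have := T.finite_dart
  obtain ⟨h, hh⟩ := hW
  exact exists_isGreatest_isLeast _ (Set.toFinite _) ⟨_, _, ⟨⟨h, hh⟩, rfl⟩, rfl⟩

end GendoBrauer

theorem mainTheorem4 {K : Type u} [Field K] {V : Type v} [Finite V]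
    (T : GendoBrauer.PlanarTree V) (m : V → ℕ) (hm : GendoBrauer.IsMultiplicity m)
    (W : Set T.graph.Dart) (A : Type w) [Ring A] [Algebra K A] [FiniteDimensional K A]
    (hA : T.IsSpecialGendoBrauer K m W A) :
    (¬ GendoBrauer.IsSymmetricAlgebra A K → ∀ n : ℕ, GendoBrauer.numSimples A = n →
      (∃ g : ZMod (2 * n) → T.graph.Dart ⊕ (W ⊕ W),
        GendoBrauer.IsGreenWalk (T.enlarged m W) n g) ∧
      ∀ g : ZMod (2 * n) → T.graph.Dart ⊕ (W ⊕ W),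
        GendoBrauer.IsGreenWalk (T.enlarged m W) n g →
        ∃ a b : ℕ, IsGreatest (GendoBrauer.gaps g) a ∧ IsLeast (GendoBrauer.gaps g) b ∧
          GendoBrauer.HasGorensteinDim A (a : ℕ∞) ∧ GendoBrauer.domDim A = b) ∧
    GendoBrauer.IsIwanagaGorenstein A ∧
    ∀ (m' : V → ℕ), GendoBrauer.IsMultiplicity m' →
      ∀ (A' : Type w) [Ring A'] [Algebra K A'] [FiniteDimensional K A'],
        T.IsSpecialGendoBrauer K m' W A' →
        (∀ d : WithBot ℕ∞, GendoBrauer.HasGorensteinDim A d ↔ GendoBrauer.HasGorensteinDim A' d) ∧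
        GendoBrauer.domDim A = GendoBrauer.domDim A' := by
  classical
  have := T.finite_dart
  rcases W.eq_empty_or_nonempty with rfl | hW
  -- With no new leaves `A` is symmetric, so the first claim is vacuous; the dimensions do not
  -- depend on the multiplicities.
  · obtain ⟨h1, h2, h3⟩ := T.dimensions_of_empty hm.1 hA
    refine ⟨fun h => absurd h1 h, ⟨_, ?_, (h2 _).2 rfl⟩, ?_⟩
    · split_ifs
      · exact WithBot.bot_ne_coe
      · exact fun h => absurd (WithBot.coe_injective h) (by simp)
    · intro m' hm' A' _ _ _ hA'
      obtain ⟨-, h2', h3'⟩ := T.dimensions_of_empty hm'.1 hA'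
      exact ⟨fun d => (h2 d).trans (h2' d).symm, h3.trans h3'.symm⟩
  · obtain ⟨a, b, ha, hb⟩ := T.exists_extrema m hW
    obtain ⟨h1, h2⟩ := T.hasGorensteinDim_and_domDim hm.1 hA ha hb
    have hT := T.isBrauer_enlarged m W hm.1
    refine ⟨fun _ n hn => ?_, ⟨_, ?_, (h1 _).2 rfl⟩, ?_⟩
    · rw [T.numSimples_eq_card hm.1 hA] at hn
      subst hn
      obtain ⟨k, hk⟩ := hW
      have : Nonempty (T.graph.Dart ⊕ (W ⊕ W)) := ⟨.inl k⟩
      refine ⟨hT.exists_greenWalk (T.exists_iterate_green_eq m W), fun g hg => ?_⟩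
      have hpos : 0 < Nat.card (T.enlarged m W).Edge := by
        have : Nonempty (T.enlarged m W).Edge := ⟨(T.enlarged m W).edge (.inl k)⟩
        exact Nat.card_pos
      have hgaps := GendoBrauer.gaps_eq hT (T.exists_iterate_green_eq m W) hpos hg
      refine ⟨a, b, ?_, ?_, (h1 _).2 rfl, h2⟩
      · rw [hgaps]; exact ha
      · rw [hgaps]; exact hb
    · exact fun h => absurd (WithBot.coe_injective h) (ENat.natCast_ne_top a)
    · intro m' hm' A' _ _ _ hA'
      -- The extrema found for `m` serve for `m'` as they stand, because return times depend only on
      -- `opp` and `succ`.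
      obtain ⟨h1', h2'⟩ := T.hasGorensteinDim_and_domDim hm'.1 hA' (a := a) (b := b) ha hb
      exact ⟨fun d => (h1 d).trans (h1' d).symm, h2.trans h2'.symm⟩
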